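/- Let $P\subset\mathbb{C}$ be the union of the lower rectangle $[-\tfrac12,\tfrac12]\times[0,\tfrac12]$ and the upper rectangle $[0,1]\times[\tfrac12,1]$. Divide the boundary of $P$ into edges, and glue them in pairs by translations, as follows ($n\ge 1$): <br>(unlabeled) the edge from $-\tfrac12+\tfrac i2$ to $\tfrac i2$ is glued to its translate by $1$; <br>($A_n$) the edge from $1+i(1-2^{-n})$ to $1+i(1-2^{-n-1})$ is glued to its translate by $-\tfrac32-\tfrac i3(2-2^{-n})$ if $n$ is odd, and by $-1-\tfrac i3(1-2^{-n})$ if $n$ is even; <br>($B_n$) the edge from $\tfrac12+i2^{-n-1}$ to $\tfrac12+i2^{-n}$ is glued to its translate by $-\tfrac12+\tfrac i3(2-2^{-n})$ if $n$ is odd, and by $-1+\tfrac i3(1-2^{-n})$ if $n$ is even; <br>($C'_n$) the edge from $1-2^{1-n}+i$ to $1-2^{1-n}+2^{-n-1}+i$ is glued to its translate by $-\tfrac12+2^{-n-1}-i$; <br>($C''_n$) the edge from $1-2^{1-n}+2^{-n-1}+i$ to $1-2^{-n}+i$ is glued to its translate by $-\tfrac12-2^{-n-1}-i$. <br>Let $X_\infty$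 be the space obtained from $P$ by removing the endpoints of all edges and the limit points of these endpoints, and making these identifications. The local coordinates that agree with $z$ up to additive constants are the charts of $X_\infty$, and $\omega_\infty$ is the $1$-form induced by $\mathrm{d}z$. **Theorem.** $X_\infty$ (with these charts) is a Riemann surface, it has infinite genus and exactly one end, and $\omega_\infty$ is an abelian differential (holomorphic $1$-form) of finite area on $X_\infty$ that has no zeros on $X_\infty$. The group $\mathrm{Aff}(X_\infty,\omega_\infty)$ of homeomorphisms of $X_\infty$ that are affine in the local coordinates with differential $\omega_\infty$ contains an orientation-reversing involution $\rho_\infty$ without fixed points that is an isometry of the metric $|\omega_\infty|^2$, and an orientation-preserving pseudo-Anosov homeomorphism $\psi_\infty$ with expansion constant $2$ (it preserves the straight-line foliations in two directions, stretching the leaves of one by the factor $2$ and shrinking those of the other by the factor $2$). The maps $\rho_\infty$ and $\psi_\infty$ commute. -/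

import Mathlib

open scoped Manifold ContDiff Topology ENNReal
open Set

noncomputable section

namespace InfiniteAY

/-! ## Topology of surfaces: genus and ends -/

/-- The genus of a connected orientable surface: the largest number (possibly infinite) of pairwise
disjoint simple closed curves whose union does not disconnect the surface. -/
def genus (X : Type*) [TopologicalSpace X] : ℕ∞ :=
  ⨆ (g : ℕ) (_ : ∃ γ : Fin g → Circle → X,
      (∀ i, Continuous (γ i) ∧ Function.Injective (γ i)) ∧
      (Pairwise fun i j => Disjoint (range (γ i)) (range (γ j))) ∧
      IsConnected (⋃ i, range (γ i))ᶜ), (g : ℕ∞)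

/-- The map on connected components of complements induced by an inclusion of compact sets. -/
def restrictComponent {X : Type*} [TopologicalSpace X] {K L : TopologicalSpace.Compacts X}
    (h : K ≤ L) :
    ConnectedComponents ↥((L : Set X)ᶜ) → ConnectedComponents ↥((K : Set X)ᶜ) :=
  (continuous_inclusion (compl_subset_compl.2 h)).connectedComponentsMap

/-- The (Freudenthal) ends of a space: the inverse limit, over the compact subsets `K`, of the sets
of connected components of the complement of `K`. -/
def End (X : Type*) [TopologicalSpace X] : Type _ :=
  {e : ∀ K : TopologicalSpace.Compacts X, ConnectedComponents ↥((K : Set X)ᶜ) //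
    ∀ (K L : TopologicalSpace.Compacts X) (h : K ≤ L), restrictComponent h (e L) = e K}

/-- The space has exactly one end. -/
def HasOneEnd (X : Type*) [TopologicalSpace X] : Prop := ∃ e : End X, ∀ e' : End X, e' = e

/-! ## Riemann surfaces and abelian differentials -/

section RiemannSurface

variable (X : Type*) [TopologicalSpace X] [ChartedSpace ℂ X]

/-- A Riemann surface: a connected, Hausdorff, second countable complex manifold of dimension 1. -/
structure IsRiemannSurface : Prop where
  t2 : T2Space X
  secondCountable : SecondCountableTopology X
  connected : ConnectedSpace X
  manifold : IsManifold 𝓘(ℂ) ω X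

/-- A complex-linear form on each tangent space. -/
abbrev OneForm : Type _ := ∀ x : X, TangentSpace 𝓘(ℂ) x →L[ℂ] ℂ

variable {X}

/-- The coefficient `f` in the expression `f dz` of the form `η` in the chart `e`. -/
def OneForm.coeff (η : OneForm X) (e : OpenPartialHomeomorph X ℂ) (z : ℂ) : ℂ :=
  η (e.symm z) (mfderiv 𝓘(ℂ) 𝓘(ℂ) e.symm z (1 : ℂ))

/-- `η` is an abelian differential (a holomorphic 1-form): its coefficient in every chart
is holomorphic. -/
def OneForm.IsHolomorphic (η : OneForm X) : Prop :=
  ∀ e ∈ atlas ℂ X, DifferentiableOn ℂ (η.coeff e) e.target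

/-- The area of the surface with respect to the area form of `|η|²` (which is `|f|² dx dy` where
`η = f dz`): the supremum of the total area of finitely many disjoint Borel pieces, each of them
contained in a chart. -/
def OneForm.area (η : OneForm X) : ℝ≥0∞ :=
  ⨆ (n : ℕ) (e : Fin n → OpenPartialHomeomorph X ℂ) (S : Fin n → Set ℂ)
    (_ : ∀ i, e i ∈ atlas ℂ X ∧ S i ⊆ (e i).target ∧ MeasurableSet (S i))
    (_ : Pairwise fun i j => Disjoint ((e i).symm '' S i) ((e j).symm '' S j)),
    ∑ i, ∫⁻ z in S i, ‖η.coeff (e i) z‖ₑ ^ 2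

/-- The canonical charts of `η`: the holomorphic charts `φ` with `dφ = η`. -/
def OneForm.IsCanonicalChart (η : OneForm X) (φ : OpenPartialHomeomorph X ℂ) : Prop :=
  φ ∈ IsManifold.maximalAtlas 𝓘(ℂ) ω X ∧ ∀ x ∈ φ.source, mfderiv 𝓘(ℂ) 𝓘(ℂ) φ x = η x

/-- The homeomorphism `f` is affine with respect to the canonical charts of `η`, and its derivative
in these charts is the real-linear automorphism `A` of the plane. -/
def OneForm.HasDer (η : OneForm X) (f : X ≃ₜ X) (A : ℂ ≃L[ℝ] ℂ) : Prop :=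
  ∀ (x : X) (φ χ : OpenPartialHomeomorph X ℂ), η.IsCanonicalChart φ → η.IsCanonicalChart χ →
    x ∈ φ.source → f x ∈ χ.source → ∃ c : ℂ, ∀ᶠ y in 𝓝 x, χ (f y) = A (φ y) + c

/-- The affine homeomorphisms of `(X, η)`. -/
def OneForm.Aff (η : OneForm X) : Set (X ≃ₜ X) := {f | ∃ A, η.HasDer f A}

/-- `f` is affine and reverses the orientation. -/
def OneForm.ReversesOrientation (η : OneForm X) (f : X ≃ₜ X) : Prop :=
  ∃ A, η.HasDer f A ∧ LinearMap.det (A : ℂ →ₗ[ℝ] ℂ) < 0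

/-- `f` is affine and preserves the orientation. -/
def OneForm.PreservesOrientation (η : OneForm X) (f : X ≃ₜ X) : Prop :=
  ∃ A, η.HasDer f A ∧ 0 < LinearMap.det (A : ℂ →ₗ[ℝ] ℂ)

/-- `f` is an isometry of the flat metric `|η|²`: it is affine with orthogonal derivative. -/
def OneForm.IsIsometric (η : OneForm X) (f : X ≃ₜ X) : Prop :=
  ∃ A, η.HasDer f A ∧ ∀ v : ℂ, ‖A v‖ = ‖v‖

/-- `f` is an affine pseudo-Anosov homeomorphism with expansion constant `k > 1`: it preserves
the foliations of `(X, η)` by straight lines in two directions `u` and `s`, stretching the leaves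
in direction `u` by the factor `k` and shrinking those in direction `s` by the factor `k`. -/
def OneForm.IsPseudoAnosov (η : OneForm X) (f : X ≃ₜ X) (k : ℝ) : Prop :=
  1 < k ∧ ∃ A, η.HasDer f A ∧ ∃ u s : ℂ, u ≠ 0 ∧ s ≠ 0 ∧
    (A u = k • u ∨ A u = -(k • u)) ∧ (A s = k⁻¹ • s ∨ A s = -(k⁻¹ • s))

end RiemannSurface

/-! ## The surface

The polygon is the union of the lower rectangle `[-1/2, 1/2] × [0, 1/2]` and the upper rectangle
`[0, 1] × [1/2, 1]`. Its boundary is divided into countably many edges, which are glued in pairs by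
translations; the endpoints of the edges and their limit points do not belong to the surface. -/

/-- The pairs of edges. The number `n : ℕ` stands for the label `n + 1`, so that the edges
`A n`, `B n`, `C' n`, `C'' n` have length `1 / 2 ^ (n + 2)`. -/
inductive Edge : Type
  | unlabeled : Edge
  | A : ℕ → Edge
  | B : ℕ → Edge
  | C' : ℕ → Edge
  | C'' : ℕ → Edge

/-- The left (lower) endpoint of the first edge of a pair. This first edge lies on the top of the
left half of the lower rectangle (`unlabeled`), on the right side of the upper rectangle (`A`), on
the right side of the lower rectangle (`B`), on the top of the upper rectangle (`C'`, `C''`). -/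
def Edge.start : Edge → ℂ
  | .unlabeled => ⟨-1 / 2, 1 / 2⟩
  | .A n => ⟨1, 1 - 1 / 2 ^ (n + 1)⟩
  | .B n => ⟨1 / 2, 1 / 2 ^ (n + 2)⟩
  | .C' n => ⟨1 - 1 / 2 ^ n, 1⟩
  | .C'' n => ⟨1 - 1 / 2 ^ n + 1 / 2 ^ (n + 2), 1⟩

/-- The vector from the left (lower) to the right (upper) endpoint of an edge. -/
def Edge.vec : Edge → ℂ
  | .unlabeled => ⟨1 / 2, 0⟩
  | .A n => ⟨0, 1 / 2 ^ (n + 2)⟩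
  | .B n => ⟨0, 1 / 2 ^ (n + 2)⟩
  | .C' n => ⟨1 / 2 ^ (n + 2), 0⟩
  | .C'' n => ⟨1 / 2 ^ (n + 2), 0⟩

/-- The translation that carries the first edge of a pair to the second one. The second edge lies
on the bottom of the right half of the upper rectangle (`unlabeled`), on the bottom of the lower
rectangle (`C'`, `C''`), on the left side of the upper or of the lower rectangle (`A`, `B`). -/
def Edge.shift : Edge → ℂ
  | .unlabeled => ⟨1, 0⟩
  | .A n => if Even n then ⟨-3 / 2, -(2 - 1 / 2 ^ (n + 1)) / 3⟩
      else ⟨-1, -(1 - 1 / 2 ^ (n + 1)) / 3⟩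
  | .B n => if Even n then ⟨-1 / 2, (2 - 1 / 2 ^ (n + 1)) / 3⟩
      else ⟨-1, (1 - 1 / 2 ^ (n + 1)) / 3⟩
  | .C' n => ⟨-1 / 2 + 1 / 2 ^ (n + 2), -1⟩
  | .C'' n => ⟨-1 / 2 - 1 / 2 ^ (n + 2), -1⟩

/-- The first edge of a pair, without its endpoints. -/
def Edge.side (e : Edge) : Set ℂ := openSegment ℝ e.start (e.start + e.vec)

/-- The interior of the polygon: the union of the interiors of the lower rectangle, of the central
rectangle, and of the upper rectangle. -/
def polygonInterior : Set ℂ :=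
  (Ioo (-1 / 2) (1 / 2) ×ℂ Ioo 0 (1 / 2)) ∪ (Ioo 0 (1 / 2) ×ℂ Ioo 0 1) ∪
    (Ioo 0 1 ×ℂ Ioo (1 / 2) 1)

/-- The polygon with its edges, but without the endpoints of the edges and their limit points. -/
def polygon : Set ℂ :=
  polygonInterior ∪ ⋃ e : Edge, (e.side ∪ (fun z => z + e.shift) '' e.side)

/-- A point of the first edge of a pair is glued to its translate on the second one. -/
def Glue (p q : polygon) : Prop := ∃ e : Edge, (p : ℂ) ∈ e.side ∧ (q : ℂ) = p + e.shift

/-- The surface `X_∞`, with the quotient topology. -/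
def XInf : Type := Quot Glue

instance : TopologicalSpace XInf := inferInstanceAs (TopologicalSpace (Quot Glue))

/-- The projection of the polygon to the surface. -/
def proj (p : polygon) : XInf := Quot.mk Glue p

/-- The local coordinates on `X_∞` induced by the coordinate `z` of the plane: they coincide with
`z`, up to additive constants, near each point of the polygon. -/
def translationAtlas : Set (OpenPartialHomeomorph XInf ℂ) :=
  {φ | ∀ p : polygon, proj p ∈ φ.source → ∃ c : ℂ, ∀ᶠ q in 𝓝 p, φ (proj q) = q + c}

/-- Around every point of `X_∞` there is a local coordinate induced by `z`. -/
def HasLocalCoordinates : Prop := ∀ x : XInf, ∃ φ ∈ translationAtlas, x ∈ φ.source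

/-- The structure on `X_∞` given by the local coordinates induced by `z`. -/
@[reducible] def chartedSpaceXInf (h : HasLocalCoordinates) : ChartedSpace ℂ XInf where
  atlas := translationAtlas
  chartAt x := (h x).choose
  mem_chart_source x := (h x).choose_spec.2
  chart_mem_atlas x := (h x).choose_spec.1

/-- The 1-form `ω_∞` on `X_∞` induced by `dz`: at each point, it is the differential of a local
coordinate induced by `z`. -/
def omegaInf (h : HasLocalCoordinates) : @OneForm XInf _ (chartedSpaceXInf h) :=
  letI := chartedSpaceXInf h
  fun x => mfderiv 𝓘(ℂ) 𝓘(ℂ) (chartAt ℂ x) x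

end InfiniteAY

end

open InfiniteAY

/-! Indices are those of `Edge`, starting at 0; a vertex is an endpoint of an edge or a limit of
endpoints.

Surface. The edges are pairwise disjoint, so at most two points are ever glued together
(`pr_eq_pr`). Each edge has a slab: one half lies in the polygon, the other is carried into it by
the gluing translation. The embeddings `Edge.unfold` of these countably many slabs, with that of the
interior, provide charts. Coordinate changes are locally translations, so they are holomorphic and
`ω_∞` has coefficient 1 in every chart: it is holomorphic without zeros, and its area is at most
that of the polygon.

Symmetries. Both maps are affine on finitely many closed pieces of the polygon; `Pieces` lists what
must be checked where pieces or edges meet. The map `rho` exchanges the two rectangles by (x, y) ↦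
(x ± 1/2, 1 - y), and thereby the pair A n with B n, and C' n with C'' n. A fixed point would force
a gluing translation with real part ±1/2; `shift_re_im` leaves one such case, which the imaginary
part excludes. The map `psi` has linear part diag(1/2, 2). It carries the lower rectangle onto [0,
1/2] × [0, 1], and the bottom and top halves of the upper rectangle onto the squares to the left and
to the right of it. It respects the gluing because the edges shrink geometrically with ratio 1/2: A
(n + 1), B (n + 1) go to A n, B n, while C' n, C'' n go to C' (n + 1), C'' (n + 1). At the start of
the sequences, A 0 and B 0 are absorbed into the interior, and C' 0, C'' 0 and the unlabeled pair
arise from the unlabeled pair and the two cuts.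

Genus. For odd n both edges A n lie on the upper rectangle, and a chord between their midpoints
closes up to a simple closed curve. These chords are disjoint. Any finite number of them leaves the
surface connected, because every strip between chords meets an edge A n with n even, which leads to
the lower rectangle (`isConnected_compl_chords`).

End. By `hasOneEnd_of_forall_compact` it suffices to find, outside any compact set, a connected set
with relatively compact complement. Small squares around the vertices of the upper rectangle,
together with their images under `rho`, form such a set. Compactness of what remains is that of a
closed rectangle minus open squares. Connectedness follows along edges: the squares at corresponding
endpoints of glued edges meet, and a square at a limit point meets those of all nearby vertices. The
resulting chain reaches all vertices in both halves of the surface (`forall_vertex`). -/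

noncomputable section

namespace InfiniteAY

/-! ## Coordinates of the edges -/

/-- The powers of `1/2`. -/
def dyad (n : ℕ) : ℝ := 1 / 2 ^ n

lemma dyad_pos (n : ℕ) : 0 < dyad n := by unfold dyad; positivity

lemma dyad_zero : dyad 0 = 1 := by simp [dyad]

lemma dyad_succ (n : ℕ) : dyad (n + 1) = dyad n / 2 := by
  unfold dyad; rw [pow_succ]; field_simp

lemma dyad_anti {m n : ℕ} (h : m ≤ n) : dyad n ≤ dyad m := by
  unfold dyad; gcongr; norm_num

lemma dyad_le_one (n : ℕ) : dyad n ≤ 1 := dyad_zero ▸ dyad_anti (Nat.zero_le n)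

lemma dyad_le_half {n : ℕ} (h : 1 ≤ n) : dyad n ≤ 1 / 2 := by
  have := dyad_anti h
  rwa [dyad_succ, dyad_zero] at this

lemma dyad_odd_le {n : ℕ} (h : ¬ Even n) : dyad n ≤ 1 / 2 :=
  dyad_le_half (Nat.one_le_iff_ne_zero.2 (by rintro rfl; simp at h))

lemma dyad_succ_le {m n : ℕ} (h : m < n) : dyad n ≤ dyad m / 2 := by
  have := dyad_anti (Nat.succ_le_of_lt h)
  rwa [Nat.succ_eq_add_one, dyad_succ] at this

/-- Distinct indices of equal parity differ by at least 2. This matters on the left sides, where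
only every second index occurs in each sequence of edges. -/
lemma dyad_succ_succ_le {m n : ℕ} (h : m < n) (hmn : Even m ↔ Even n) :
    dyad n ≤ dyad m / 4 := by
  have h2 : m + 1 + 1 ≤ n := by
    rcases Nat.lt_or_ge (m + 1) n with h1 | h1
    · exact h1
    · obtain rfl : n = m + 1 := by omega
      rw [Nat.even_add_one] at hmn
      tauto
  have := dyad_anti h2
  rw [dyad_succ, dyad_succ] at this
  linarith

lemma mem_openSegment_horizontal {a z : ℂ} {l : ℝ} (hl : 0 < l) :
    z ∈ openSegment ℝ a (a + ⟨l, 0⟩) ↔ z.im = a.im ∧ a.re < z.re ∧ z.re < a.re + l := by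
  rw [openSegment_eq_image']
  constructor
  · rintro ⟨t, ⟨h0, h1⟩, rfl⟩
    simp
    exact ⟨by positivity, by nlinarith⟩
  · rintro ⟨h, h0, h1⟩
    refine ⟨(z.re - a.re) / l, ⟨div_pos (by linarith) hl, (div_lt_one hl).2 (by linarith)⟩, ?_⟩
    apply Complex.ext
    · simp; field_simp; ring
    · simp [h]

lemma mem_openSegment_vertical {a z : ℂ} {l : ℝ} (hl : 0 < l) :
    z ∈ openSegment ℝ a (a + ⟨0, l⟩) ↔ z.re = a.re ∧ a.im < z.im ∧ z.im < a.im + l := by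
  rw [openSegment_eq_image']
  constructor
  · rintro ⟨t, ⟨h0, h1⟩, rfl⟩
    simp
    exact ⟨by positivity, by nlinarith⟩
  · rintro ⟨h, h0, h1⟩
    refine ⟨(z.im - a.im) / l, ⟨div_pos (by linarith) hl, (div_lt_one hl).2 (by linarith)⟩, ?_⟩
    apply Complex.ext
    · simp [h]
    · simp; field_simp; ring

lemma one_div_two_pow_one (n : ℕ) : (1 : ℝ) / 2 ^ (n + 1) = dyad n / 2 := dyad_succ n

lemma one_div_two_pow_two (n : ℕ) : (1 : ℝ) / 2 ^ (n + 2) = dyad n / 4 := by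
  unfold dyad; rw [pow_add]; field_simp; norm_num

lemma one_div_two_pow (n : ℕ) : (1 : ℝ) / 2 ^ n = dyad n := rfl

namespace Edge

lemma start_A (n : ℕ) : (A n).start = ⟨1, 1 - dyad n / 2⟩ := by simp only [start, one_div_two_pow_one]
lemma start_B (n : ℕ) : (B n).start = ⟨1 / 2, dyad n / 4⟩ := by simp only [start, one_div_two_pow_two]
lemma start_C' (n : ℕ) : (C' n).start = ⟨1 - dyad n, 1⟩ := by simp only [start, one_div_two_pow]
lemma start_C'' (n : ℕ) : (C'' n).start = ⟨1 - dyad n + dyad n / 4, 1⟩ := by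
  simp only [start, one_div_two_pow_two, one_div_two_pow]
lemma vec_A (n : ℕ) : (A n).vec = ⟨0, dyad n / 4⟩ := by simp only [vec, one_div_two_pow_two]
lemma vec_B (n : ℕ) : (B n).vec = ⟨0, dyad n / 4⟩ := by simp only [vec, one_div_two_pow_two]
lemma vec_C' (n : ℕ) : (C' n).vec = ⟨dyad n / 4, 0⟩ := by simp only [vec, one_div_two_pow_two]
lemma vec_C'' (n : ℕ) : (C'' n).vec = ⟨dyad n / 4, 0⟩ := by simp only [vec, one_div_two_pow_two]

lemma shift_unlabeled : unlabeled.shift = ⟨1, 0⟩ := rfl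
lemma shift_A_even {n : ℕ} (h : Even n) : (A n).shift = ⟨-3 / 2, -(2 - dyad n / 2) / 3⟩ := by
  simp only [shift, h, if_true, one_div_two_pow_one]
lemma shift_A_odd {n : ℕ} (h : ¬ Even n) : (A n).shift = ⟨-1, -(1 - dyad n / 2) / 3⟩ := by
  simp only [shift, h, if_false, one_div_two_pow_one]
lemma shift_B_even {n : ℕ} (h : Even n) : (B n).shift = ⟨-1 / 2, (2 - dyad n / 2) / 3⟩ := by
  simp only [shift, h, if_true, one_div_two_pow_one]
lemma shift_B_odd {n : ℕ} (h : ¬ Even n) : (B n).shift = ⟨-1, (1 - dyad n / 2) / 3⟩ := by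
  simp only [shift, h, if_false, one_div_two_pow_one]
lemma shift_C' (n : ℕ) : (C' n).shift = ⟨-1 / 2 + dyad n / 4, -1⟩ := by
  simp only [shift, one_div_two_pow_two]
lemma shift_C'' (n : ℕ) : (C'' n).shift = ⟨-1 / 2 - dyad n / 4, -1⟩ := by
  simp only [shift, one_div_two_pow_two]

/-- The second edge of a pair, without its endpoints. -/
def side' (e : Edge) : Set ℂ := (fun z => z + e.shift) '' e.side

variable {z : ℂ}

lemma mem_side_unlabeled : z ∈ unlabeled.side ↔ z.im = 1 / 2 ∧ -1 / 2 < z.re ∧ z.re < 0 := by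
  simp only [side, start, vec]
  rw [mem_openSegment_horizontal (by norm_num)]
  norm_num

lemma mem_side_A {n : ℕ} :
    z ∈ (A n).side ↔ z.re = 1 ∧ 1 - dyad n / 2 < z.im ∧ z.im < 1 - dyad n / 4 := by
  have := dyad_pos n
  rw [side, start_A, vec_A, mem_openSegment_vertical (by linarith)]
  simp only
  refine and_congr_right fun _ => and_congr_right fun _ => ?_
  constructor <;> intro h <;> linarith

lemma mem_side_B {n : ℕ} :
    z ∈ (B n).side ↔ z.re = 1 / 2 ∧ dyad n / 4 < z.im ∧ z.im < dyad n / 2 := by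
  have := dyad_pos n
  rw [side, start_B, vec_B, mem_openSegment_vertical (by linarith)]
  simp only
  refine and_congr_right fun _ => and_congr_right fun _ => ?_
  constructor <;> intro h <;> linarith

lemma mem_side_C' {n : ℕ} :
    z ∈ (C' n).side ↔ z.im = 1 ∧ 1 - dyad n < z.re ∧ z.re < 1 - 3 * dyad n / 4 := by
  have := dyad_pos n
  rw [side, start_C', vec_C', mem_openSegment_horizontal (by linarith)]
  simp only
  refine and_congr_right fun _ => and_congr_right fun _ => ?_
  constructor <;> intro h <;> linarith

lemma mem_side_C'' {n : ℕ} :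
    z ∈ (C'' n).side ↔ z.im = 1 ∧ 1 - 3 * dyad n / 4 < z.re ∧ z.re < 1 - dyad n / 2 := by
  have := dyad_pos n
  rw [side, start_C'', vec_C'', mem_openSegment_horizontal (by linarith)]
  simp only
  refine and_congr_right fun _ => and_congr ?_ ?_ <;> constructor <;> intro h <;> linarith

lemma mem_side' {e : Edge} : z ∈ e.side' ↔ z - e.shift ∈ e.side := by
  simp [side', sub_eq_add_neg]

lemma add_shift_mem_side' {e : Edge} (h : z ∈ e.side) : z + e.shift ∈ e.side' := ⟨z, h, rfl⟩

lemma mem_side'_unlabeled : z ∈ unlabeled.side' ↔ z.im = 1 / 2 ∧ 1 / 2 < z.re ∧ z.re < 1 := by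
  rw [mem_side', shift_unlabeled, mem_side_unlabeled]
  simp only [Complex.sub_re, Complex.sub_im]
  refine and_congr ?_ (and_congr ?_ ?_) <;> constructor <;> intro h <;> linarith

lemma mem_side'_A_even {n : ℕ} (h : Even n) :
    z ∈ (A n).side' ↔ z.re = -1 / 2 ∧ 1 / 3 - dyad n / 3 < z.im ∧ z.im < 1 / 3 - dyad n / 12 := by
  rw [mem_side', shift_A_even h, mem_side_A]
  simp only [Complex.sub_re, Complex.sub_im]
  refine and_congr ?_ (and_congr ?_ ?_) <;> constructor <;> intro h <;> linarith

lemma mem_side'_A_odd {n : ℕ} (h : ¬ Even n) :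
    z ∈ (A n).side' ↔ z.re = 0 ∧ 2 / 3 - dyad n / 3 < z.im ∧ z.im < 2 / 3 - dyad n / 12 := by
  rw [mem_side', shift_A_odd h, mem_side_A]
  simp only [Complex.sub_re, Complex.sub_im]
  refine and_congr ?_ (and_congr ?_ ?_) <;> constructor <;> intro h <;> linarith

lemma mem_side'_B_even {n : ℕ} (h : Even n) :
    z ∈ (B n).side' ↔ z.re = 0 ∧ 2 / 3 + dyad n / 12 < z.im ∧ z.im < 2 / 3 + dyad n / 3 := by
  rw [mem_side', shift_B_even h, mem_side_B]
  simp only [Complex.sub_re, Complex.sub_im]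
  refine and_congr ?_ (and_congr ?_ ?_) <;> constructor <;> intro h <;> linarith

lemma mem_side'_B_odd {n : ℕ} (h : ¬ Even n) :
    z ∈ (B n).side' ↔ z.re = -1 / 2 ∧ 1 / 3 + dyad n / 12 < z.im ∧ z.im < 1 / 3 + dyad n / 3 := by
  rw [mem_side', shift_B_odd h, mem_side_B]
  simp only [Complex.sub_re, Complex.sub_im]
  refine and_congr ?_ (and_congr ?_ ?_) <;> constructor <;> intro h <;> linarith

lemma mem_side'_C' {n : ℕ} :
    z ∈ (C' n).side' ↔ z.im = 0 ∧ 1 / 2 - 3 * dyad n / 4 < z.re ∧ z.re < 1 / 2 - dyad n / 2 := by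
  rw [mem_side', shift_C', mem_side_C']
  simp only [Complex.sub_re, Complex.sub_im]
  refine and_congr ?_ (and_congr ?_ ?_) <;> constructor <;> intro h <;> linarith

lemma mem_side'_C'' {n : ℕ} :
    z ∈ (C'' n).side' ↔ z.im = 0 ∧ 1 / 2 - dyad n < z.re ∧ z.re < 1 / 2 - 3 * dyad n / 4 := by
  rw [mem_side', shift_C'', mem_side_C'']
  simp only [Complex.sub_re, Complex.sub_im]
  refine and_congr ?_ (and_congr ?_ ?_) <;> constructor <;> intro h <;> linarith

/-- An edge avoids the interior of the polygon, and lies on one of four lines bounding it. -/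
lemma side_bounds {e : Edge} (h : z ∈ e.side) :
    (z.im = 1 / 2 ∧ -1 / 2 < z.re ∧ z.re < 0) ∨ (z.re = 1 ∧ 1 / 2 < z.im ∧ z.im < 1) ∨
    (z.re = 1 / 2 ∧ 0 < z.im ∧ z.im < 1 / 2) ∨ (z.im = 1 ∧ 0 < z.re ∧ z.re < 1) := by
  rcases e with _ | n | n | n | n
  · exact Or.inl (mem_side_unlabeled.1 h)
  · have h := mem_side_A.1 h
    have := dyad_pos n; have := dyad_le_one n
    exact Or.inr <| Or.inl ⟨h.1, by linarith, by linarith⟩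
  · have h := mem_side_B.1 h
    have := dyad_pos n; have := dyad_le_one n
    exact Or.inr <| Or.inr <| Or.inl ⟨h.1, by linarith, by linarith⟩
  · have h := mem_side_C'.1 h
    have := dyad_pos n; have := dyad_le_one n
    exact Or.inr <| Or.inr <| Or.inr ⟨h.1, by linarith, by linarith⟩
  · have h := mem_side_C''.1 h
    have := dyad_pos n; have := dyad_le_one n
    exact Or.inr <| Or.inr <| Or.inr ⟨h.1, by linarith, by linarith⟩

lemma side'_bounds {e : Edge} (h : z ∈ e.side') :
    (z.im = 1 / 2 ∧ 1 / 2 < z.re ∧ z.re < 1) ∨ (z.re = 0 ∧ 1 / 2 < z.im ∧ z.im < 1) ∨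
    (z.re = -1 / 2 ∧ 0 < z.im ∧ z.im < 1 / 2) ∨ (z.im = 0 ∧ -1 / 2 < z.re ∧ z.re < 1 / 2) := by
  rcases e with _ | n | n | n | n
  · exact Or.inl (mem_side'_unlabeled.1 h)
  · by_cases hn : Even n
    · have h := (mem_side'_A_even hn).1 h
      have := dyad_pos n; have := dyad_le_one n
      exact Or.inr <| Or.inr <| Or.inl ⟨h.1, by linarith, by linarith⟩
    · have h := (mem_side'_A_odd hn).1 h
      have := dyad_pos n; have := dyad_odd_le hn
      exact Or.inr <| Or.inl ⟨h.1, by linarith, by linarith⟩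
  · by_cases hn : Even n
    · have h := (mem_side'_B_even hn).1 h
      have := dyad_pos n; have := dyad_le_one n
      exact Or.inr <| Or.inl ⟨h.1, by linarith, by linarith⟩
    · have h := (mem_side'_B_odd hn).1 h
      have := dyad_pos n; have := dyad_odd_le hn
      exact Or.inr <| Or.inr <| Or.inl ⟨h.1, by linarith, by linarith⟩
  · have h := mem_side'_C'.1 h
    have := dyad_pos n; have := dyad_le_one n
    exact Or.inr <| Or.inr <| Or.inr ⟨h.1, by linarith, by linarith⟩
  · have h := mem_side'_C''.1 h
    have := dyad_pos n; have := dyad_le_one n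
    exact Or.inr <| Or.inr <| Or.inr ⟨h.1, by linarith, by linarith⟩

end Edge

/-! ### Incidence of the polygon and its edges -/

lemma mem_polygonInterior {z : ℂ} : z ∈ polygonInterior ↔
    (-1 / 2 < z.re ∧ z.re < 1 / 2 ∧ 0 < z.im ∧ z.im < 1 / 2) ∨
    (0 < z.re ∧ z.re < 1 / 2 ∧ 0 < z.im ∧ z.im < 1) ∨
    (0 < z.re ∧ z.re < 1 ∧ 1 / 2 < z.im ∧ z.im < 1) := by
  simp only [polygonInterior, mem_union, Complex.mem_reProdIm, mem_Ioo, and_assoc, or_assoc]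

lemma mem_polygon {z : ℂ} :
    z ∈ polygon ↔ z ∈ polygonInterior ∨ ∃ e : Edge, z ∈ e.side ∨ z ∈ e.side' := by
  simp only [polygon, mem_union, mem_iUnion, Edge.side']

lemma polygonInterior_subset : polygonInterior ⊆ polygon := subset_union_left

lemma side_subset (e : Edge) : e.side ⊆ polygon := fun _ h => mem_polygon.2 (.inr ⟨e, .inl h⟩)

lemma side'_subset (e : Edge) : e.side' ⊆ polygon := fun _ h => mem_polygon.2 (.inr ⟨e, .inr h⟩)

lemma notMem_side_of_interior {z : ℂ} (h : z ∈ polygonInterior) (e : Edge) : z ∉ e.side := by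
  intro h'
  rw [mem_polygonInterior] at h
  rcases Edge.side_bounds h' with h' | h' | h' | h' <;> rcases h with h | h | h <;> linarith

lemma notMem_side'_of_interior {z : ℂ} (h : z ∈ polygonInterior) (e : Edge) : z ∉ e.side' := by
  intro h'
  rw [mem_polygonInterior] at h
  rcases Edge.side'_bounds h' with h' | h' | h' | h' <;> rcases h with h | h | h <;> linarith

/-- First edges bound the polygon from above or from the right, second edges from below or from the
left; corners are excluded by the strict inequalities. -/
lemma notMem_side'_of_mem_side {z : ℂ} {e e' : Edge} (h : z ∈ e.side) : z ∉ e'.side' := by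
  intro h'
  rcases Edge.side'_bounds h' with h' | h' | h' | h' <;>
    rcases Edge.side_bounds h with h | h | h | h <;> linarith

lemma polygon_bounds {z : ℂ} (h : z ∈ polygon) :
    (-1 / 2 ≤ z.re ∧ z.re ≤ 1 / 2 ∧ 0 ≤ z.im ∧ z.im ≤ 1 / 2) ∨
    (0 ≤ z.re ∧ z.re ≤ 1 ∧ 1 / 2 ≤ z.im ∧ z.im ≤ 1) := by
  rcases mem_polygon.1 h with h | ⟨e, h | h⟩
  · rcases mem_polygonInterior.1 h with h | h | h
    · exact Or.inl ⟨by linarith, by linarith, by linarith, by linarith⟩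
    · rcases le_total z.im (1 / 2) with h2 | h2
      · exact Or.inl ⟨by linarith, by linarith, by linarith, by linarith⟩
      · exact Or.inr ⟨by linarith, by linarith, by linarith, by linarith⟩
    · exact Or.inr ⟨by linarith, by linarith, by linarith, by linarith⟩
  · rcases Edge.side_bounds h with h | h | h | h
    · exact Or.inl ⟨by linarith, by linarith, by linarith, by linarith⟩
    · exact Or.inr ⟨by linarith, by linarith, by linarith, by linarith⟩
    · exact Or.inl ⟨by linarith, by linarith, by linarith, by linarith⟩
    · exact Or.inr ⟨by linarith, by linarith, by linarith, by linarith⟩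
  · rcases Edge.side'_bounds h with h | h | h | h
    · exact Or.inr ⟨by linarith, by linarith, by linarith, by linarith⟩
    · exact Or.inr ⟨by linarith, by linarith, by linarith, by linarith⟩
    · exact Or.inl ⟨by linarith, by linarith, by linarith, by linarith⟩
    · exact Or.inl ⟨by linarith, by linarith, by linarith, by linarith⟩

/-- Consecutive dyadic intervals do not overlap. The parameter `t` will be the rescaled distance to
the point where the edges of a side accumulate. -/
lemma eq_of_dyad_lt {m n : ℕ} {t : ℝ} (hm : dyad m / 2 < t ∧ t < dyad m)
    (hn : dyad n / 2 < t ∧ t < dyad n) : m = n := by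
  rcases lt_trichotomy m n with h | h | h
  · have := dyad_succ_le h; linarith
  · exact h
  · have := dyad_succ_le h; linarith

/-- The variant for the left sides: there an edge of index `n` fills an interval of ratio 4, whose
neighbours have indices `n ± 2`. -/
lemma eq_of_dyad_lt_of_parity {m n : ℕ} {t : ℝ} (hmn : Even m ↔ Even n)
    (hm : dyad m / 4 < t ∧ t < dyad m) (hn : dyad n / 4 < t ∧ t < dyad n) : m = n := by
  rcases lt_trichotomy m n with h | h | h
  · have := dyad_succ_succ_le h hmn; linarith
  · exact h
  · have := dyad_succ_succ_le h hmn.symm; linarith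

lemma Edge.side_cases {z : ℂ} {e : Edge} (h : z ∈ e.side) :
    (e = .unlabeled ∧ z.im = 1 / 2 ∧ -1 / 2 < z.re ∧ z.re < 0) ∨
    (∃ n, e = .A n ∧ 0 < dyad n ∧ dyad n ≤ 1 ∧
      z.re = 1 ∧ 1 - dyad n / 2 < z.im ∧ z.im < 1 - dyad n / 4) ∨
    (∃ n, e = .B n ∧ 0 < dyad n ∧ dyad n ≤ 1 ∧
      z.re = 1 / 2 ∧ dyad n / 4 < z.im ∧ z.im < dyad n / 2) ∨
    (∃ n, e = .C' n ∧ 0 < dyad n ∧ dyad n ≤ 1 ∧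
      z.im = 1 ∧ 1 - dyad n < z.re ∧ z.re < 1 - 3 * dyad n / 4) ∨
    (∃ n, e = .C'' n ∧ 0 < dyad n ∧ dyad n ≤ 1 ∧
      z.im = 1 ∧ 1 - 3 * dyad n / 4 < z.re ∧ z.re < 1 - dyad n / 2) := by
  rcases e with _ | n | n | n | n
  · exact .inl ⟨rfl, mem_side_unlabeled.1 h⟩
  · exact .inr <| .inl ⟨n, rfl, dyad_pos n, dyad_le_one n, mem_side_A.1 h⟩
  · exact .inr <| .inr <| .inl ⟨n, rfl, dyad_pos n, dyad_le_one n, mem_side_B.1 h⟩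
  · exact .inr <| .inr <| .inr <| .inl ⟨n, rfl, dyad_pos n, dyad_le_one n, mem_side_C'.1 h⟩
  · exact .inr <| .inr <| .inr <| .inr ⟨n, rfl, dyad_pos n, dyad_le_one n, mem_side_C''.1 h⟩

lemma Edge.side'_cases {z : ℂ} {e : Edge} (h : z ∈ e.side') :
    (e = .unlabeled ∧ z.im = 1 / 2 ∧ 1 / 2 < z.re ∧ z.re < 1) ∨
    (∃ n, e = .A n ∧ Even n ∧ 0 < dyad n ∧ dyad n ≤ 1 ∧
      z.re = -1 / 2 ∧ 1 / 3 - dyad n / 3 < z.im ∧ z.im < 1 / 3 - dyad n / 12) ∨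
    (∃ n, e = .A n ∧ ¬ Even n ∧ 0 < dyad n ∧ dyad n ≤ 1 / 2 ∧
      z.re = 0 ∧ 2 / 3 - dyad n / 3 < z.im ∧ z.im < 2 / 3 - dyad n / 12) ∨
    (∃ n, e = .B n ∧ Even n ∧ 0 < dyad n ∧ dyad n ≤ 1 ∧
      z.re = 0 ∧ 2 / 3 + dyad n / 12 < z.im ∧ z.im < 2 / 3 + dyad n / 3) ∨
    (∃ n, e = .B n ∧ ¬ Even n ∧ 0 < dyad n ∧ dyad n ≤ 1 / 2 ∧
      z.re = -1 / 2 ∧ 1 / 3 + dyad n / 12 < z.im ∧ z.im < 1 / 3 + dyad n / 3) ∨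
    (∃ n, e = .C' n ∧ 0 < dyad n ∧ dyad n ≤ 1 ∧
      z.im = 0 ∧ 1 / 2 - 3 * dyad n / 4 < z.re ∧ z.re < 1 / 2 - dyad n / 2) ∨
    (∃ n, e = .C'' n ∧ 0 < dyad n ∧ dyad n ≤ 1 ∧
      z.im = 0 ∧ 1 / 2 - dyad n < z.re ∧ z.re < 1 / 2 - 3 * dyad n / 4) := by
  rcases e with _ | n | n | n | n
  · exact .inl ⟨rfl, mem_side'_unlabeled.1 h⟩
  · rcases em (Even n) with hn | hn
    · exact .inr <| .inl ⟨n, rfl, hn, dyad_pos n, dyad_le_one n, (mem_side'_A_even hn).1 h⟩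
    · exact .inr <| .inr <| .inl ⟨n, rfl, hn, dyad_pos n, dyad_odd_le hn, (mem_side'_A_odd hn).1 h⟩
  · rcases em (Even n) with hn | hn
    · exact .inr <| .inr <| .inr <| .inl
        ⟨n, rfl, hn, dyad_pos n, dyad_le_one n, (mem_side'_B_even hn).1 h⟩
    · exact .inr <| .inr <| .inr <| .inr <| .inl
        ⟨n, rfl, hn, dyad_pos n, dyad_odd_le hn, (mem_side'_B_odd hn).1 h⟩
  · exact .inr <| .inr <| .inr <| .inr <| .inr <| .inl
      ⟨n, rfl, dyad_pos n, dyad_le_one n, mem_side'_C'.1 h⟩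
  · exact .inr <| .inr <| .inr <| .inr <| .inr <| .inr
      ⟨n, rfl, dyad_pos n, dyad_le_one n, mem_side'_C''.1 h⟩

/-- The first edges of different pairs are disjoint. -/
lemma eq_of_mem_side {z : ℂ} {e e' : Edge} (h : z ∈ e.side) (h' : z ∈ e'.side) : e = e' := by
  rcases Edge.side_cases h with ⟨rfl, h⟩ | ⟨n, rfl, h⟩ | ⟨n, rfl, h⟩ | ⟨n, rfl, h⟩ | ⟨n, rfl, h⟩ <;>
    rcases Edge.side_cases h' with
      ⟨rfl, h'⟩ | ⟨m, rfl, h'⟩ | ⟨m, rfl, h'⟩ | ⟨m, rfl, h'⟩ | ⟨m, rfl, h'⟩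
  all_goals try rfl
  all_goals try (exfalso; linarith)
  · rw [eq_of_dyad_lt (m := n) (n := m) (t := 2 * (1 - z.im)) ⟨by linarith, by linarith⟩
      ⟨by linarith, by linarith⟩]
  · rw [eq_of_dyad_lt (m := n) (n := m) (t := 2 * z.im) ⟨by linarith, by linarith⟩
      ⟨by linarith, by linarith⟩]
  -- The remaining goals concern `C'` and `C''`. The edges `C' n` and `C'' n` are the two halves of
  -- one dyadic interval, so first the indices agree, and then different kinds are separated by the
  -- midpoint.
  all_goals
    obtain rfl := eq_of_dyad_lt (m := n) (n := m) (t := 1 - z.re) ⟨by linarith, by linarith⟩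
      ⟨by linarith, by linarith⟩
    try rfl
  all_goals exfalso; linarith

/-- The second edges of different pairs are disjoint. -/
lemma eq_of_mem_side' {z : ℂ} {e e' : Edge} (h : z ∈ e.side') (h' : z ∈ e'.side') : e = e' := by
  rcases Edge.side'_cases h with ⟨rfl, h⟩ | ⟨n, rfl, hn, h⟩ | ⟨n, rfl, hn, h⟩ | ⟨n, rfl, hn, h⟩ |
      ⟨n, rfl, hn, h⟩ | ⟨n, rfl, h⟩ | ⟨n, rfl, h⟩ <;>
    rcases Edge.side'_cases h' with ⟨rfl, h'⟩ | ⟨m, rfl, hm, h'⟩ | ⟨m, rfl, hm, h'⟩ |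
      ⟨m, rfl, hm, h'⟩ | ⟨m, rfl, hm, h'⟩ | ⟨m, rfl, h'⟩ | ⟨m, rfl, h'⟩
  all_goals try rfl
  all_goals try (exfalso; linarith)
  · rw [eq_of_dyad_lt_of_parity (m := n) (n := m) (t := 3 * (1 / 3 - z.im)) (iff_of_true hn hm)
      ⟨by linarith, by linarith⟩ ⟨by linarith, by linarith⟩]
  · rw [eq_of_dyad_lt_of_parity (m := n) (n := m) (t := 3 * (2 / 3 - z.im)) (iff_of_false hn hm)
      ⟨by linarith, by linarith⟩ ⟨by linarith, by linarith⟩]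
  · rw [eq_of_dyad_lt_of_parity (m := n) (n := m) (t := 3 * (z.im - 2 / 3)) (iff_of_true hn hm)
      ⟨by linarith, by linarith⟩ ⟨by linarith, by linarith⟩]
  · rw [eq_of_dyad_lt_of_parity (m := n) (n := m) (t := 3 * (z.im - 1 / 3)) (iff_of_false hn hm)
      ⟨by linarith, by linarith⟩ ⟨by linarith, by linarith⟩]
  all_goals
    obtain rfl := eq_of_dyad_lt (m := n) (n := m) (t := 1 / 2 - z.re) ⟨by linarith, by linarith⟩
      ⟨by linarith, by linarith⟩
    try rfl
  all_goals exfalso; linarith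

/-! ## The topology of the surface -/

namespace Edge

/-- A rectangular neighbourhood of the first edge of a pair, which is a union of two rectangles
that are adjacent to the edge: one of them lies in the polygon, the other one is
carried into the polygon by the gluing translation. -/
def slab : Edge → Set ℂ
  | .unlabeled => Ioo (-1 / 2) 0 ×ℂ Ioo (1 / 4) (3 / 4)
  | .A n => Ioo (3 / 4) (5 / 4) ×ℂ Ioo (1 - dyad n / 2) (1 - dyad n / 4)
  | .B n => Ioo (1 / 4) (3 / 4) ×ℂ Ioo (dyad n / 4) (dyad n / 2)
  | .C' n => Ioo (1 - dyad n) (1 - 3 * dyad n / 4) ×ℂ Ioo (3 / 4) (5 / 4)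
  | .C'' n => Ioo (1 - 3 * dyad n / 4) (1 - dyad n / 2) ×ℂ Ioo (3 / 4) (5 / 4)

/-- The closed half-plane on the inner side of the first edge of a pair. -/
def inner : Edge → Set ℂ
  | .unlabeled => {z | z.im ≤ 1 / 2}
  | .A _ => {z | z.re ≤ 1}
  | .B _ => {z | z.re ≤ 1 / 2}
  | .C' _ => {z | z.im ≤ 1}
  | .C'' _ => {z | z.im ≤ 1}

/-- The closed half-plane on the outer side of the first edge of a pair. -/
def outer : Edge → Set ℂ
  | .unlabeled => {z | 1 / 2 ≤ z.im}
  | .A _ => {z | 1 ≤ z.re}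
  | .B _ => {z | 1 / 2 ≤ z.re}
  | .C' _ => {z | 1 ≤ z.im}
  | .C'' _ => {z | 1 ≤ z.im}

lemma isOpen_slab (e : Edge) : IsOpen e.slab := by
  cases e <;> exact isOpen_Ioo.reProdIm isOpen_Ioo

lemma isClosed_inner (e : Edge) : IsClosed e.inner := by
  cases e <;> exact isClosed_le (by fun_prop) (by fun_prop)

lemma isClosed_outer (e : Edge) : IsClosed e.outer := by
  cases e <;> exact isClosed_le (by fun_prop) (by fun_prop)

lemma inner_union_outer (e : Edge) (z : ℂ) : z ∈ e.inner ∨ z ∈ e.outer := by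
  cases e <;> simp only [inner, outer, mem_ofPred_eq] <;> exact le_total _ _

variable {z : ℂ} {e : Edge}

lemma side_subset_slab : e.side ⊆ e.slab := by
  intro z h
  rcases side_cases h with ⟨rfl, h⟩ | ⟨n, rfl, h⟩ | ⟨n, rfl, h⟩ | ⟨n, rfl, h⟩ | ⟨n, rfl, h⟩ <;>
  exact ⟨⟨by linarith, by linarith⟩, ⟨by linarith, by linarith⟩⟩

lemma mem_side_of_mem_inner_outer (h : z ∈ e.slab) (hi : z ∈ e.inner) (ho : z ∈ e.outer) :
    z ∈ e.side := by
  rcases e with _ | n | n | n | n <;> obtain ⟨⟨h1, h2⟩, ⟨h3, h4⟩⟩ := h <;>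
    simp only [inner, outer, mem_ofPred_eq] at hi ho <;> have h0 := le_antisymm hi ho
  · exact mem_side_unlabeled.2 ⟨h0, h1, h2⟩
  · exact mem_side_A.2 ⟨h0, h3, h4⟩
  · exact mem_side_B.2 ⟨h0, h3, h4⟩
  · exact mem_side_C'.2 ⟨h0, h1, h2⟩
  · exact mem_side_C''.2 ⟨h0, h1, h2⟩

lemma interior_or_side_of_inner (h : z ∈ e.slab) (hi : z ∈ e.inner) :
    z ∈ polygonInterior ∨ z ∈ e.side := by
  by_cases ho : z ∈ e.outer
  · exact .inr (mem_side_of_mem_inner_outer h hi ho)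
  left
  rw [mem_polygonInterior]
  rcases e with _ | n | n | n | n <;> obtain ⟨⟨h1, h2⟩, ⟨h3, h4⟩⟩ := h <;>
    simp only [outer, mem_ofPred_eq, not_le] at ho <;>
    try (have := dyad_pos n; have := dyad_le_one n)
  · exact .inl ⟨by linarith, by linarith, by linarith, by linarith⟩
  · exact .inr <| .inr ⟨by linarith, by linarith, by linarith, by linarith⟩
  · exact .inl ⟨by linarith, by linarith, by linarith, by linarith⟩
  · exact .inr <| .inr ⟨by linarith, by linarith, by linarith, by linarith⟩
  · exact .inr <| .inr ⟨by linarith, by linarith, by linarith, by linarith⟩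

lemma mem_inner_of_mem_polygon (h : z ∈ e.slab) (hz : z ∈ polygon) : z ∈ e.inner := by
  rcases e with _ | n | n | n | n <;> obtain ⟨⟨h1, h2⟩, ⟨h3, h4⟩⟩ := h <;>
    simp only [inner, mem_ofPred_eq] <;>
    rcases polygon_bounds hz with hz | hz <;>
    try (have := dyad_pos n; have := dyad_le_one n)
  all_goals linarith

lemma interior_or_side_of_outer (h : z ∈ e.slab) (ho : z ∈ e.outer) :
    z + e.shift ∈ polygonInterior ∨ z ∈ e.side := by
  by_cases hi : z ∈ e.inner
  · exact .inr (mem_side_of_mem_inner_outer h hi ho)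
  left
  rw [mem_polygonInterior]
  rcases e with _ | n | n | n | n <;> obtain ⟨⟨h1, h2⟩, ⟨h3, h4⟩⟩ := h <;>
    simp only [inner, mem_ofPred_eq, not_le] at hi <;>
    try (have := dyad_pos n; have := dyad_le_one n)
  · simp only [shift_unlabeled, Complex.add_re, Complex.add_im]
    exact .inr <| .inr ⟨by linarith, by linarith, by linarith, by linarith⟩
  · by_cases hn : Even n
    · simp only [shift_A_even hn, Complex.add_re, Complex.add_im]
      exact .inl ⟨by linarith, by linarith, by linarith, by linarith⟩
    · have := dyad_odd_le hn
      simp only [shift_A_odd hn, Complex.add_re, Complex.add_im]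
      exact .inr <| .inr ⟨by linarith, by linarith, by linarith, by linarith⟩
  · by_cases hn : Even n
    · simp only [shift_B_even hn, Complex.add_re, Complex.add_im]
      exact .inr <| .inr ⟨by linarith, by linarith, by linarith, by linarith⟩
    · have := dyad_odd_le hn
      simp only [shift_B_odd hn, Complex.add_re, Complex.add_im]
      exact .inl ⟨by linarith, by linarith, by linarith, by linarith⟩
  · simp only [shift_C', Complex.add_re, Complex.add_im]
    exact .inl ⟨by linarith, by linarith, by linarith, by linarith⟩
  · simp only [shift_C'', Complex.add_re, Complex.add_im]
    exact .inl ⟨by linarith, by linarith, by linarith, by linarith⟩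

lemma mem_outer_of_mem_polygon (h : z ∈ e.slab) (hz : z + e.shift ∈ polygon) : z ∈ e.outer := by
  rcases e with _ | n | n | n | n <;> obtain ⟨⟨h1, h2⟩, ⟨h3, h4⟩⟩ := h <;>
    simp only [outer, mem_ofPred_eq] <;>
    try (have := dyad_pos n; have := dyad_le_one n)
  · have hz := polygon_bounds hz
    simp only [shift_unlabeled, Complex.add_re, Complex.add_im] at hz
    rcases hz with hz | hz <;> linarith
  · by_cases hn : Even n
    · have hz := polygon_bounds hz
      simp only [shift_A_even hn, Complex.add_re, Complex.add_im] at hz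
      rcases hz with hz | hz <;> linarith
    · have := dyad_odd_le hn
      have hz := polygon_bounds hz
      simp only [shift_A_odd hn, Complex.add_re, Complex.add_im] at hz
      rcases hz with hz | hz <;> linarith
  · by_cases hn : Even n
    · have hz := polygon_bounds hz
      simp only [shift_B_even hn, Complex.add_re, Complex.add_im] at hz
      rcases hz with hz | hz <;> linarith
    · have := dyad_odd_le hn
      have hz := polygon_bounds hz
      simp only [shift_B_odd hn, Complex.add_re, Complex.add_im] at hz
      rcases hz with hz | hz <;> linarith
  · have hz := polygon_bounds hz
    simp only [shift_C', Complex.add_re, Complex.add_im] at hz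
    rcases hz with hz | hz <;> linarith
  · have hz := polygon_bounds hz
    simp only [shift_C'', Complex.add_re, Complex.add_im] at hz
    rcases hz with hz | hz <;> linarith

lemma ne_add_shift {w : ℂ} (hz : z ∈ e.slab) (hw : w ∈ e.slab) : z ≠ w + e.shift := by
  rintro rfl
  rcases e with _ | n | n | n | n <;> obtain ⟨⟨h1, h2⟩, ⟨h3, h4⟩⟩ := hz <;>
    obtain ⟨⟨h1', h2'⟩, ⟨h3', h4'⟩⟩ := hw
  · simp only [shift_unlabeled, Complex.add_re] at h1 h2; linarith
  · by_cases hn : Even n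
    · simp only [shift_A_even hn, Complex.add_re] at h1 h2; linarith
    · simp only [shift_A_odd hn, Complex.add_re] at h1 h2; linarith
  · by_cases hn : Even n
    · simp only [shift_B_even hn, Complex.add_re] at h1 h2; linarith
    · simp only [shift_B_odd hn, Complex.add_re] at h1 h2; linarith
  · simp only [shift_C', Complex.add_im] at h3 h4; linarith
  · simp only [shift_C'', Complex.add_im] at h3 h4; linarith

lemma side_subset_inner (h : z ∈ e.side) : z ∈ e.inner :=
  mem_inner_of_mem_polygon (side_subset_slab h) (side_subset e h)

lemma side_subset_outer (h : z ∈ e.side) : z ∈ e.outer :=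
  mem_outer_of_mem_polygon (side_subset_slab h) (side'_subset e (add_shift_mem_side' h))

end Edge

/-! ### Saturated sets and the fibres of the projection -/

/-- A set of points of the plane is saturated if, with a point of an edge, it contains the point
it is glued to. -/
def Saturated (U : Set ℂ) : Prop := ∀ (e : Edge) (z : ℂ), z ∈ e.side → (z ∈ U ↔ z + e.shift ∈ U)

/-- The subset of the surface defined by a saturated set. -/
def descend (U : Set ℂ) (hU : Saturated U) : Set XInf :=
  {x | Quot.lift (fun p : polygon => (p : ℂ) ∈ U)
    (by rintro p q' ⟨e, h, h'⟩; simp only [h']; exact propext (hU e p h)) x}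

lemma proj_mem_descend {U : Set ℂ} {hU : Saturated U} {p : polygon} :
    proj p ∈ descend U hU ↔ (p : ℂ) ∈ U := Iff.rfl

lemma continuous_proj : Continuous proj := continuous_quot_mk

lemma isOpen_descend {U : Set ℂ} (hU : Saturated U) (h : IsOpen U) : IsOpen (descend U hU) :=
  isOpen_coinduced.2 (h.preimage continuous_subtype_val)

lemma zero_lt_one_interior : (⟨1 / 4, 1 / 4⟩ : ℂ) ∈ polygonInterior :=
  mem_polygonInterior.2 (.inl (by norm_num))

open Classical in
/-- The projection to the surface, extended arbitrarily outside of the polygon. -/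
def pr (z : ℂ) : XInf :=
  if h : z ∈ polygon then proj ⟨z, h⟩ else proj ⟨_, polygonInterior_subset zero_lt_one_interior⟩

lemma pr_of_mem {z : ℂ} (h : z ∈ polygon) : pr z = proj ⟨z, h⟩ := dif_pos h

lemma pr_coe (p : polygon) : pr p = proj p := pr_of_mem p.2

lemma pr_mem_descend {U : Set ℂ} {hU : Saturated U} {z : ℂ} (hz : z ∈ polygon) :
    pr z ∈ descend U hU ↔ z ∈ U := by rw [pr_of_mem hz, proj_mem_descend]

lemma continuousOn_pr : ContinuousOn pr polygon := by
  rw [continuousOn_iff_continuous_domRestrict]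
  exact continuous_proj.congr fun p => (pr_coe p).symm

lemma exists_pr (x : XInf) : ∃ z ∈ polygon, pr z = x := by
  obtain ⟨p, rfl⟩ := Quot.exists_rep x
  exact ⟨p, p.2, pr_coe p⟩

lemma pr_add_shift {e : Edge} {z : ℂ} (h : z ∈ e.side) : pr (z + e.shift) = pr z := by
  rw [pr_of_mem (side_subset e h), pr_of_mem (side'_subset e (Edge.add_shift_mem_side' h))]
  exact (Quot.sound ⟨e, h, rfl⟩).symm

/-- A priori the quotient identifies points joined by chains of gluings. The set of points reached
in at most one step is saturated, since no point lies on two edges; hence it descends to the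
quotient and contains the whole fibre. -/
lemma pr_eq_pr {z w : ℂ} (hz : z ∈ polygon) (hw : w ∈ polygon) (h : pr z = pr w) :
    w = z ∨ (∃ e : Edge, z ∈ e.side ∧ w = z + e.shift) ∨ ∃ e : Edge, w ∈ e.side ∧ z = w + e.shift := by
  let U : Set ℂ := {w | w = z ∨ (∃ e : Edge, z ∈ e.side ∧ w = z + e.shift) ∨
    ∃ e : Edge, w ∈ e.side ∧ z = w + e.shift}
  have hU : Saturated U := by
    intro e v hv
    constructor
    · rintro (rfl | ⟨e', h1, rfl⟩ | ⟨e', h1, rfl⟩)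
      · exact .inr <| .inl ⟨e, hv, rfl⟩
      · exact (notMem_side'_of_mem_side hv (Edge.add_shift_mem_side' h1)).elim
      · obtain rfl := eq_of_mem_side hv h1
        exact .inl rfl
    · rintro (rfl | ⟨e', h1, h2⟩ | ⟨e', h1, h2⟩)
      · exact .inr <| .inr ⟨e, hv, rfl⟩
      · have h3 := Edge.add_shift_mem_side' hv
        rw [h2] at h3
        obtain rfl := eq_of_mem_side' h3 (Edge.add_shift_mem_side' h1)
        exact .inl (add_right_cancel h2)
      · exact (notMem_side'_of_mem_side h1 (Edge.add_shift_mem_side' hv)).elim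
  have h1 : pr z ∈ descend U hU := (pr_mem_descend hz).2 (.inl rfl)
  rw [h, pr_mem_descend hw] at h1
  exact h1

lemma eq_of_pr_eq_of_interior {z w : ℂ} (hz : z ∈ polygonInterior) (hw : w ∈ polygon)
    (h : pr w = pr z) : w = z := by
  rcases pr_eq_pr (polygonInterior_subset hz) hw h.symm with h | ⟨e, h1, -⟩ | ⟨e, h1, rfl⟩
  · exact h
  · exact (notMem_side_of_interior hz e h1).elim
  · exact (notMem_side'_of_interior hz e (Edge.add_shift_mem_side' h1)).elim

lemma eq_of_pr_eq_of_side {e : Edge} {z w : ℂ} (hz : z ∈ e.side) (hw : w ∈ polygon)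
    (h : pr w = pr z) : w = z ∨ w = z + e.shift := by
  rcases pr_eq_pr (side_subset e hz) hw h.symm with h | ⟨e', h1, h2⟩ | ⟨e', h1, rfl⟩
  · exact .inl h
  · obtain rfl := eq_of_mem_side hz h1
    exact .inr h2
  · exact (notMem_side'_of_mem_side hz (Edge.add_shift_mem_side' h1)).elim

lemma saturated_of_subset_interior {U : Set ℂ} (hU : U ⊆ polygonInterior) : Saturated U := by
  intro e z hz
  constructor
  · intro h
    exact (notMem_side_of_interior (hU h) e hz).elim
  · intro h
    exact (notMem_side'_of_interior (hU h) e (Edge.add_shift_mem_side' hz)).elim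

/-- Points of the polygon in the slab or in its translate are interior or on the pair `e` itself, so
no other pair imposes a condition. -/
lemma saturated_of_subset_slab {e : Edge} {U : Set ℂ} (hU : U ⊆ e.slab) :
    Saturated (U ∪ {z | z - e.shift ∈ U}) := by
  intro e' z hz
  have hz' := Edge.add_shift_mem_side' hz
  constructor
  · rintro (h | h)
    · have h1 := Edge.mem_inner_of_mem_polygon (hU h) (side_subset e' hz)
      rcases Edge.interior_or_side_of_inner (hU h) h1 with h2 | h2
      · exact (notMem_side_of_interior h2 e' hz).elim
      · obtain rfl := eq_of_mem_side hz h2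
        exact .inr (by simpa using h)
    · have h1 := Edge.mem_outer_of_mem_polygon (hU h) (by simpa using side_subset e' hz)
      rcases Edge.interior_or_side_of_outer (hU h) h1 with h2 | h2
      · rw [sub_add_cancel] at h2
        exact (notMem_side_of_interior h2 e' hz).elim
      · exact (notMem_side'_of_mem_side hz (Edge.mem_side'.2 h2)).elim
  · rintro (h | h)
    · have h1 := Edge.mem_inner_of_mem_polygon (hU h) (side'_subset e' hz')
      rcases Edge.interior_or_side_of_inner (hU h) h1 with h2 | h2
      · exact (notMem_side'_of_interior h2 e' hz').elim
      · exact (notMem_side'_of_mem_side h2 hz').elim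
    · have h1 := Edge.mem_outer_of_mem_polygon (hU h) (by simpa using side'_subset e' hz')
      rcases Edge.interior_or_side_of_outer (hU h) h1 with h2 | h2
      · rw [sub_add_cancel] at h2
        exact (notMem_side'_of_interior h2 e' hz').elim
      · obtain rfl := eq_of_mem_side' hz' (Edge.mem_side'.2 h2)
        exact .inl (by simpa using h)

lemma isOpen_polygonInterior : IsOpen polygonInterior :=
  ((isOpen_Ioo.reProdIm isOpen_Ioo).union (isOpen_Ioo.reProdIm isOpen_Ioo)).union
    (isOpen_Ioo.reProdIm isOpen_Ioo)

/-- The points of the surface near a given one are represented near its representatives. -/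
lemma exists_saturated {z : ℂ} (hz : z ∈ polygon) {V : Set ℂ} (hV : IsOpen V)
    (h : ∀ w ∈ polygon, pr w = pr z → w ∈ V) :
    ∃ U, ∃ hU : Saturated U, IsOpen U ∧ U ⊆ V ∧ pr z ∈ descend U hU := by
  have key : ∀ (e : Edge) (z : ℂ), z ∈ e.side → z ∈ V → z + e.shift ∈ V →
      ∃ U, ∃ hU : Saturated U, IsOpen U ∧ U ⊆ V ∧ pr z ∈ descend U hU := by
    intro e z hz h1 h2
    -- Both `U` and its translate must stay inside `V`, which is why the preimage of `V` under the
    -- translation is intersected as well.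
    have hS : IsOpen (e.slab ∩ V ∩ {w | w + e.shift ∈ V}) :=
      (e.isOpen_slab.inter hV).inter (hV.preimage (continuous_add_const _))
    refine ⟨_, saturated_of_subset_slab (e := e) (U := e.slab ∩ V ∩ {w | w + e.shift ∈ V})
      (fun w hw => hw.1.1), hS.union (hS.preimage (continuous_id.sub continuous_const)), ?_, ?_⟩
    · rintro w (hw | hw)
      · exact hw.1.2
      · simpa using hw.2
    · exact (pr_mem_descend (side_subset e hz)).2 (.inl ⟨⟨Edge.side_subset_slab hz, h1⟩, h2⟩)
  rcases mem_polygon.1 hz with h0 | ⟨e, h0 | h0⟩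
  · refine ⟨polygonInterior ∩ V, saturated_of_subset_interior inter_subset_left,
      isOpen_polygonInterior.inter hV, inter_subset_right, (pr_mem_descend hz).2 ⟨h0, h z hz rfl⟩⟩
  · exact key e z h0 (h z hz rfl)
      (h _ (side'_subset e (Edge.add_shift_mem_side' h0)) (pr_add_shift h0))
  · obtain ⟨w, hw, rfl⟩ := h0
    simp only at *
    rw [pr_add_shift hw] at h ⊢
    exact key e w hw (h w (side_subset e hw) rfl) (h _ hz (pr_add_shift hw))

/-- A property holds near a point of the surface as soon as it holds near all representatives. -/
lemma eventually_nhds_pr {z : ℂ} (hz : z ∈ polygon) {P : XInf → Prop}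
    (h : ∀ w ∈ polygon, pr w = pr z → ∀ᶠ v in 𝓝[polygon] w, P (pr v)) : ∀ᶠ y in 𝓝 (pr z), P y := by
  have h' : ∀ w ∈ polygon, pr w = pr z →
      ∃ V, IsOpen V ∧ w ∈ V ∧ ∀ v ∈ V, v ∈ polygon → P (pr v) := by
    intro w hw hwz
    have := h w hw hwz
    rw [eventually_nhdsWithin_iff, eventually_nhds_iff] at this
    obtain ⟨V, h1, h2, h3⟩ := this
    exact ⟨V, h2, h3, h1⟩
  choose! V hV using h'
  obtain ⟨U, hU, hU1, hU2, hU3⟩ := exists_saturated hz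
    (V := ⋃ w ∈ {w | w ∈ polygon ∧ pr w = pr z}, V w)
    (isOpen_biUnion fun w hw => (hV w hw.1 hw.2).1)
    (fun w hw hwz => mem_biUnion (show w ∈ {w | w ∈ polygon ∧ pr w = pr z} from ⟨hw, hwz⟩)
      (hV w hw hwz).2.1)
  filter_upwards [(isOpen_descend hU hU1).mem_nhds hU3] with y hy
  obtain ⟨v, hv, rfl⟩ := exists_pr y
  obtain ⟨w, hw, hvw⟩ := mem_iUnion₂.1 (hU2 ((pr_mem_descend hv).1 hy))
  exact (hV w hw.1 hw.2).2.2 v hvw hv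

lemma finite_fiber (z : ℂ) (hz : z ∈ polygon) : {w | w ∈ polygon ∧ pr w = pr z}.Finite := by
  rcases mem_polygon.1 hz with h | ⟨e, h | ⟨v, h, rfl⟩⟩
  · exact (finite_singleton z).subset fun w hw => eq_of_pr_eq_of_interior h hw.1 hw.2
  · exact (Set.toFinite {z, z + e.shift}).subset fun w hw => eq_of_pr_eq_of_side h hw.1 hw.2
  · refine (Set.toFinite {v, v + e.shift}).subset fun w hw => eq_of_pr_eq_of_side h hw.1 ?_
    rw [hw.2, pr_add_shift h]

/-- Two distinct fibres are disjoint finite sets; separate them in the plane, then shrink to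
saturated open sets. -/
instance : T2Space XInf := by
  refine ⟨fun x y hxy => ?_⟩
  obtain ⟨z, hz, rfl⟩ := exists_pr x
  obtain ⟨w, hw, rfl⟩ := exists_pr y
  have hd : Disjoint {v | v ∈ polygon ∧ pr v = pr z} {v | v ∈ polygon ∧ pr v = pr w} :=
    disjoint_left.2 fun v h1 h2 => hxy (h1.2.symm.trans h2.2)
  obtain ⟨V, W, hV, hW, hV1, hW1, hVW⟩ :=
    SeparatedNhds.of_isCompact_isCompact (finite_fiber z hz).isCompact (finite_fiber w hw).isCompact hd
  obtain ⟨U, hU, h1, h2, h3⟩ := exists_saturated hz hV fun v h h' => hV1 ⟨h, h'⟩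
  obtain ⟨U', hU', h1', h2', h3'⟩ := exists_saturated hw hW fun v h h' => hW1 ⟨h, h'⟩
  refine ⟨_, _, isOpen_descend hU h1, isOpen_descend hU' h1', h3, h3', disjoint_left.2 ?_⟩
  intro x hx hx'
  obtain ⟨v, hv, rfl⟩ := exists_pr x
  exact disjoint_left.1 hVW (h2 ((pr_mem_descend hv).1 hx)) (h2' ((pr_mem_descend hv).1 hx'))

/-! ## Local coordinates -/

/-- The inverse of an open embedding of an open subset of the plane, as a local coordinate. -/
def inverseChart (σ : ℂ → XInf) (D : Set ℂ) (hD : IsOpen D) (hc : ContinuousOn σ D)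
    (hi : InjOn σ D) (ho : ∀ U ⊆ D, IsOpen U → IsOpen (σ '' U)) : OpenPartialHomeomorph XInf ℂ :=
  (OpenPartialHomeomorph.ofContinuousOpenRestrict (hi.bijOn_image.toPartialEquiv σ D (σ '' D)) hc
    (by
      intro U hU
      obtain ⟨V, hV, rfl⟩ := hU
      have := ho (D ∩ V) inter_subset_left (hD.inter hV)
      convert this using 1
      ext x
      simp only [mem_image, Subtype.exists, mem_preimage, mem_inter_iff, and_assoc]
      exact exists_congr fun y => ⟨fun ⟨h1, h2, h3⟩ => ⟨h1, h2, h3⟩, fun ⟨h1, h2, h3⟩ => ⟨h1, h2, h3⟩⟩)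
    hD).symm

section inverseChart

variable {σ : ℂ → XInf} {D : Set ℂ} (hD : IsOpen D) (hc : ContinuousOn σ D)
    (hi : InjOn σ D) (ho : ∀ U ⊆ D, IsOpen U → IsOpen (σ '' U))

lemma inverseChart_apply {z : ℂ} (hz : z ∈ D) : inverseChart σ D hD hc hi ho (σ z) = z :=
  (inverseChart σ D hD hc hi ho).right_inv hz

end inverseChart

lemma mem_translationAtlas {φ : OpenPartialHomeomorph XInf ℂ} :
    φ ∈ translationAtlas ↔ ∀ z ∈ polygon, pr z ∈ φ.source →
      ∃ c : ℂ, ∀ᶠ w in 𝓝[polygon] z, φ (pr w) = w + c := by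
  simp only [translationAtlas, mem_ofPred_eq, Subtype.forall]
  refine forall₂_congr fun z hz => ?_
  rw [pr_of_mem hz]
  refine forall_congr' fun _ => exists_congr fun c => ?_
  rw [← eventually_nhds_subtype_iff polygon ⟨z, hz⟩]
  simp only [pr_coe]

lemma inverseChart_mem {σ : ℂ → XInf} {D : Set ℂ} (hD : IsOpen D) (hc : ContinuousOn σ D)
    (hi : InjOn σ D) (ho : ∀ U ⊆ D, IsOpen U → IsOpen (σ '' U))
    (h : ∀ z ∈ polygon, pr z ∈ σ '' D →
      ∃ c : ℂ, ∀ᶠ w in 𝓝[polygon] z, w + c ∈ D ∧ σ (w + c) = pr w) :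
    inverseChart σ D hD hc hi ho ∈ translationAtlas := by
  rw [mem_translationAtlas]
  intro z hz hzs
  obtain ⟨c, hcc⟩ := h z hz hzs
  refine ⟨c, ?_⟩
  filter_upwards [hcc] with w hw
  rw [← hw.2, inverseChart_apply _ _ _ _ hw.1]

lemma isOpen_image_pr {U : Set ℂ} (hU : IsOpen U) (h : U ⊆ polygonInterior) :
    IsOpen (pr '' U) := by
  convert isOpen_descend (saturated_of_subset_interior h) hU using 1
  ext x
  obtain ⟨z, hz, rfl⟩ := exists_pr x
  rw [pr_mem_descend hz]
  constructor
  · rintro ⟨w, hw, hwz⟩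
    rwa [eq_of_pr_eq_of_interior (h hw) hz hwz.symm]
  · exact mem_image_of_mem _

/-- The local coordinate on the interior of the polygon. -/
def interiorChart : OpenPartialHomeomorph XInf ℂ :=
  inverseChart pr polygonInterior isOpen_polygonInterior (continuousOn_pr.mono polygonInterior_subset)
    (fun _ hz _ hw h => eq_of_pr_eq_of_interior hw (polygonInterior_subset hz) h)
    (fun _ h hU => isOpen_image_pr hU h)

lemma interiorChart_mem : interiorChart ∈ translationAtlas := by
  refine inverseChart_mem _ _ _ _ ?_
  rintro z hz ⟨w, hw, hwz⟩
  obtain rfl := eq_of_pr_eq_of_interior hw hz hwz.symm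
  refine ⟨0, ?_⟩
  filter_upwards [mem_nhdsWithin_of_mem_nhds (isOpen_polygonInterior.mem_nhds hw)] with v hv
  simpa using hv

namespace Edge

variable {e : Edge} {z : ℂ}

open Classical in
/-- The map from the slab around an edge to the surface. -/
def unfold (e : Edge) (z : ℂ) : XInf := if z ∈ e.inner then pr z else pr (z + e.shift)

lemma unfold_of_inner (h : z ∈ e.inner) : e.unfold z = pr z := if_pos h

lemma unfold_of_outer (hs : z ∈ e.slab) (h : z ∈ e.outer) : e.unfold z = pr (z + e.shift) := by
  by_cases hi : z ∈ e.inner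
  · rw [unfold_of_inner hi, pr_add_shift (mem_side_of_mem_inner_outer hs hi h)]
  · exact if_neg hi

lemma mem_polygon_of_inner (hs : z ∈ e.slab) (h : z ∈ e.inner) : z ∈ polygon := by
  rcases interior_or_side_of_inner hs h with h | h
  · exact polygonInterior_subset h
  · exact side_subset e h

lemma mem_polygon_of_outer (hs : z ∈ e.slab) (h : z ∈ e.outer) : z + e.shift ∈ polygon := by
  rcases interior_or_side_of_outer hs h with h | h
  · exact polygonInterior_subset h
  · exact side'_subset e (add_shift_mem_side' h)

lemma continuousOn_unfold : ContinuousOn e.unfold e.slab := by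
  have h1 : ContinuousOn e.unfold (e.slab ∩ e.inner) :=
    (continuousOn_pr.mono fun z hz => mem_polygon_of_inner hz.1 hz.2).congr
      fun z hz => unfold_of_inner hz.2
  have h2 : ContinuousOn e.unfold (e.slab ∩ e.outer) :=
    (continuousOn_pr.comp (f := fun z => z + e.shift) (by fun_prop)
      fun z hz => mem_polygon_of_outer hz.1 hz.2).congr fun z hz => unfold_of_outer hz.1 hz.2
  intro z hz
  have h3 : e.slab = (e.slab ∩ e.inner) ∪ (e.slab ∩ e.outer) := by
    rw [← inter_union_distrib_left, eq_comm, inter_eq_left]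
    exact fun z _ => inner_union_outer e z
  rw [h3]
  refine ContinuousWithinAt.union ?_ ?_
  · by_cases h : z ∈ e.inner
    · exact h1 z ⟨hz, h⟩
    · exact continuousWithinAt_of_notMem_closure fun h' =>
        h (e.isClosed_inner.closure_subset (closure_mono inter_subset_right h'))
  · by_cases h : z ∈ e.outer
    · exact h2 z ⟨hz, h⟩
    · exact continuousWithinAt_of_notMem_closure fun h' =>
        h (e.isClosed_outer.closure_subset (closure_mono inter_subset_right h'))

/-- Off the edge, `e.unfold z` is represented by an interior point, whose fibre is a singleton; on
the edge the fibre is known. -/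
lemma unfold_eq_pr {w : ℂ} (hz : z ∈ e.slab) (hw : w ∈ polygon) (h : e.unfold z = pr w) :
    w = z ∨ w = z + e.shift := by
  by_cases hs : z ∈ e.side
  · rw [unfold_of_inner (side_subset_inner hs)] at h
    exact eq_of_pr_eq_of_side hs hw h.symm
  by_cases hi : z ∈ e.inner
  · rw [unfold_of_inner hi] at h
    rcases interior_or_side_of_inner hz hi with h1 | h1
    · exact .inl (eq_of_pr_eq_of_interior h1 hw h.symm)
    · exact (hs h1).elim
  · have ho := (inner_union_outer e z).resolve_left hi
    rw [unfold_of_outer hz ho] at h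
    rcases interior_or_side_of_outer hz ho with h1 | h1
    · exact .inr (eq_of_pr_eq_of_interior h1 hw h.symm)
    · exact (hs h1).elim

lemma injOn_unfold : InjOn e.unfold e.slab := by
  intro z hz w hw h
  rcases inner_union_outer e w with hi | ho
  · rw [unfold_of_inner hi] at h
    rcases unfold_eq_pr hz (mem_polygon_of_inner hw hi) h with h | h
    · exact h.symm
    · exact (ne_add_shift hw hz h).elim
  · rw [unfold_of_outer hw ho] at h
    rcases unfold_eq_pr hz (mem_polygon_of_outer hw ho) h with h | h
    · exact (ne_add_shift hz hw h.symm).elim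
    · exact (add_right_cancel h).symm

lemma isOpen_image_unfold {U : Set ℂ} (hU : IsOpen U) (h : U ⊆ e.slab) :
    IsOpen (e.unfold '' U) := by
  convert isOpen_descend (saturated_of_subset_slab h)
    (hU.union (hU.preimage (continuous_id.sub continuous_const))) using 1
  ext x
  obtain ⟨z, hz, rfl⟩ := exists_pr x
  rw [pr_mem_descend hz]
  constructor
  · rintro ⟨w, hw, hwz⟩
    rcases unfold_eq_pr (h hw) hz hwz with rfl | rfl
    · exact .inl hw
    · exact .inr (by simpa using hw)
  · rintro (hzU | hzU)
    · exact ⟨z, hzU, unfold_of_inner (mem_inner_of_mem_polygon (h hzU) hz)⟩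
    · refine ⟨_, hzU, ?_⟩
      rw [unfold_of_outer (h hzU) (mem_outer_of_mem_polygon (h hzU) (by simpa using hz))]
      simp

/-- The local coordinate around an edge. -/
def chart (e : Edge) : OpenPartialHomeomorph XInf ℂ :=
  inverseChart e.unfold e.slab e.isOpen_slab continuousOn_unfold injOn_unfold
    (fun _ h hU => isOpen_image_unfold hU h)

lemma chart_mem (e : Edge) : e.chart ∈ translationAtlas := by
  refine inverseChart_mem _ _ _ _ ?_
  rintro z hz ⟨w, hw, hwz⟩
  rcases unfold_eq_pr hw hz hwz with rfl | rfl
  · refine ⟨0, ?_⟩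
    filter_upwards [mem_nhdsWithin_of_mem_nhds (e.isOpen_slab.mem_nhds hw), self_mem_nhdsWithin]
      with v hv hvp
    simp only [add_zero]
    exact ⟨hv, unfold_of_inner (mem_inner_of_mem_polygon hv hvp)⟩
  · refine ⟨-e.shift, ?_⟩
    have hw' : w + e.shift ∈ {v | v - e.shift ∈ e.slab} := by simpa using hw
    filter_upwards [mem_nhdsWithin_of_mem_nhds ((e.isOpen_slab.preimage
      (continuous_id.sub continuous_const)).mem_nhds hw'), self_mem_nhdsWithin] with v hv hvp
    rw [← sub_eq_add_neg]
    replace hv : v - e.shift ∈ e.slab := hv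
    refine ⟨hv, ?_⟩
    rw [unfold_of_outer hv (mem_outer_of_mem_polygon hv (by simpa using hvp)), sub_add_cancel]

instance : Countable Edge := by
  let f : Edge → ℕ × ℕ := fun e => match e with
    | .unlabeled => (0, 0)
    | .A n => (1, n)
    | .B n => (2, n)
    | .C' n => (3, n)
    | .C'' n => (4, n)
  refine Function.Injective.countable (f := f) ?_
  intro e e' h
  cases e <;> cases e' <;> simp_all [f]

end Edge

/-! ### The structure of a Riemann surface -/

lemma exists_mem_chart_source (x : XInf) : x ∈ interiorChart.source ∨ ∃ e : Edge, x ∈ e.chart.source := by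
  obtain ⟨z, hz, rfl⟩ := exists_pr x
  rcases mem_polygon.1 hz with h | ⟨e, h | ⟨z, h, rfl⟩⟩
  · exact .inl ⟨z, h, rfl⟩
  · exact .inr ⟨e, z, Edge.side_subset_slab h, Edge.unfold_of_inner (Edge.side_subset_inner h)⟩
  · refine .inr ⟨e, z, Edge.side_subset_slab h, ?_⟩
    rw [Edge.unfold_of_inner (Edge.side_subset_inner h), pr_add_shift h]

lemma hasLocalCoordinates : HasLocalCoordinates := by
  intro x
  rcases exists_mem_chart_source x with h | ⟨e, h⟩
  · exact ⟨_, interiorChart_mem, h⟩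
  · exact ⟨_, e.chart_mem, h⟩

instance instChartedSpaceXInf : ChartedSpace ℂ XInf := chartedSpaceXInf hasLocalCoordinates

/-- Each chart domain is homeomorphic to a subset of the plane, and one chart per edge plus the
interior chart cover the surface. -/
instance : SecondCountableTopology XInf := by
  let c : Option Edge → OpenPartialHomeomorph XInf ℂ := fun o => o.elim interiorChart Edge.chart
  have : ∀ o, SecondCountableTopology (c o).source := fun o => (c o).secondCountableTopology_source
  refine TopologicalSpace.secondCountableTopology_of_countable_cover
    (U := fun o => (c o).source) (fun o => (c o).open_source) ?_
  refine eq_univ_of_forall fun x => mem_iUnion.2 ?_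
  rcases exists_mem_chart_source x with h | ⟨e, h⟩
  · exact ⟨none, h⟩
  · exact ⟨some e, h⟩

lemma closure_rectangle {a b c d : ℝ} (hab : a < b) (hcd : c < d) :
    closure (Ioo a b ×ℂ Ioo c d) = Icc a b ×ℂ Icc c d := by
  rw [Complex.closure_reProdIm, closure_Ioo hab.ne, closure_Ioo hcd.ne]

lemma isPreconnected_rectangle (a b c d : ℝ) : IsPreconnected (Ioo a b ×ℂ Ioo c d) :=
  (((convex_Ioo a b).linear_preimage Complex.reLm).inter
    ((convex_Ioo c d).linear_preimage Complex.imLm)).isPreconnected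

lemma isPreconnected_polygonInterior : IsPreconnected polygonInterior := by
  refine IsPreconnected.union ⟨1 / 4, 3 / 4⟩ ?_ ?_ (IsPreconnected.union ⟨1 / 4, 1 / 4⟩ ?_ ?_
    (isPreconnected_rectangle _ _ _ _) (isPreconnected_rectangle _ _ _ _))
    (isPreconnected_rectangle _ _ _ _)
  · right; constructor <;> constructor <;> norm_num
  · constructor <;> constructor <;> norm_num
  · constructor <;> constructor <;> norm_num
  · constructor <;> constructor <;> norm_num

lemma polygon_subset_closure : polygon ⊆ closure polygonInterior := by
  intro z hz
  rcases polygon_bounds hz with h | h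
  · refine closure_mono (s := Ioo (-1 / 2 : ℝ) (1 / 2) ×ℂ Ioo (0 : ℝ) (1 / 2)) ?_ ?_
    · exact subset_union_left.trans subset_union_left
    · rw [closure_rectangle (by norm_num) (by norm_num)]
      exact ⟨⟨h.1, h.2.1⟩, h.2.2⟩
  · refine closure_mono (s := Ioo (0 : ℝ) 1 ×ℂ Ioo (1 / 2 : ℝ) 1) subset_union_right ?_
    rw [closure_rectangle (by norm_num) (by norm_num)]
    exact ⟨⟨h.1, h.2.1⟩, h.2.2⟩

/-- The polygon lies between its connected interior and the closure of that interior. -/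
instance : ConnectedSpace XInf := by
  have h : pr '' polygon = univ := eq_univ_of_forall exists_pr
  have h1 := (isPreconnected_polygonInterior.subset_closure polygonInterior_subset
    polygon_subset_closure).image pr continuousOn_pr
  rw [h] at h1
  exact { isPreconnected_univ := h1, toNonempty := ⟨pr 0⟩ }

/-- Two local coordinates differ by a locally constant function. -/
lemma eventually_eq_add {φ χ : OpenPartialHomeomorph XInf ℂ} (hφ : φ ∈ translationAtlas)
    (hχ : χ ∈ translationAtlas) {x : XInf} (h : x ∈ φ.source) (h' : x ∈ χ.source) :
    ∀ᶠ y in 𝓝 x, χ y = φ y + (χ x - φ x) := by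
  rw [mem_translationAtlas] at hφ hχ
  obtain ⟨z, hz, rfl⟩ := exists_pr x
  refine eventually_nhds_pr hz fun w hw hwz => ?_
  rw [← hwz] at h h' ⊢
  obtain ⟨a, ha⟩ := hφ w hw h
  obtain ⟨b, hb⟩ := hχ w hw h'
  filter_upwards [ha, hb] with v h1 h2
  rw [h1, h2, ha.self_of_nhdsWithin hw, hb.self_of_nhdsWithin hw]
  ring

lemma eventually_symm_eq_add {φ χ : OpenPartialHomeomorph XInf ℂ} (hφ : φ ∈ translationAtlas)
    (hχ : χ ∈ translationAtlas) {z : ℂ} (h : z ∈ φ.target) (h' : φ.symm z ∈ χ.source) :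
    ∀ᶠ w in 𝓝 z, χ (φ.symm w) = w + (χ (φ.symm z) - z) := by
  have h1 := (φ.continuousAt_symm h).eventually (eventually_eq_add hφ hχ (φ.map_target h) h')
  filter_upwards [h1, φ.open_target.mem_nhds h] with w hw hwt
  rw [hw, φ.right_inv hwt, φ.right_inv h]

instance : IsManifold 𝓘(ℂ) ω XInf := by
  refine isManifold_of_contDiffOn _ _ _ fun φ χ hφ hχ => ?_
  intro z hz
  simp only [modelWithCornersSelf_coe, modelWithCornersSelf_coe_symm, preimage_id_eq, id_eq,
    range_id, inter_univ, OpenPartialHomeomorph.trans_source, OpenPartialHomeomorph.symm_source,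
    mem_inter_iff, mem_preimage, Function.id_comp, Function.comp_id] at hz ⊢
  have h1 := eventually_symm_eq_add hφ hχ hz.1 hz.2
  refine ContDiffAt.contDiffWithinAt ?_
  refine ContDiffAt.congr_of_eventuallyEq (f := fun w => w + (χ (φ.symm z) - z)) (by fun_prop) ?_
  exact h1

lemma isRiemannSurface : IsRiemannSurface XInf :=
  ⟨inferInstance, inferInstance, inferInstance, inferInstance⟩

/-! ## The abelian differential -/

/-- The form `ω_∞`. -/
abbrev omega : OneForm XInf := omegaInf hasLocalCoordinates

lemma chartAt_mem (x : XInf) : chartAt ℂ x ∈ translationAtlas := chart_mem_atlas ℂ x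

lemma hasMFDerivAt_of_eventually {f : XInf → ℂ} {x : XInf} {c : ℂ}
    (h : ∀ᶠ y in 𝓝 x, f y = chartAt ℂ x y + c) :
    HasMFDerivAt 𝓘(ℂ) 𝓘(ℂ) f x (ContinuousLinearMap.id ℂ ℂ) := by
  constructor
  · have h1 : ContinuousAt (fun y => chartAt ℂ x y + c) x :=
      ((chartAt ℂ x).continuousAt (mem_chart_source ℂ x)).add continuousAt_const
    exact h1.congr (h.mono fun _ h => h.symm)
  · simp only [writtenInExtChartAt, extChartAt, OpenPartialHomeomorph.extend,
      modelWithCornersSelf_partialEquiv, PartialEquiv.trans_refl, modelWithCornersSelf_coe,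
      range_id, chartAt_self_eq, OpenPartialHomeomorph.refl_partialEquiv,
      PartialEquiv.refl_coe, OpenPartialHomeomorph.toFun_eq_coe, Function.id_comp,
      OpenPartialHomeomorph.coe_toPartialEquiv_symm]
    have hx := mem_chart_source ℂ x
    have h1 : ∀ᶠ z in 𝓝 (chartAt ℂ x x), (f ∘ (chartAt ℂ x).symm) z = z + c := by
      have h2 := (chartAt ℂ x).continuousAt_symm ((chartAt ℂ x).map_source hx)
      rw [ContinuousAt, (chartAt ℂ x).left_inv hx] at h2
      filter_upwards [h2.eventually h,
        (chartAt ℂ x).open_target.mem_nhds ((chartAt ℂ x).map_source hx)] with z hz hzt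
      simp only [Function.comp_apply, hz, (chartAt ℂ x).right_inv hzt]
    exact HasFDerivAt.hasFDerivWithinAt (((hasFDerivAt_id _).add_const c).congr_of_eventuallyEq h1)

lemma omega_apply (x : XInf) : omega x = ContinuousLinearMap.id ℂ ℂ :=
  (hasMFDerivAt_of_eventually (c := 0) (Filter.Eventually.of_forall fun y => by simp)).mfderiv

lemma omega_ne_zero (x : XInf) : omega x ≠ 0 := by
  rw [omega_apply]
  intro h
  exact one_ne_zero (α := ℂ) (congrArg (fun L : ℂ →L[ℂ] ℂ => L 1) h)

lemma hasMFDerivAt_symm {φ : OpenPartialHomeomorph XInf ℂ} (hφ : φ ∈ translationAtlas) {z : ℂ}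
    (hz : z ∈ φ.target) :
    HasMFDerivAt 𝓘(ℂ) 𝓘(ℂ) φ.symm z (ContinuousLinearMap.id ℂ ℂ) := by
  constructor
  · exact φ.continuousAt_symm hz
  · simp only [writtenInExtChartAt, extChartAt, OpenPartialHomeomorph.extend,
      modelWithCornersSelf_partialEquiv, PartialEquiv.trans_refl, modelWithCornersSelf_coe,
      range_id, chartAt_self_eq, OpenPartialHomeomorph.refl_partialEquiv,
      PartialEquiv.refl_coe, OpenPartialHomeomorph.toFun_eq_coe, PartialEquiv.refl_symm,
      Function.comp_id, id_eq]
    have h1 := eventually_symm_eq_add hφ (chartAt_mem (φ.symm z)) hz (mem_chart_source ℂ _)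
    exact HasFDerivAt.hasFDerivWithinAt (((hasFDerivAt_id z).add_const _).congr_of_eventuallyEq h1)

lemma coeff_omega {φ : OpenPartialHomeomorph XInf ℂ} (hφ : φ ∈ translationAtlas) {z : ℂ}
    (hz : z ∈ φ.target) : omega.coeff φ z = 1 := by
  rw [OneForm.coeff, (hasMFDerivAt_symm hφ hz).mfderiv, omega_apply]
  rfl

lemma omega_isHolomorphic : omega.IsHolomorphic := fun _ hφ =>
  (differentiableOn_const 1).congr fun _ hz => coeff_omega hφ hz

/-- Read in a translation chart, a canonical chart has derivative 1, so it differs from the identity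
by a constant on a disc. This lets the affine maps be tested on translation charts only. -/
lemma mem_translationAtlas_of_isCanonicalChart {φ : OpenPartialHomeomorph XInf ℂ}
    (h : omega.IsCanonicalChart φ) : φ ∈ translationAtlas := by
  rw [mem_translationAtlas]
  intro z hz hzs
  set x := pr z
  let e := chartAt ℂ x
  have hx : x ∈ e.source := mem_chart_source ℂ x
  have he : e ∈ translationAtlas := chartAt_mem x
  have hd : ∀ w ∈ e.target ∩ e.symm ⁻¹' φ.source,
      HasFDerivAt (φ ∘ e.symm) (ContinuousLinearMap.id ℂ ℂ) w := by
    intro w hw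
    have h1 : MDifferentiableAt 𝓘(ℂ) 𝓘(ℂ) φ (e.symm w) :=
      mdifferentiableAt_of_mem_maximalAtlas
        (IsManifold.maximalAtlas_subset_of_le (by simp) h.1) hw.2
    have h2 := h1.hasMFDerivAt
    rw [h.2 _ hw.2, omega_apply] at h2
    have h3 := h2.comp w (hasMFDerivAt_symm he hw.1)
    exact h3.hasFDerivAt
  have hO : IsOpen (e.target ∩ e.symm ⁻¹' φ.source) := e.isOpen_inter_preimage_symm φ.open_source
  have hmem : e x ∈ e.target ∩ e.symm ⁻¹' φ.source :=
    ⟨e.map_source hx, by rwa [mem_preimage, e.left_inv hx]⟩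
  obtain ⟨r, hr, hball⟩ := Metric.isOpen_iff.1 hO _ hmem
  have hconst : ∀ w ∈ Metric.ball (e x) r, φ (e.symm w) - w = φ (e.symm (e x)) - e x := by
    intro w hw
    refine Metric.isOpen_ball.is_const_of_fderiv_eq_zero (𝕜 := ℂ)
      (convex_ball (e x) r).isPreconnected (f := fun w => φ (e.symm w) - w) ?_ ?_ hw
      (Metric.mem_ball_self hr)
    · intro v hv
      exact ((hd v (hball hv)).sub (hasFDerivAt_id v)).differentiableAt.differentiableWithinAt
    · intro v hv
      have := ((hd v (hball hv)).sub (hasFDerivAt_id v)).fderiv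
      rw [sub_self] at this
      exact this
  obtain ⟨c, hc⟩ := mem_translationAtlas.1 he z hz hx
  refine ⟨c + (φ (e.symm (e x)) - e x), ?_⟩
  have hcont : ContinuousWithinAt pr polygon z := continuousOn_pr z hz
  filter_upwards [hc, hcont.eventually (e.open_source.mem_nhds hx), hcont.eventually
    ((e.continuousAt hx).eventually (Metric.ball_mem_nhds _ hr))] with v h1 h2 h3
  have h4 := hconst _ h3
  rw [e.left_inv h2, h1] at h4
  rw [← add_assoc, ← h4]
  ring

/-! ### Area -/

lemma measurableSet_polygon : MeasurableSet polygon := by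
  have h : ∀ e : Edge, MeasurableSet e.side := by
    intro e
    have h : e.side = e.slab ∩ e.inner ∩ e.outer := Subset.antisymm
      (fun z hz => ⟨⟨Edge.side_subset_slab hz, Edge.side_subset_inner hz⟩, Edge.side_subset_outer hz⟩)
      fun z hz => Edge.mem_side_of_mem_inner_outer hz.1.1 hz.1.2 hz.2
    rw [h]
    exact (e.isOpen_slab.measurableSet.inter e.isClosed_inner.measurableSet).inter
      e.isClosed_outer.measurableSet
  refine isOpen_polygonInterior.measurableSet.union (MeasurableSet.iUnion fun e => ?_)
  refine (h e).union ?_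
  rw [image_add_right]
  exact measurable_add_const _ (h e)

-- The coefficient is 1, so a piece contributes its Lebesgue measure. Its lift to the polygon has at
-- least that measure, and the lifts of disjoint pieces are disjoint subsets of a bounded set.
open MeasureTheory in
lemma omega_area_lt_top : omega.area < ⊤ := by
  have hbdd : volume polygon < ⊤ := by
    refine Bornology.IsBounded.measure_lt_top ?_
    refine (Metric.isBounded_closedBall (x := (0 : ℂ)) (r := 2)).subset fun z hz => ?_
    rw [mem_closedBall_zero_iff]
    refine (Complex.norm_le_abs_re_add_abs_im z).trans ?_
    have h1 : |z.re| ≤ 1 := by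
      rcases polygon_bounds hz with h | h <;> exact abs_le.2 ⟨by linarith, by linarith⟩
    have h2 : |z.im| ≤ 1 := by
      rcases polygon_bounds hz with h | h <;> exact abs_le.2 ⟨by linarith, by linarith⟩
    linarith
  refine lt_of_le_of_lt ?_ hbdd
  refine iSup_le fun n => iSup_le fun e => iSup_le fun S => iSup_le fun hS => iSup_le fun hd => ?_
  let W : Fin n → Set ℂ := fun i => polygon ∩ {z | pr z ∈ (e i).symm '' S i}
  have hWe : ∀ i, W i = polygon ∩ {z | pr z ∈ (e i).source ∧ e i (pr z) ∈ S i} := by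
    intro i
    ext z
    refine and_congr_right fun hz => ?_
    constructor
    · rintro ⟨w, hw, hwz⟩
      simp only [mem_ofPred_eq]
      rw [← hwz, (e i).right_inv ((hS i).2.1 hw)]
      exact ⟨(e i).map_target ((hS i).2.1 hw), hw⟩
    · rintro ⟨h1, h2⟩
      exact ⟨_, h2, (e i).left_inv h1⟩
  have hWm : ∀ i, MeasurableSet (W i) := by
    intro i
    rw [hWe]
    have h1 : ContinuousOn (fun p : polygon => e i (proj p)) (proj ⁻¹' (e i).source) :=
      (e i).continuousOn.comp continuous_proj.continuousOn fun _ h => h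
    have h2 : MeasurableSet {p : polygon | proj p ∈ (e i).source ∧ e i (proj p) ∈ S i} := by
      have h3 : MeasurableSet (proj ⁻¹' (e i).source) :=
        ((e i).open_source.preimage continuous_proj).measurableSet
      have h4 := h1.domRestrict.measurable (hS i).2.2
      exact MeasurableSet.subtype_image h3 h4 |>.congr (by
        ext p
        simp [Set.domRestrict, and_comm])
    have h5 := measurableSet_polygon.subtype_image h2
    convert h5 using 1
    ext z
    constructor
    · rintro ⟨hz, h⟩
      refine ⟨⟨z, hz⟩, ?_, rfl⟩
      rwa [mem_ofPred_eq, ← pr_of_mem hz]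
    · rintro ⟨p, hp, rfl⟩
      refine ⟨p.2, ?_⟩
      rwa [mem_ofPred_eq, pr_coe]
  have hle : ∀ i, ∫⁻ z in S i, ‖omega.coeff (e i) z‖ₑ ^ 2 ≤ volume (W i) := by
    intro i
    have h1 : ∫⁻ z in S i, ‖omega.coeff (e i) z‖ₑ ^ 2 = volume (S i) := by
      rw [setLIntegral_congr_fun (g := fun _ => 1) (hS i).2.2 fun z hz => by
        simp only [coeff_omega (hS i).1 ((hS i).2.1 hz)]; simp]
      simp
    rw [h1]
    -- Surjectivity is enough: points on edges have two lifts, but only an upper bound for the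
    -- measure of `S i` is needed.
    have h2 : S i ⊆ (fun z => e i (pr z)) '' W i := by
      intro w hw
      obtain ⟨z, hz, hzw⟩ := exists_pr ((e i).symm w)
      refine ⟨z, ⟨hz, w, hw, hzw.symm⟩, ?_⟩
      simp only [hzw, (e i).right_inv ((hS i).2.1 hw)]
    refine (measure_mono h2).trans ?_
    -- Near each point the map is a translation, so its Jacobian is 1 and it cannot increase
    -- measure.
    have h3 : ∀ z ∈ W i, HasFDerivWithinAt (fun z => e i (pr z))
        (ContinuousLinearMap.id ℝ ℂ) (W i) z := by
      intro z hz
      have hz' := hz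
      rw [hWe] at hz'
      obtain ⟨c, hc⟩ := mem_translationAtlas.1 (hS i).1 z hz.1 hz'.2.1
      refine ((hasFDerivWithinAt_id z _).add_const c).congr_of_eventuallyEq ?_
        (hc.self_of_nhdsWithin hz.1)
      exact hc.filter_mono (nhdsWithin_mono _ inter_subset_left)
    refine (addHaar_image_le_lintegral_abs_det_fderiv volume (hWm i) h3).trans ?_
    simp [ContinuousLinearMap.det]
  calc ∑ i, ∫⁻ z in S i, ‖omega.coeff (e i) z‖ₑ ^ 2 ≤ ∑ i, volume (W i) :=
        Finset.sum_le_sum fun i _ => hle i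
    _ = volume (⋃ i, W i) := by
        rw [measure_iUnion (fun i j hij => ?_) hWm, tsum_fintype]
        exact disjoint_left.2 fun z h1 h2 => disjoint_left.1 (hd hij) h1.2 h2.2
    _ ≤ volume polygon := measure_mono (iUnion_subset fun i => inter_subset_left)

/-! ## Piecewise affine maps -/

/-- Two points of the polygon represent the same point of the surface. -/
def Linked (z w : ℂ) : Prop := z ∈ polygon ∧ w ∈ polygon ∧ pr z = pr w

lemma Linked.symm {z w : ℂ} (h : Linked z w) : Linked w z := ⟨h.2.1, h.1, h.2.2.symm⟩

lemma Linked.of_interior {z w : ℂ} (h : z ∈ polygonInterior) (hw : w = z) : Linked z w := by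
  subst hw
  exact ⟨polygonInterior_subset h, polygonInterior_subset h, rfl⟩

lemma Linked.of_side {z w : ℂ} (e : Edge) (h : z ∈ e.side) (hw : w = z + e.shift) : Linked z w := by
  subst hw
  exact ⟨side_subset e h, side'_subset e (Edge.add_shift_mem_side' h), (pr_add_shift h).symm⟩

/-- A continuous self-map of the surface, given by maps of closed pieces of the polygon. -/
structure Pieces (n : ℕ) where
  dom : Fin n → Set ℂ
  toFun : Fin n → ℂ → ℂ
  isClosed : ∀ i, IsClosed (dom i)
  continuous : ∀ i, Continuous (toFun i)
  cover : ∀ z ∈ polygon, ∃ i, z ∈ dom i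
  -- That the image lies in the polygon is required only at interior points of a single piece; at
  -- all other points it is part of `Linked`.
  interior : ∀ i, ∀ z ∈ polygonInterior, z ∈ dom i → (∀ j ≠ i, z ∉ dom j) → toFun i z ∈ polygon
  overlap : ∀ i j, i < j → ∀ z ∈ polygon, z ∈ dom i → z ∈ dom j → Linked (toFun i z) (toFun j z)
  glue : ∀ e : Edge, ∀ z ∈ e.side, ∃ i j, z ∈ dom i ∧ z + e.shift ∈ dom j ∧
    Linked (toFun i z) (toFun j (z + e.shift))

namespace Pieces

variable {n : ℕ} (p : Pieces n)

lemma linked_of_ne {i j : Fin n} (h : i ≠ j) {z : ℂ} (hz : z ∈ polygon) (hi : z ∈ p.dom i)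
    (hj : z ∈ p.dom j) : Linked (p.toFun i z) (p.toFun j z) := by
  rcases lt_or_gt_of_ne h with h | h
  · exact p.overlap i j h z hz hi hj
  · exact (p.overlap j i h z hz hj hi).symm

lemma maps {i : Fin n} {z : ℂ} (hz : z ∈ polygon) (hi : z ∈ p.dom i) : p.toFun i z ∈ polygon := by
  by_cases h : ∃ j ≠ i, z ∈ p.dom j
  · obtain ⟨j, hj, hzj⟩ := h
    exact (p.linked_of_ne hj.symm hz hi hzj).1
  push Not at h
  have key : ∀ j, z ∈ p.dom j → j = i := fun j hj => by
    by_contra hne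
    exact h j hne hj
  rcases mem_polygon.1 hz with h0 | ⟨e, h0 | ⟨w, h0, rfl⟩⟩
  · exact p.interior i z h0 hi h
  · obtain ⟨i', j', h1, h2, h3⟩ := p.glue e z h0
    exact key i' h1 ▸ h3.1
  · obtain ⟨i', j', h1, h2, h3⟩ := p.glue e w h0
    exact key j' h2 ▸ h3.2.1

lemma pr_toFun_eq {i j : Fin n} {z : ℂ} (hz : z ∈ polygon) (hi : z ∈ p.dom i)
    (hj : z ∈ p.dom j) : pr (p.toFun i z) = pr (p.toFun j z) := by
  by_cases h : i = j
  · rw [h]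
  · exact (p.linked_of_ne h hz hi hj).2.2

/-- The map of the surface defined by maps of pieces of the polygon. -/
def map : XInf → XInf :=
  Quot.lift (fun q : polygon => pr (p.toFun (p.cover q q.2).choose q)) (by
    rintro ⟨z, hz⟩ ⟨w, hw⟩ ⟨e, h, h'⟩
    simp only at h h'
    subst h'
    obtain ⟨i, j, h1, h2, h3⟩ := p.glue e z h
    simp only
    rw [p.pr_toFun_eq hz (p.cover z hz).choose_spec h1,
      p.pr_toFun_eq hw (p.cover _ hw).choose_spec h2, h3.2.2])

lemma map_pr {i : Fin n} {z : ℂ} (hz : z ∈ polygon) (hi : z ∈ p.dom i) :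
    p.map (pr z) = pr (p.toFun i z) := by
  rw [pr_of_mem hz]
  exact p.pr_toFun_eq hz (p.cover z hz).choose_spec hi

lemma continuous_map : Continuous p.map := by
  refine continuous_quot_lift _ ?_
  refine LocallyFinite.continuous (f := fun i => {q : polygon | (q : ℂ) ∈ p.dom i})
    (locallyFinite_of_finite _) ?_ (fun i => (p.isClosed i).preimage continuous_subtype_val) ?_
  · exact eq_univ_of_forall fun q => mem_iUnion.2 (p.cover q q.2)
  · intro i
    have h : ContinuousOn (fun q : polygon => pr (p.toFun i q)) {q : polygon | (q : ℂ) ∈ p.dom i} :=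
      continuousOn_pr.comp ((p.continuous i).comp continuous_subtype_val).continuousOn
        fun q hq => p.maps q.2 hq
    exact h.congr fun q hq => p.pr_toFun_eq q.2 (p.cover q q.2).choose_spec hq

/-- The pieces that meet a small neighbourhood of a point contain the point. -/
lemma eventually_mem (w : ℂ) : ∀ᶠ v in 𝓝 w, ∀ i, v ∈ p.dom i → w ∈ p.dom i := by
  rw [Filter.eventually_all]
  intro i
  by_cases h : w ∈ p.dom i
  · exact Filter.Eventually.of_forall fun _ _ => h
  · filter_upwards [(p.isClosed i).isOpen_compl.mem_nhds h] with v hv hv'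
    exact (hv hv').elim

/-- All pieces have the same linear part `A`, so `χ ∘ f - A ∘ φ` is constant near each
representative within each piece. The constant is its value at the point itself, hence the same for
all pieces and representatives. -/
lemma hasDer {f : XInf ≃ₜ XInf} (hf : ∀ x, f x = p.map x) {A : ℂ ≃L[ℝ] ℂ}
    (hA : ∀ i, ∃ b, ∀ z, p.toFun i z = A z + b) : omega.HasDer f A := by
  intro x φ χ hφ hχ hx hfx
  replace hφ := mem_translationAtlas.1 (mem_translationAtlas_of_isCanonicalChart hφ)
  replace hχ := mem_translationAtlas.1 (mem_translationAtlas_of_isCanonicalChart hχ)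
  choose b hb using hA
  obtain ⟨z, hz, rfl⟩ := exists_pr x
  refine ⟨χ (f (pr z)) - A (φ (pr z)), eventually_nhds_pr hz fun w hw hwz => ?_⟩
  rw [← hwz] at hx hfx ⊢
  obtain ⟨c, hc⟩ := hφ w hw hx
  have key : ∀ i, w ∈ p.dom i → ∀ᶠ v in 𝓝[polygon] w, v ∈ p.dom i →
      χ (f (pr v)) = A (φ (pr v)) + (χ (f (pr w)) - A (φ (pr w))) := by
    intro i hi
    rw [hf, p.map_pr hw hi] at hfx
    obtain ⟨d, hd⟩ := hχ _ (p.maps hw hi) hfx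
    have hd0 := hd.self_of_nhdsWithin (p.maps hw hi)
    rw [eventually_nhdsWithin_iff] at hd
    have h1 := (p.continuous i).continuousAt.eventually hd
    filter_upwards [hc, mem_nhdsWithin_of_mem_nhds h1, self_mem_nhdsWithin] with v hv1 hv2 hv3 hv4
    rw [hf, hf, p.map_pr hv3 hv4, p.map_pr hw hi, hv2 (p.maps hv3 hv4), hv1, hd0,
      hc.self_of_nhdsWithin hw, hb, hb, map_add, map_add]
    ring
  have key' : ∀ᶠ v in 𝓝[polygon] w, ∀ i, w ∈ p.dom i → v ∈ p.dom i →
      χ (f (pr v)) = A (φ (pr v)) + (χ (f (pr w)) - A (φ (pr w))) := by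
    rw [Filter.eventually_all]
    intro i
    by_cases hi : w ∈ p.dom i
    · exact (key i hi).mono fun v hv _ => hv
    · exact Filter.Eventually.of_forall fun v h => (hi h).elim
  filter_upwards [key', mem_nhdsWithin_of_mem_nhds (p.eventually_mem w), self_mem_nhdsWithin]
    with v h1 h2 h3
  obtain ⟨i, hi⟩ := p.cover v h3
  exact h1 i (h2 i hi) hi

end Pieces

/-! ## The involution and the pseudo-Anosov map -/

lemma polygon_re_im_cases {z : ℂ} (h : z ∈ polygon) :
    (z.im ≤ 1 / 2 ∧ z.re ≤ 1 / 2) ∨ (1 / 2 ≤ z.im ∧ 0 ≤ z.re) := by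
  rcases polygon_bounds h with h | h
  · exact .inl ⟨h.2.2.2, h.2.1⟩
  · exact .inr ⟨h.2.2.1, h.1⟩

/-- The ends `i/2` and `1/2 + i/2` of the common segment of the two rectangles are vertices, so they
are missing from the polygon. -/
lemma interior_of_im_eq_half {z : ℂ} (h : z ∈ polygon) (h1 : z.im = 1 / 2) (h2 : 0 ≤ z.re)
    (h3 : z.re ≤ 1 / 2) : 0 < z.re ∧ z.re < 1 / 2 := by
  rcases mem_polygon.1 h with h | ⟨e, h | h⟩
  · rcases mem_polygonInterior.1 h with h | h | h <;> constructor <;> linarith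
  · rcases Edge.side_bounds h with h | h | h | h <;> constructor <;> linarith
  · rcases Edge.side'_bounds h with h | h | h | h <;> constructor <;> linarith

/-- The pieces of the orientation-reversing involution. -/
def rhoPieces : Pieces 2 where
  dom i := match i with
    | 0 => {z | z.im ≤ 1 / 2} ∩ {z | z.re ≤ 1 / 2}
    | 1 => {z | 1 / 2 ≤ z.im} ∩ {z | 0 ≤ z.re}
  toFun i z := match i with
    | 0 => Complex.conjCLE z + ⟨1 / 2, 1⟩
    | 1 => Complex.conjCLE z + ⟨-1 / 2, 1⟩
  isClosed i := match i with
    | 0 => (isClosed_le (by fun_prop) (by fun_prop)).inter (isClosed_le (by fun_prop) (by fun_prop))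
    | 1 => (isClosed_le (by fun_prop) (by fun_prop)).inter (isClosed_le (by fun_prop) (by fun_prop))
  continuous i := match i with
    | 0 => by fun_prop
    | 1 => by fun_prop
  cover z hz := by
    rcases polygon_re_im_cases hz with h | h
    · exact ⟨0, h⟩
    · exact ⟨1, h⟩
  interior i z hz hi hne := by
    refine polygonInterior_subset (mem_polygonInterior.2 ?_)
    replace hz := mem_polygonInterior.1 hz
    match i with
    | 0 =>
      have h1 := hne 1 (by decide)
      simp only [mem_inter_iff, mem_ofPred_eq] at hi h1
      simp only [Complex.conjCLE_apply, Complex.add_re, Complex.add_im, Complex.conj_re,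
        Complex.conj_im]
      have h2 : z.im < 1 / 2 := by
        by_contra h
        push Not at h
        exact h1 ⟨h, by rcases hz with hz | hz | hz <;> linarith⟩
      rcases hz with hz | hz | hz
      · exact .inr <| .inr ⟨by linarith, by linarith, by linarith, by linarith⟩
      · exact .inr <| .inr ⟨by linarith, by linarith, by linarith, by linarith⟩
      · linarith
    | 1 =>
      have h1 := hne 0 (by decide)
      simp only [mem_inter_iff, mem_ofPred_eq] at hi h1
      simp only [Complex.conjCLE_apply, Complex.add_re, Complex.add_im, Complex.conj_re,
        Complex.conj_im]
      have h2 : 1 / 2 < z.im := by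
        by_contra h
        push Not at h
        exact h1 ⟨h, by rcases hz with hz | hz | hz <;> linarith⟩
      rcases hz with hz | hz | hz
      · linarith
      · exact .inl ⟨by linarith, by linarith, by linarith, by linarith⟩
      · exact .inl ⟨by linarith, by linarith, by linarith, by linarith⟩
  overlap i j hij z hz hi hj := match i, j with
    | 0, 0 => absurd hij (by decide)
    | 1, 0 => absurd hij (by decide)
    | 1, 1 => absurd hij (by decide)
    | 0, 1 => by
      have h : z.im = 1 / 2 := le_antisymm (by exact hi.1) (by exact hj.1)
      have h1 := interior_of_im_eq_half hz h hj.2 hi.2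
      -- The cut between the two rectangles is opened into the unlabeled pair; conversely, the
      -- unlabeled pair is closed up in the interior (first case of `glue`).
      refine (Linked.of_side .unlabeled (Edge.mem_side_unlabeled.2 ?_) ?_).symm
      · simp
        exact ⟨by linarith, by linarith, by linarith⟩
      · apply Complex.ext <;> simp [Edge.shift_unlabeled]
        ring
  glue e z hz := by
    rcases Edge.side_cases hz with
      ⟨rfl, h⟩ | ⟨n, rfl, h⟩ | ⟨n, rfl, h⟩ | ⟨n, rfl, h⟩ | ⟨n, rfl, h⟩
    · refine ⟨0, 1, ⟨by simp only [mem_ofPred_eq]; linarith, by simp only [mem_ofPred_eq]; linarith⟩,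
        ⟨?_, ?_⟩, Linked.of_interior (mem_polygonInterior.2 (.inr (.inl ?_))) ?_⟩
      · simp [Edge.shift_unlabeled, h.1]
      · simp [Edge.shift_unlabeled]; linarith
      · simp
        exact ⟨by linarith, by linarith, by linarith, by linarith⟩
      · apply Complex.ext <;> simp [Edge.shift_unlabeled]
        ring
    · have h1 : z ∈ {z : ℂ | 1 / 2 ≤ z.im} ∩ {z | 0 ≤ z.re} := by
        constructor <;> simp only [mem_ofPred_eq] <;> linarith
      have h2 : Complex.conjCLE z + ⟨-1 / 2, 1⟩ ∈ (Edge.B n).side := by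
        rw [Edge.mem_side_B]
        simp
        exact ⟨by linarith, by linarith, by linarith⟩
      -- The parity decides whether the partner of `A n` lies on the lower rectangle (piece 0) or on
      -- the upper one (piece 1).
      by_cases hn : Even n
      · refine ⟨1, 0, h1, ⟨?_, ?_⟩, Linked.of_side (.B n) h2 ?_⟩
        · simp [Edge.shift_A_even hn]; linarith
        · simp [Edge.shift_A_even hn]; linarith
        · apply Complex.ext <;> simp [Edge.shift_A_even hn, Edge.shift_B_even hn] <;> ring
      · have := dyad_odd_le hn
        refine ⟨1, 1, h1, ⟨?_, ?_⟩, Linked.of_side (.B n) h2 ?_⟩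
        · simp [Edge.shift_A_odd hn]; linarith
        · simp [Edge.shift_A_odd hn]; linarith
        · apply Complex.ext <;> simp [Edge.shift_A_odd hn, Edge.shift_B_odd hn] <;> ring
    · have h1 : z ∈ {z : ℂ | z.im ≤ 1 / 2} ∩ {z | z.re ≤ 1 / 2} := by
        constructor <;> simp only [mem_ofPred_eq] <;> linarith
      have h2 : Complex.conjCLE z + ⟨1 / 2, 1⟩ ∈ (Edge.A n).side := by
        rw [Edge.mem_side_A]
        simp
        exact ⟨by linarith, by linarith, by linarith⟩
      by_cases hn : Even n
      · refine ⟨0, 1, h1, ⟨?_, ?_⟩, Linked.of_side (.A n) h2 ?_⟩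
        · simp [Edge.shift_B_even hn]; linarith
        · simp [Edge.shift_B_even hn]; linarith
        · apply Complex.ext <;> simp [Edge.shift_A_even hn, Edge.shift_B_even hn] <;> ring
      · have := dyad_odd_le hn
        refine ⟨0, 0, h1, ⟨?_, ?_⟩, Linked.of_side (.A n) h2 ?_⟩
        · simp [Edge.shift_B_odd hn]; linarith
        · simp [Edge.shift_B_odd hn]; linarith
        · apply Complex.ext <;> simp [Edge.shift_A_odd hn, Edge.shift_B_odd hn] <;> ring
    · have h1 : z ∈ {z : ℂ | 1 / 2 ≤ z.im} ∩ {z | 0 ≤ z.re} := by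
        constructor <;> simp only [mem_ofPred_eq] <;> linarith
      refine ⟨1, 0, h1, ⟨?_, ?_⟩, (Linked.of_side (.C'' n) (Edge.mem_side_C''.2 ?_) ?_).symm⟩
      · simp [Edge.shift_C']; linarith
      · simp [Edge.shift_C']; linarith
      · simp [Edge.shift_C']
        exact ⟨by linarith, by linarith, by linarith⟩
      · apply Complex.ext <;> simp [Edge.shift_C', Edge.shift_C'']
        ring
    · have h1 : z ∈ {z : ℂ | 1 / 2 ≤ z.im} ∩ {z | 0 ≤ z.re} := by
        constructor <;> simp only [mem_ofPred_eq] <;> linarith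
      refine ⟨1, 0, h1, ⟨?_, ?_⟩, (Linked.of_side (.C' n) (Edge.mem_side_C'.2 ?_) ?_).symm⟩
      · simp [Edge.shift_C'']; linarith
      · simp [Edge.shift_C'']; linarith
      · simp [Edge.shift_C'']
        exact ⟨by linarith, by linarith, by linarith⟩
      · apply Complex.ext <;> simp [Edge.shift_C', Edge.shift_C'']
        ring

/-- Writing the image as `z` plus a displacement allows a direct comparison with the gluing
translations. -/
lemma rho_lower {z : ℂ} (hz : z ∈ polygon) (h : z.im ≤ 1 / 2) (h' : z.re ≤ 1 / 2) :
    z + ⟨1 / 2, 1 - 2 * z.im⟩ ∈ polygon ∧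
      rhoPieces.map (pr z) = pr (z + ⟨1 / 2, 1 - 2 * z.im⟩) := by
  have h1 : z + ⟨1 / 2, 1 - 2 * z.im⟩ = rhoPieces.toFun 0 z := by
    apply Complex.ext <;> simp [rhoPieces]
    ring
  rw [h1]
  exact ⟨rhoPieces.maps hz ⟨h, h'⟩, rhoPieces.map_pr hz ⟨h, h'⟩⟩

lemma rho_upper {z : ℂ} (hz : z ∈ polygon) (h : 1 / 2 ≤ z.im) (h' : 0 ≤ z.re) :
    z + ⟨-1 / 2, 1 - 2 * z.im⟩ ∈ polygon ∧
      rhoPieces.map (pr z) = pr (z + ⟨-1 / 2, 1 - 2 * z.im⟩) := by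
  have h1 : z + ⟨-1 / 2, 1 - 2 * z.im⟩ = rhoPieces.toFun 1 z := by
    apply Complex.ext <;> simp [rhoPieces]
    ring
  rw [h1]
  exact ⟨rhoPieces.maps hz ⟨h, h'⟩, rhoPieces.map_pr hz ⟨h, h'⟩⟩

lemma rho_rho (x : XInf) : rhoPieces.map (rhoPieces.map x) = x := by
  obtain ⟨z, hz, rfl⟩ := exists_pr x
  rcases polygon_bounds hz with h | h
  · obtain ⟨h1, h2⟩ := rho_lower hz h.2.2.2 h.2.1
    rw [h2, (rho_upper h1 (by simp; linarith) (by simp; linarith)).2]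
    congr 1
    apply Complex.ext <;> simp
    · ring
    · ring
  · obtain ⟨h1, h2⟩ := rho_upper hz h.2.2.1 h.1
    rw [h2, (rho_lower h1 (by simp; linarith) (by simp; linarith)).2]
    congr 1
    apply Complex.ext <;> simp
    · ring
    · ring

/-- The involution `ρ_∞`. -/
def rho : XInf ≃ₜ XInf where
  toFun := rhoPieces.map
  invFun := rhoPieces.map
  left_inv := rho_rho
  right_inv := rho_rho
  continuous_toFun := rhoPieces.continuous_map
  continuous_invFun := rhoPieces.continuous_map

/-- At a fixed point in the lower rectangle, a gluing translation would be plus or minus the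
displacement of `rho`, whose real part is 1/2. Only the pairs `B n` with `n` even come near to this.
-/
lemma shift_re_im (e : Edge) : e.shift.re ≠ 1 / 2 ∧ (e.shift.re = -1 / 2 → 0 < e.shift.im) := by
  rcases e with _ | n | n | n | n
  · norm_num [Edge.shift_unlabeled]
  · by_cases hn : Even n
    · norm_num [Edge.shift_A_even hn]
    · norm_num [Edge.shift_A_odd hn]
  · have := dyad_le_one n
    by_cases hn : Even n
    · norm_num [Edge.shift_B_even hn]
      linarith
    · norm_num [Edge.shift_B_odd hn]
  all_goals
    have := dyad_pos n
    have := dyad_le_one n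
    simp only [Edge.shift_C', Edge.shift_C'']
    exact ⟨fun h => by linarith, fun h => by linarith⟩

lemma rho_ne (x : XInf) : rho x ≠ x := by
  have key : ∀ z ∈ polygon, z.im ≤ 1 / 2 → z.re ≤ 1 / 2 → rho (pr z) ≠ pr z := by
    intro z hz h h' heq
    obtain ⟨h1, h2⟩ := rho_lower hz h h'
    rcases pr_eq_pr h1 hz (h2.symm.trans heq) with h3 | ⟨e, h3, h4⟩ | ⟨e, h3, h4⟩
    · have := congrArg Complex.re h3
      simp at this
    · rw [add_assoc, left_eq_add] at h4
      have hr := congrArg Complex.re h4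
      have hi := congrArg Complex.im h4
      simp only [Complex.add_re, Complex.add_im, Complex.zero_re, Complex.zero_im] at hr hi
      -- Here the gluing translation has imaginary part `2 * z.im - 1`, which is nonpositive in the
      -- lower rectangle.
      have := (shift_re_im e).2 (by linarith)
      rcases polygon_bounds hz with h | h <;> linarith
    · have := congrArg Complex.re (add_left_cancel h4)
      exact (shift_re_im e).1 this.symm
  intro heq
  obtain ⟨z, hz, rfl⟩ := exists_pr x
  rcases polygon_bounds hz with h | h
  · exact key z hz h.2.2.2 h.2.1 heq
  · obtain ⟨h1, h2⟩ := rho_upper hz h.2.2.1 h.1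
    -- A fixed point coincides with its image, and the image is represented in the lower rectangle.
    rw [← heq] at heq
    refine key _ h1 (by simp; linarith) (by simp; linarith) ?_
    rw [← h2]
    exact heq

lemma rho_hasDer : omega.HasDer rho Complex.conjCLE := by
  refine rhoPieces.hasDer (fun _ => rfl) fun i => ?_
  match i with
  | 0 => exact ⟨_, fun _ => rfl⟩
  | 1 => exact ⟨_, fun _ => rfl⟩

/-! ### The pseudo-Anosov map and its inverse -/

lemma dyad_le_half_of_lt {n : ℕ} (h : dyad n < 1) : dyad n ≤ 1 / 2 := by
  rcases n with _ | n
  · rw [dyad_zero] at h; linarith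
  · exact dyad_le_half (by omega)

lemma dyad_le_quarter_of_even {n : ℕ} (hn : Even n) (h : dyad n < 1) : dyad n ≤ 1 / 4 := by
  rcases Nat.eq_zero_or_pos n with rfl | h0
  · rw [dyad_zero] at h; linarith
  · have := dyad_succ_succ_le h0 (iff_of_true Even.zero hn)
    rwa [dyad_zero] at this

/-- The linear map that shrinks the horizontal direction and stretches the vertical one. -/
def stretch : ℂ ≃L[ℝ] ℂ :=
  LinearEquiv.toContinuousLinearEquiv
    { toFun := fun z => ⟨z.re / 2, 2 * z.im⟩
      invFun := fun z => ⟨2 * z.re, z.im / 2⟩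
      map_add' := fun z w => by
        apply Complex.ext
        · exact add_div _ _ _
        · exact mul_add _ _ _
      map_smul' := fun c z => by
        apply Complex.ext <;> simp
        · ring
        · ring
      left_inv := fun z => by (apply Complex.ext <;> simp); ring
      right_inv := fun z => by (apply Complex.ext <;> simp); ring }

@[simp] lemma stretch_re (z : ℂ) : (stretch z).re = z.re / 2 := rfl
@[simp] lemma stretch_im (z : ℂ) : (stretch z).im = 2 * z.im := rfl
@[simp] lemma stretch_symm_re (z : ℂ) : (stretch.symm z).re = 2 * z.re := rfl
@[simp] lemma stretch_symm_im (z : ℂ) : (stretch.symm z).im = z.im / 2 := rfl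

lemma det_stretch : LinearMap.det (stretch : ℂ →ₗ[ℝ] ℂ) = 1 := by
  rw [← LinearMap.det_toMatrix Complex.basisOneI, Matrix.det_fin_two]
  simp [LinearMap.toMatrix_apply]

/-- The ends of this cut of the upper rectangle are vertices: `1 + 3i/4` separates `A 0` from `A 1`,
and `3i/4` is an endpoint of the partner of `B 0`. The next two lemmas treat the cuts used by the
inverse map. -/
lemma re_bounds_of_im {z : ℂ} (h : z ∈ polygon) (h1 : z.im = 3 / 4) : 0 < z.re ∧ z.re < 1 := by
  rcases mem_polygon.1 h with h | ⟨e, h | h⟩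
  · rcases mem_polygonInterior.1 h with h | h | h <;> constructor <;> linarith
  · rcases Edge.side_cases h with ⟨rfl, h⟩ | ⟨n, rfl, h⟩ | ⟨n, rfl, h⟩ | ⟨n, rfl, h⟩ | ⟨n, rfl, h⟩
    · exfalso; linarith
    · have := dyad_le_half_of_lt (n := n) (by linarith)
      exfalso; linarith
    all_goals exfalso; linarith
  · rcases Edge.side'_cases h with ⟨rfl, h⟩ | ⟨n, rfl, hn, h⟩ | ⟨n, rfl, hn, h⟩ | ⟨n, rfl, hn, h⟩ |
      ⟨n, rfl, hn, h⟩ | ⟨n, rfl, h⟩ | ⟨n, rfl, h⟩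
    · exfalso; linarith
    · exfalso; linarith
    · exfalso; linarith
    · have := dyad_le_quarter_of_even (n := n) hn (by linarith)
      exfalso; linarith
    all_goals exfalso; linarith

lemma im_bounds_of_re_zero {z : ℂ} (h : z ∈ polygon) (h1 : z.re = 0) (h2 : z.im ≤ 1 / 2) :
    0 < z.im ∧ z.im < 1 / 2 := by
  rcases mem_polygon.1 h with h | ⟨e, h | h⟩
  · rcases mem_polygonInterior.1 h with h | h | h <;> constructor <;> linarith
  · rcases Edge.side_bounds h with h | h | h | h <;> constructor <;> linarith
  · rcases Edge.side'_cases h with ⟨rfl, h⟩ | ⟨n, rfl, hn, h⟩ | ⟨n, rfl, hn, h⟩ | ⟨n, rfl, hn, h⟩ |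
      ⟨n, rfl, hn, h⟩ | ⟨n, rfl, h⟩ | ⟨n, rfl, h⟩
    iterate 5 constructor <;> linarith
    all_goals
      have := dyad_le_half_of_lt (n := n) (by linarith)
      exfalso; linarith

lemma im_bounds_of_re_half {z : ℂ} (h : z ∈ polygon) (h1 : z.re = 1 / 2) (h2 : 1 / 2 ≤ z.im) :
    1 / 2 < z.im ∧ z.im < 1 := by
  rcases mem_polygon.1 h with h | ⟨e, h | h⟩
  · rcases mem_polygonInterior.1 h with h | h | h <;> constructor <;> linarith
  · rcases Edge.side_cases h with ⟨rfl, h⟩ | ⟨n, rfl, h⟩ | ⟨n, rfl, h⟩ | ⟨n, rfl, h⟩ | ⟨n, rfl, h⟩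
    iterate 3 exfalso; linarith
    all_goals
      have := dyad_le_half_of_lt (n := n) (by linarith)
      exfalso; linarith
  · rcases Edge.side'_bounds h with h | h | h | h <;> constructor <;> linarith

/-- The pieces of the pseudo-Anosov map. -/
def psiPieces : Pieces 3 where
  dom i := match i with
    | 0 => {z | z.im ≤ 1 / 2} ∩ {z | z.re ≤ 1 / 2}
    | 1 => {z | 1 / 2 ≤ z.im} ∩ {z | z.im ≤ 3 / 4} ∩ {z | 0 ≤ z.re}
    | 2 => {z | 3 / 4 ≤ z.im}
  toFun i z := match i with
    | 0 => stretch z + ⟨1 / 4, 0⟩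
    | 1 => stretch z + ⟨-1 / 2, -1⟩
    | 2 => stretch z + ⟨1 / 2, -1⟩
  isClosed i := match i with
    | 0 => (isClosed_le (by fun_prop) (by fun_prop)).inter (isClosed_le (by fun_prop) (by fun_prop))
    | 1 => ((isClosed_le (by fun_prop) (by fun_prop)).inter
        (isClosed_le (by fun_prop) (by fun_prop))).inter (isClosed_le (by fun_prop) (by fun_prop))
    | 2 => isClosed_le (by fun_prop) (by fun_prop)
  continuous i := match i with
    | 0 => by fun_prop
    | 1 => by fun_prop
    | 2 => by fun_prop
  cover z hz := by
    rcases polygon_re_im_cases hz with h | h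
    · exact ⟨0, h⟩
    · rcases le_total z.im (3 / 4) with h1 | h1
      · exact ⟨1, ⟨h.1, h1⟩, h.2⟩
      · exact ⟨2, h1⟩
  interior i z hz hi hne := by
    refine polygonInterior_subset (mem_polygonInterior.2 ?_)
    replace hz := mem_polygonInterior.1 hz
    match i with
    | 0 =>
      have h1 := hne 1 (by decide)
      simp only [mem_inter_iff, mem_ofPred_eq] at hi h1
      simp only [Complex.add_re, Complex.add_im, stretch_re, stretch_im]
      have h2 : z.im < 1 / 2 := by
        by_contra h
        push Not at h
        exact h1 ⟨⟨h, by linarith⟩, by rcases hz with hz | hz | hz <;> linarith⟩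
      rcases hz with hz | hz | hz
      · exact .inr <| .inl ⟨by linarith, by linarith, by linarith, by linarith⟩
      · exact .inr <| .inl ⟨by linarith, by linarith, by linarith, by linarith⟩
      · linarith
    | 1 =>
      have h1 := hne 0 (by decide)
      have h2 := hne 2 (by decide)
      simp only [mem_inter_iff, mem_ofPred_eq, not_le] at hi h1 h2
      simp only [Complex.add_re, Complex.add_im, stretch_re, stretch_im]
      have h3 : 1 / 2 < z.im := by
        rcases hi.1.1.lt_or_eq with h | h
        · exact h
        · exact (h1 ⟨h.ge, by rcases hz with hz | hz | hz <;> linarith⟩).elim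
      rcases hz with hz | hz | hz
      · linarith
      · exact .inl ⟨by linarith, by linarith, by linarith, by linarith⟩
      · exact .inl ⟨by linarith, by linarith, by linarith, by linarith⟩
    | 2 =>
      have h1 := hne 1 (by decide)
      simp only [mem_inter_iff, mem_ofPred_eq] at hi h1
      simp only [Complex.add_re, Complex.add_im, stretch_re, stretch_im]
      have h2 : 3 / 4 < z.im := by
        by_contra h
        push Not at h
        exact h1 ⟨⟨by linarith, h⟩, by rcases hz with hz | hz | hz <;> linarith⟩
      rcases hz with hz | hz | hz
      · linarith
      · exact .inr <| .inr ⟨by linarith, by linarith, by linarith, by linarith⟩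
      · exact .inr <| .inr ⟨by linarith, by linarith, by linarith, by linarith⟩
  overlap i j hij z hz hi hj := match i, j with
    | 0, 0 => absurd hij (by decide)
    | 1, 0 => absurd hij (by decide)
    | 1, 1 => absurd hij (by decide)
    | 2, 0 => absurd hij (by decide)
    | 2, 1 => absurd hij (by decide)
    | 2, 2 => absurd hij (by decide)
    | 0, 1 => by
      have h : z.im = 1 / 2 := le_antisymm (by exact hi.1) (by exact hj.1.1)
      have h1 := interior_of_im_eq_half hz h hj.2 hi.2
      -- The cut between the rectangles becomes the pair `C'' 0`, and the cut at height 3/4 (below)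
      -- becomes the unlabeled pair.
      refine Linked.of_side (.C'' 0) (Edge.mem_side_C''.2 ?_) ?_
      · simp [dyad_zero, h]
        exact ⟨by linarith, by linarith⟩
      · apply Complex.ext <;> simp [Edge.shift_C'', dyad_zero]
    | 0, 2 => by
      simp only [mem_inter_iff, mem_ofPred_eq] at hi hj
      linarith
    | 1, 2 => by
      have h : z.im = 3 / 4 := le_antisymm (by exact hi.1.2) (by exact hj)
      have h1 := re_bounds_of_im hz h
      refine Linked.of_side .unlabeled (Edge.mem_side_unlabeled.2 ?_) ?_
      · simp [h]
        exact ⟨by linarith, by linarith, by linarith⟩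
      · apply Complex.ext <;> simp [Edge.shift_unlabeled]
        ring
  glue e z hz := by
    rcases Edge.side_cases hz with
      ⟨rfl, h⟩ | ⟨n, rfl, h⟩ | ⟨n, rfl, h⟩ | ⟨n, rfl, h⟩ | ⟨n, rfl, h⟩
    · refine ⟨0, 1, ?_, ?_, Linked.of_side (.C' 0) (Edge.mem_side_C'.2 ?_) ?_⟩
      · exact ⟨by simp only [mem_ofPred_eq]; linarith, by simp only [mem_ofPred_eq]; linarith⟩
      · refine ⟨⟨?_, ?_⟩, ?_⟩ <;> simp [Edge.shift_unlabeled, h.1]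
        · norm_num
        · linarith
      · simp [dyad_zero, h.1]
        exact ⟨by linarith, by linarith⟩
      · apply Complex.ext <;> simp [Edge.shift_unlabeled, Edge.shift_C', dyad_zero]
        ring
    · rcases n with _ | n
      · rw [dyad_zero] at h
        -- The pair `A 0` has no predecessor to go to: its image is the interior segment where the
        -- left square meets the central rectangle.
        refine ⟨1, 0, ⟨⟨?_, ?_⟩, ?_⟩, ⟨?_, ?_⟩,
          Linked.of_interior (mem_polygonInterior.2 (.inl ?_)) ?_⟩
        · simp only [mem_ofPred_eq]; linarith
        · simp only [mem_ofPred_eq]; linarith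
        · simp only [mem_ofPred_eq]; linarith
        · simp [Edge.shift_A_even, dyad_zero]; linarith
        · simp [Edge.shift_A_even, dyad_zero]; linarith
        · simp
          exact ⟨by linarith, by linarith, by linarith, by linarith⟩
        · apply Complex.ext <;> simp [Edge.shift_A_even, dyad_zero] <;> ring
      · rw [dyad_succ] at h
        have hd := dyad_le_one n
        have h1 : (3 : ℝ) / 4 ≤ z.im := by linarith
        have h2 : stretch z + ⟨1 / 2, -1⟩ ∈ (Edge.A n).side := by
          rw [Edge.mem_side_A]
          simp
          exact ⟨by linarith, by linarith, by linarith⟩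
        by_cases hn : Even n
        · have hn' : ¬ Even (n + 1) := by rwa [Nat.even_add_one, not_not]
          refine ⟨2, 1, h1, ⟨⟨?_, ?_⟩, ?_⟩, Linked.of_side (.A n) h2 ?_⟩
          · simp [Edge.shift_A_odd hn', dyad_succ]; linarith
          · simp [Edge.shift_A_odd hn', dyad_succ]; linarith
          · simp [Edge.shift_A_odd hn', dyad_succ]; linarith
          · apply Complex.ext <;>
              simp [Edge.shift_A_odd hn', Edge.shift_A_even hn, dyad_succ] <;> ring
        · have hn' : Even (n + 1) := by rwa [Nat.even_add_one]
          refine ⟨2, 0, h1, ⟨?_, ?_⟩, Linked.of_side (.A n) h2 ?_⟩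
          · simp [Edge.shift_A_even hn', dyad_succ]; linarith
          · simp [Edge.shift_A_even hn', dyad_succ]; linarith
          · apply Complex.ext <;>
              simp [Edge.shift_A_even hn', Edge.shift_A_odd hn, dyad_succ] <;> ring
    · have h0 : z ∈ {z : ℂ | z.im ≤ 1 / 2} ∩ {z | z.re ≤ 1 / 2} := by
        constructor <;> simp only [mem_ofPred_eq] <;> linarith
      rcases n with _ | n
      · rw [dyad_zero] at h
        -- Similarly `B 0` becomes the interior segment where the central rectangle meets the right
        -- square.
        refine ⟨0, 2, h0, ?_, Linked.of_interior (mem_polygonInterior.2 (.inr (.inr ?_))) ?_⟩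
        · simp [Edge.shift_B_even, dyad_zero]; linarith
        · simp
          exact ⟨by linarith, by linarith, by linarith, by linarith⟩
        · apply Complex.ext <;> simp [Edge.shift_B_even, dyad_zero] <;> linarith
      · rw [dyad_succ] at h
        have hd := dyad_le_one n
        have h2 : stretch z + ⟨1 / 4, 0⟩ ∈ (Edge.B n).side := by
          rw [Edge.mem_side_B]
          simp
          exact ⟨by linarith, by linarith, by linarith⟩
        by_cases hn : Even n
        · have hn' : ¬ Even (n + 1) := by rwa [Nat.even_add_one, not_not]
          refine ⟨0, 0, h0, ⟨?_, ?_⟩, Linked.of_side (.B n) h2 ?_⟩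
          · simp [Edge.shift_B_odd hn', dyad_succ]; linarith
          · simp [Edge.shift_B_odd hn', dyad_succ]; linarith
          · apply Complex.ext <;>
              simp [Edge.shift_B_odd hn', Edge.shift_B_even hn, dyad_succ] <;> ring
        · have hn' : Even (n + 1) := by rwa [Nat.even_add_one]
          have hd' := dyad_odd_le hn
          refine ⟨0, 1, h0, ⟨⟨?_, ?_⟩, ?_⟩, Linked.of_side (.B n) h2 ?_⟩
          · simp [Edge.shift_B_even hn', dyad_succ]; linarith
          · simp [Edge.shift_B_even hn', dyad_succ]; linarith
          · simp [Edge.shift_B_even hn', dyad_succ]; linarith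
          · apply Complex.ext <;>
              simp [Edge.shift_B_even hn', Edge.shift_B_odd hn, dyad_succ] <;> ring
    · refine ⟨2, 0, ?_, ⟨?_, ?_⟩, Linked.of_side (.C' (n + 1)) (Edge.mem_side_C'.2 ?_) ?_⟩
      · simp only [mem_ofPred_eq]; linarith
      · simp [Edge.shift_C']; linarith
      · simp [Edge.shift_C']; linarith
      · simp [dyad_succ]
        exact ⟨by linarith, by linarith, by linarith⟩
      · apply Complex.ext <;> simp [Edge.shift_C', dyad_succ] <;> ring
    · refine ⟨2, 0, ?_, ⟨?_, ?_⟩, Linked.of_side (.C'' (n + 1)) (Edge.mem_side_C''.2 ?_) ?_⟩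
      · simp only [mem_ofPred_eq]; linarith
      · simp [Edge.shift_C'']; linarith
      · simp [Edge.shift_C'']; linarith
      · simp [dyad_succ]
        exact ⟨by linarith, by linarith, by linarith⟩
      · apply Complex.ext <;> simp [Edge.shift_C'', dyad_succ] <;> ring

/-- The pieces of the inverse of the pseudo-Anosov map. -/
def psiInvPieces : Pieces 3 where
  dom i := match i with
    | 0 => {z | 0 ≤ z.re} ∩ {z | z.re ≤ 1 / 2}
    | 1 => {z | z.re ≤ 0} ∩ {z | z.im ≤ 1 / 2}
    | 2 => {z | 1 / 2 ≤ z.re} ∩ {z | 1 / 2 ≤ z.im}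
  toFun i z := match i with
    | 0 => stretch.symm z + ⟨-1 / 2, 0⟩
    | 1 => stretch.symm z + ⟨1, 1 / 2⟩
    | 2 => stretch.symm z + ⟨-1, 1 / 2⟩
  isClosed i := match i with
    | 0 => (isClosed_le (by fun_prop) (by fun_prop)).inter (isClosed_le (by fun_prop) (by fun_prop))
    | 1 => (isClosed_le (by fun_prop) (by fun_prop)).inter (isClosed_le (by fun_prop) (by fun_prop))
    | 2 => (isClosed_le (by fun_prop) (by fun_prop)).inter (isClosed_le (by fun_prop) (by fun_prop))
  continuous i := match i with
    | 0 => by fun_prop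
    | 1 => by fun_prop
    | 2 => by fun_prop
  cover z hz := by
    rcases le_total z.re 0 with h0 | h0
    · rcases polygon_re_im_cases hz with h | h
      · exact ⟨1, h0, h.1⟩
      · exact ⟨0, h.2, by simp only [mem_ofPred_eq]; linarith⟩
    · rcases le_total z.re (1 / 2) with h1 | h1
      · exact ⟨0, h0, h1⟩
      · rcases polygon_re_im_cases hz with h | h
        · exact ⟨0, h0, h.2⟩
        · exact ⟨2, h1, h.1⟩
  interior i z hz hi hne := by
    refine polygonInterior_subset (mem_polygonInterior.2 ?_)
    replace hz := mem_polygonInterior.1 hz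
    match i with
    | 0 =>
      have h1 := hne 1 (by decide)
      have h2 := hne 2 (by decide)
      simp only [mem_inter_iff, mem_ofPred_eq] at hi h1 h2
      simp only [Complex.add_re, Complex.add_im, stretch_symm_re, stretch_symm_im]
      have h3 : 0 < z.re := by
        by_contra h
        push Not at h
        exact h1 ⟨h, by rcases hz with hz | hz | hz <;> linarith⟩
      have h4 : z.re < 1 / 2 := by
        by_contra h
        push Not at h
        exact h2 ⟨h, by rcases hz with hz | hz | hz <;> linarith⟩
      refine .inl ⟨by linarith, by linarith, ?_, ?_⟩ <;> rcases hz with hz | hz | hz <;> linarith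
    | 1 =>
      have h1 := hne 0 (by decide)
      simp only [mem_inter_iff, mem_ofPred_eq] at hi h1
      simp only [Complex.add_re, Complex.add_im, stretch_symm_re, stretch_symm_im]
      have h2 : z.re < 0 := by
        by_contra h
        push Not at h
        exact h1 ⟨h, by linarith⟩
      rcases hz with hz | hz | hz
      · exact .inr <| .inr ⟨by linarith, by linarith, by linarith, by linarith⟩
      · linarith
      · linarith
    | 2 =>
      have h1 := hne 0 (by decide)
      simp only [mem_inter_iff, mem_ofPred_eq] at hi h1
      simp only [Complex.add_re, Complex.add_im, stretch_symm_re, stretch_symm_im]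
      have h2 : 1 / 2 < z.re := by
        by_contra h
        push Not at h
        exact h1 ⟨by linarith, h⟩
      rcases hz with hz | hz | hz
      · linarith
      · linarith
      · exact .inr <| .inr ⟨by linarith, by linarith, by linarith, by linarith⟩
  overlap i j hij z hz hi hj := match i, j with
    | 0, 0 => absurd hij (by decide)
    | 1, 0 => absurd hij (by decide)
    | 1, 1 => absurd hij (by decide)
    | 2, 0 => absurd hij (by decide)
    | 2, 1 => absurd hij (by decide)
    | 2, 2 => absurd hij (by decide)
    | 0, 1 => by
      have h : z.re = 0 := le_antisymm (by exact hj.1) (by exact hi.1)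
      have h1 := im_bounds_of_re_zero hz h hj.2
      refine (Linked.of_side (.A 0) (Edge.mem_side_A.2 ?_) ?_).symm
      · simp [dyad_zero, h]
        exact ⟨by linarith, by linarith⟩
      · apply Complex.ext <;> simp [Edge.shift_A_even, dyad_zero] <;> ring
    | 0, 2 => by
      have h : z.re = 1 / 2 := le_antisymm (by exact hi.2) (by exact hj.1)
      have h1 := im_bounds_of_re_half hz h hj.2
      refine Linked.of_side (.B 0) (Edge.mem_side_B.2 ?_) ?_
      · simp [dyad_zero, h]
        norm_num
        exact ⟨by linarith, by linarith⟩
      · apply Complex.ext <;> simp [Edge.shift_B_even, dyad_zero] <;> ring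
    | 1, 2 => by
      simp only [mem_inter_iff, mem_ofPred_eq] at hi hj
      linarith
  glue e z hz := by
    rcases Edge.side_cases hz with
      ⟨rfl, h⟩ | ⟨n, rfl, h⟩ | ⟨n, rfl, h⟩ | ⟨n, rfl, h⟩ | ⟨n, rfl, h⟩
    · refine ⟨1, 2, ⟨?_, ?_⟩, ⟨?_, ?_⟩, Linked.of_interior (mem_polygonInterior.2 (.inr (.inr ?_))) ?_⟩
      · simp only [mem_ofPred_eq]; linarith
      · simp only [mem_ofPred_eq]; linarith
      · simp [Edge.shift_unlabeled]; linarith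
      · simp [Edge.shift_unlabeled]; linarith
      · simp
        exact ⟨by linarith, by linarith, by linarith, by linarith⟩
      · (apply Complex.ext <;> simp [Edge.shift_unlabeled]); ring
    · have h1 : z ∈ {z : ℂ | 1 / 2 ≤ z.re} ∩ {z | 1 / 2 ≤ z.im} := by
        constructor <;> simp only [mem_ofPred_eq] <;> linarith
      have h2 : stretch.symm z + ⟨-1, 1 / 2⟩ ∈ (Edge.A (n + 1)).side := by
        rw [Edge.mem_side_A]
        simp [dyad_succ]
        exact ⟨by linarith, by linarith, by linarith⟩
      by_cases hn : Even n
      · have hn' : ¬ Even (n + 1) := by rwa [Nat.even_add_one, not_not]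
        refine ⟨2, 1, h1, ⟨?_, ?_⟩, Linked.of_side (.A (n + 1)) h2 ?_⟩
        · simp [Edge.shift_A_even hn]; linarith
        · simp [Edge.shift_A_even hn]; linarith
        · apply Complex.ext <;>
            simp [Edge.shift_A_odd hn', Edge.shift_A_even hn, dyad_succ] <;> ring
      · have hn' : Even (n + 1) := by rwa [Nat.even_add_one]
        refine ⟨2, 0, h1, ⟨?_, ?_⟩, Linked.of_side (.A (n + 1)) h2 ?_⟩
        · simp [Edge.shift_A_odd hn]; linarith
        · simp [Edge.shift_A_odd hn]; linarith
        · apply Complex.ext <;>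
            simp [Edge.shift_A_even hn', Edge.shift_A_odd hn, dyad_succ] <;> ring
    · have h1 : z ∈ {z : ℂ | 0 ≤ z.re} ∩ {z | z.re ≤ 1 / 2} := by
        constructor <;> simp only [mem_ofPred_eq] <;> linarith
      have h2 : stretch.symm z + ⟨-1 / 2, 0⟩ ∈ (Edge.B (n + 1)).side := by
        rw [Edge.mem_side_B]
        simp [dyad_succ]
        exact ⟨by linarith, by linarith, by linarith⟩
      by_cases hn : Even n
      · have hn' : ¬ Even (n + 1) := by rwa [Nat.even_add_one, not_not]
        refine ⟨0, 0, h1, ⟨?_, ?_⟩, Linked.of_side (.B (n + 1)) h2 ?_⟩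
        · simp [Edge.shift_B_even hn]; linarith
        · simp [Edge.shift_B_even hn]; linarith
        · apply Complex.ext <;>
            simp [Edge.shift_B_odd hn', Edge.shift_B_even hn, dyad_succ] <;> ring
      · have hn' : Even (n + 1) := by rwa [Nat.even_add_one]
        have hd := dyad_odd_le hn
        refine ⟨0, 1, h1, ⟨?_, ?_⟩, Linked.of_side (.B (n + 1)) h2 ?_⟩
        · simp [Edge.shift_B_odd hn]; linarith
        · simp [Edge.shift_B_odd hn]; linarith
        · apply Complex.ext <;>
            simp [Edge.shift_B_even hn', Edge.shift_B_odd hn, dyad_succ] <;> ring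
    · rcases n with _ | n
      · rw [dyad_zero] at h
        refine ⟨0, 1, ⟨?_, ?_⟩, ⟨?_, ?_⟩,
          Linked.of_side .unlabeled (Edge.mem_side_unlabeled.2 ?_) ?_⟩
        · simp only [mem_ofPred_eq]; linarith
        · simp only [mem_ofPred_eq]; linarith
        · simp [Edge.shift_C', dyad_zero]; linarith
        · simp [Edge.shift_C']; linarith
        · simp
          exact ⟨by linarith, by linarith, by linarith⟩
        · apply Complex.ext <;> simp [Edge.shift_C', Edge.shift_unlabeled, dyad_zero] <;> ring
      · rw [dyad_succ] at h
        have hd := dyad_le_one n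
        refine ⟨2, 0, ⟨?_, ?_⟩, ⟨?_, ?_⟩, Linked.of_side (.C' n) (Edge.mem_side_C'.2 ?_) ?_⟩
        · simp only [mem_ofPred_eq]; linarith
        · simp only [mem_ofPred_eq]; linarith
        · simp [Edge.shift_C', dyad_succ]; linarith
        · simp [Edge.shift_C', dyad_succ]; linarith
        · simp
          exact ⟨by linarith, by linarith, by linarith⟩
        · apply Complex.ext <;> simp [Edge.shift_C', dyad_succ] <;> ring
    · rcases n with _ | n
      · rw [dyad_zero] at h
        refine ⟨0, 1, ⟨?_, ?_⟩, ⟨?_, ?_⟩,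
          Linked.of_interior (mem_polygonInterior.2 (.inr (.inl ?_))) ?_⟩
        · simp only [mem_ofPred_eq]; linarith
        · simp only [mem_ofPred_eq]; linarith
        · simp [Edge.shift_C'', dyad_zero]; linarith
        · simp [Edge.shift_C'']; linarith
        · simp
          exact ⟨by linarith, by linarith, by linarith, by linarith⟩
        · apply Complex.ext <;> simp [Edge.shift_C'', dyad_zero] <;> ring
      · rw [dyad_succ] at h
        have hd := dyad_le_one n
        refine ⟨2, 0, ⟨?_, ?_⟩, ⟨?_, ?_⟩, Linked.of_side (.C'' n) (Edge.mem_side_C''.2 ?_) ?_⟩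
        · simp only [mem_ofPred_eq]; linarith
        · simp only [mem_ofPred_eq]; linarith
        · simp [Edge.shift_C'', dyad_succ]; linarith
        · simp [Edge.shift_C'', dyad_succ]; linarith
        · simp
          exact ⟨by linarith, by linarith, by linarith⟩
        · apply Complex.ext <;> simp [Edge.shift_C'', dyad_succ] <;> ring

lemma psi_lower {z : ℂ} (hz : z ∈ polygon) (h : z.im ≤ 1 / 2) (h' : z.re ≤ 1 / 2) :
    stretch z + ⟨1 / 4, 0⟩ ∈ polygon ∧ psiPieces.map (pr z) = pr (stretch z + ⟨1 / 4, 0⟩) :=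
  ⟨psiPieces.maps (i := 0) hz ⟨h, h'⟩, psiPieces.map_pr (i := 0) hz ⟨h, h'⟩⟩

lemma psi_middle {z : ℂ} (hz : z ∈ polygon) (h : 1 / 2 ≤ z.im) (h' : z.im ≤ 3 / 4)
    (h'' : 0 ≤ z.re) :
    stretch z + ⟨-1 / 2, -1⟩ ∈ polygon ∧ psiPieces.map (pr z) = pr (stretch z + ⟨-1 / 2, -1⟩) :=
  ⟨psiPieces.maps (i := 1) hz ⟨⟨h, h'⟩, h''⟩, psiPieces.map_pr (i := 1) hz ⟨⟨h, h'⟩, h''⟩⟩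

lemma psi_upper {z : ℂ} (hz : z ∈ polygon) (h : 3 / 4 ≤ z.im) :
    stretch z + ⟨1 / 2, -1⟩ ∈ polygon ∧ psiPieces.map (pr z) = pr (stretch z + ⟨1 / 2, -1⟩) :=
  ⟨psiPieces.maps (i := 2) hz h, psiPieces.map_pr (i := 2) hz h⟩

lemma psiInv_center {z : ℂ} (hz : z ∈ polygon) (h : 0 ≤ z.re) (h' : z.re ≤ 1 / 2) :
    stretch.symm z + ⟨-1 / 2, 0⟩ ∈ polygon ∧
      psiInvPieces.map (pr z) = pr (stretch.symm z + ⟨-1 / 2, 0⟩) :=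
  ⟨psiInvPieces.maps (i := 0) hz ⟨h, h'⟩, psiInvPieces.map_pr (i := 0) hz ⟨h, h'⟩⟩

lemma psiInv_left {z : ℂ} (hz : z ∈ polygon) (h : z.re ≤ 0) (h' : z.im ≤ 1 / 2) :
    stretch.symm z + ⟨1, 1 / 2⟩ ∈ polygon ∧
      psiInvPieces.map (pr z) = pr (stretch.symm z + ⟨1, 1 / 2⟩) :=
  ⟨psiInvPieces.maps (i := 1) hz ⟨h, h'⟩, psiInvPieces.map_pr (i := 1) hz ⟨h, h'⟩⟩

lemma psiInv_right {z : ℂ} (hz : z ∈ polygon) (h : 1 / 2 ≤ z.re) (h' : 1 / 2 ≤ z.im) :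
    stretch.symm z + ⟨-1, 1 / 2⟩ ∈ polygon ∧
      psiInvPieces.map (pr z) = pr (stretch.symm z + ⟨-1, 1 / 2⟩) :=
  ⟨psiInvPieces.maps (i := 2) hz ⟨h, h'⟩, psiInvPieces.map_pr (i := 2) hz ⟨h, h'⟩⟩

lemma psiInv_psi (x : XInf) : psiInvPieces.map (psiPieces.map x) = x := by
  obtain ⟨z, hz, rfl⟩ := exists_pr x
  rcases polygon_bounds hz with h | h
  · obtain ⟨h1, h2⟩ := psi_lower hz h.2.2.2 h.2.1
    rw [h2, (psiInv_center h1 (by simp; linarith) (by simp; linarith)).2]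
    congr 1
    apply Complex.ext <;> simp
    ring
  · rcases le_total z.im (3 / 4) with h' | h'
    · obtain ⟨h1, h2⟩ := psi_middle hz h.2.2.1 h' h.1
      rw [h2, (psiInv_left h1 (by simp; linarith) (by simp; linarith)).2]
      congr 1
      apply Complex.ext <;> (simp; ring)
    · obtain ⟨h1, h2⟩ := psi_upper hz h'
      rw [h2, (psiInv_right h1 (by simp; linarith) (by simp; linarith)).2]
      congr 1
      (apply Complex.ext <;> simp); ring

lemma psi_psiInv (x : XInf) : psiPieces.map (psiInvPieces.map x) = x := by
  obtain ⟨z, hz, rfl⟩ := exists_pr x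
  obtain ⟨i, hi⟩ := psiInvPieces.cover z hz
  have hb : 0 ≤ z.im ∧ z.im ≤ 1 ∧ -1 / 2 ≤ z.re := by
    rcases polygon_bounds hz with h | h <;> exact ⟨by linarith, by linarith, by linarith⟩
  match i with
  | 0 =>
    have h : 0 ≤ z.re := hi.1
    have h' : z.re ≤ 1 / 2 := hi.2
    obtain ⟨h1, h2⟩ := psiInv_center hz h h'
    rw [h2, (psi_lower h1 (by simp; linarith) (by simp; linarith)).2]
    congr 1
    (apply Complex.ext <;> simp); ring
  | 1 =>
    have h : z.re ≤ 0 := hi.1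
    have h' : z.im ≤ 1 / 2 := hi.2
    obtain ⟨h1, h2⟩ := psiInv_left hz h h'
    rw [h2, (psi_middle h1 (by simp; linarith) (by simp; linarith) (by simp; linarith)).2]
    congr 1
    (apply Complex.ext <;> simp); ring
  | 2 =>
    have h : 1 / 2 ≤ z.re := hi.1
    have h' : 1 / 2 ≤ z.im := hi.2
    obtain ⟨h1, h2⟩ := psiInv_right hz h h'
    rw [h2, (psi_upper h1 (by simp; linarith)).2]
    congr 1
    (apply Complex.ext <;> simp); ring

/-- The pseudo-Anosov homeomorphism `ψ_∞`. -/
def psi : XInf ≃ₜ XInf where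
  toFun := psiPieces.map
  invFun := psiInvPieces.map
  left_inv := psiInv_psi
  right_inv := psi_psiInv
  continuous_toFun := psiPieces.continuous_map
  continuous_invFun := psiInvPieces.continuous_map

lemma psi_hasDer : omega.HasDer psi stretch := by
  refine psiPieces.hasDer (fun _ => rfl) fun i => ?_
  match i with
  | 0 => exact ⟨_, fun _ => rfl⟩
  | 1 => exact ⟨_, fun _ => rfl⟩
  | 2 => exact ⟨_, fun _ => rfl⟩

/-- The linear parts commute, being diagonal. The translation parts are compared on the four
horizontal strips of height 1/4, on each of which both composites are affine. -/
lemma rho_psi (x : XInf) : rho (psi x) = psi (rho x) := by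
  change rhoPieces.map (psiPieces.map x) = psiPieces.map (rhoPieces.map x)
  obtain ⟨z, hz, rfl⟩ := exists_pr x
  rcases polygon_bounds hz with h | h
  · obtain ⟨h1, h2⟩ := psi_lower hz h.2.2.2 h.2.1
    obtain ⟨h3, h4⟩ := rho_lower hz h.2.2.2 h.2.1
    rw [h2, h4]
    rcases le_total z.im (1 / 4) with h' | h'
    · rw [(rho_lower h1 (by simp; linarith) (by simp; linarith)).2,
        (psi_upper h3 (by simp; linarith)).2]
      congr 1
      apply Complex.ext <;> (simp; ring)
    · rw [(rho_upper h1 (by simp; linarith) (by simp; linarith)).2,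
        (psi_middle h3 (by simp; linarith) (by simp; linarith) (by simp; linarith)).2]
      congr 1
      apply Complex.ext <;> (simp; ring)
  · obtain ⟨h3, h4⟩ := rho_upper hz h.2.2.1 h.1
    rw [h4, (psi_lower h3 (by simp; linarith) (by simp; linarith)).2]
    rcases le_total z.im (3 / 4) with h' | h'
    · obtain ⟨h1, h2⟩ := psi_middle hz h.2.2.1 h' h.1
      rw [h2, (rho_lower h1 (by simp; linarith) (by simp; linarith)).2]
      congr 1
      apply Complex.ext <;> (simp; ring)
    · obtain ⟨h1, h2⟩ := psi_upper hz h'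
      rw [h2, (rho_upper h1 (by simp; linarith) (by simp; linarith)).2]
      congr 1
      apply Complex.ext <;> (simp; ring)

lemma rho_psi_spec :
    ∃ ρ ∈ omega.Aff, ∃ ψ ∈ omega.Aff,
      (omega.ReversesOrientation ρ ∧ omega.IsIsometric ρ ∧ (∀ x, ρ (ρ x) = x) ∧ (∀ x, ρ x ≠ x)) ∧
      (omega.PreservesOrientation ψ ∧ omega.IsPseudoAnosov ψ 2) ∧ (∀ x, ρ (ψ x) = ψ (ρ x)) := by
  refine ⟨rho, ⟨_, rho_hasDer⟩, psi, ⟨_, psi_hasDer⟩,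
    ⟨⟨_, rho_hasDer, ?_⟩, ⟨_, rho_hasDer, fun v => by simp⟩, rho_rho, rho_ne⟩,
    ⟨⟨_, psi_hasDer, det_stretch.symm ▸ one_pos⟩, by norm_num, _, psi_hasDer, Complex.I, 1,
      Complex.I_ne_zero, one_ne_zero, .inl ?_, .inl ?_⟩, rho_psi⟩
  · have := Complex.det_conjAe
    refine lt_of_eq_of_lt this (by norm_num)
  · apply Complex.ext <;> simp
  · apply Complex.ext <;> simp

/-! ## Genus -/

/-- The loop factors through the quotient of the unit interval by its endpoints, which is the
circle. -/
lemma exists_simple_closed_curve {X : Type*} [TopologicalSpace X] {f : ℝ → X}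
    (hc : ContinuousOn f (Icc 0 1)) (h : f 0 = f 1) (hi : InjOn f (Ico 0 1)) :
    ∃ γ : Circle → X, Continuous γ ∧ Function.Injective γ ∧ range γ = f '' Icc 0 1 := by
  have : Fact ((0 : ℝ) < 1) := ⟨one_pos⟩
  let φ : AddCircle (1 : ℝ) ≃ₜ Circle := AddCircle.homeomorphCircle one_ne_zero
  have hlift : ∀ x : AddCircle (1 : ℝ), ∃ t ∈ Ico (0 : ℝ) 1, (t : AddCircle (1 : ℝ)) = x := by
    intro x
    obtain ⟨t, ht, htx⟩ := (AddCircle.coe_image_Ico_eq (1 : ℝ) 0).symm ▸ mem_univ x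
    exact ⟨t, by rwa [zero_add] at ht, htx⟩
  refine ⟨AddCircle.liftIco 1 0 f ∘ φ.symm,
    (AddCircle.liftIco_zero_continuous h hc).comp φ.symm.continuous, ?_, ?_⟩
  · refine Function.Injective.comp ?_ φ.symm.injective
    intro x y hxy
    obtain ⟨s, hs, rfl⟩ := hlift x
    obtain ⟨t, ht, rfl⟩ := hlift y
    rw [AddCircle.liftIco_zero_coe_apply hs, AddCircle.liftIco_zero_coe_apply ht] at hxy
    rw [hi hs ht hxy]
  · rw [φ.symm.surjective.range_comp]
    ext x
    constructor
    · rintro ⟨y, rfl⟩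
      obtain ⟨s, hs, rfl⟩ := hlift y
      rw [AddCircle.liftIco_zero_coe_apply hs]
      exact ⟨s, ⟨hs.1, hs.2.le⟩, rfl⟩
    · rintro ⟨s, hs, rfl⟩
      rcases hs.2.lt_or_eq with h1 | rfl
      · exact ⟨s, AddCircle.liftIco_zero_coe_apply ⟨hs.1, h1⟩⟩
      · refine ⟨((0 : ℝ) : AddCircle (1 : ℝ)), ?_⟩
        rw [AddCircle.liftIco_zero_coe_apply ⟨le_rfl, one_pos⟩, h]

/-- The chord of the upper rectangle that joins the midpoints of the edges `A (2 * k + 1)`. -/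
def chord (k : ℕ) (t : ℝ) : ℂ := ⟨t, (2 + t) / 3 - dyad (2 * k + 1) * (5 + 4 * t) / 24⟩

lemma continuous_chord (k : ℕ) : Continuous (chord k) := by
  have h : chord k = fun t : ℝ => (t : ℂ) +
      (((2 + t) / 3 - dyad (2 * k + 1) * (5 + 4 * t) / 24 : ℝ) : ℂ) * Complex.I := by
    funext t
    apply Complex.ext <;> simp [chord]
  rw [h]
  fun_prop

lemma dyad_odd_bounds (k : ℕ) : 0 < dyad (2 * k + 1) ∧ dyad (2 * k + 1) ≤ 1 / 2 :=
  ⟨dyad_pos _, dyad_le_half (by omega)⟩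

lemma not_even_two_mul_add_one (k : ℕ) : ¬ Even (2 * k + 1) := by simp

/-- With `d = dyad (2 * k + 1)`, the chord ends at height `1 - 3 * d / 8` on the right and starts at
`2 / 3 - 5 * d / 24` on the left, the midpoints of the two glued edges. -/
lemma chord_one_mem (k : ℕ) : chord k 1 ∈ (Edge.A (2 * k + 1)).side := by
  have := dyad_odd_bounds k
  rw [Edge.mem_side_A]
  simp only [chord]
  exact ⟨trivial, by linarith, by linarith⟩

lemma chord_zero (k : ℕ) : chord k 0 = chord k 1 + (Edge.A (2 * k + 1)).shift := by
  rw [Edge.shift_A_odd (not_even_two_mul_add_one k)]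
  apply Complex.ext <;> simp [chord]
  ring

lemma chord_bounds (k : ℕ) {t : ℝ} (h : t ∈ Icc (0 : ℝ) 1) :
    1 / 2 < (chord k t).im ∧ (chord k t).im < 1 := by
  have h1 := dyad_odd_bounds k
  obtain ⟨h2, h3⟩ := h
  simp only [chord]
  constructor <;> nlinarith

lemma chord_mem_interior (k : ℕ) {t : ℝ} (h0 : 0 < t) (h1 : t < 1) :
    chord k t ∈ polygonInterior := by
  have := chord_bounds k ⟨h0.le, h1.le⟩
  exact mem_polygonInterior.2 (.inr (.inr ⟨h0, h1, this.1, this.2⟩))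

lemma pr_chord_zero (k : ℕ) : pr (chord k 0) = pr (chord k 1) := by
  rw [chord_zero, pr_add_shift (chord_one_mem k)]

lemma chord_zero_mem (k : ℕ) : chord k 0 ∈ polygon := by
  rw [chord_zero]
  exact side'_subset _ (Edge.add_shift_mem_side' (chord_one_mem k))

lemma chord_mem (k : ℕ) {t : ℝ} (h : t ∈ Icc (0 : ℝ) 1) : chord k t ∈ polygon := by
  rcases h.1.eq_or_lt with rfl | h0
  · exact chord_zero_mem k
  rcases h.2.eq_or_lt with rfl | h1
  · exact side_subset _ (chord_one_mem k)
  · exact polygonInterior_subset (chord_mem_interior k h0 h1)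

/-- The points of the polygon that represent points of the closed curve defined by a chord
lie on the chord. -/
lemma mem_chord_of_pr_eq {k : ℕ} {t : ℝ} (ht : t ∈ Icc (0 : ℝ) 1) {z : ℂ} (hz : z ∈ polygon)
    (h : pr z = pr (chord k t)) : ∃ s ∈ Icc (0 : ℝ) 1, z = chord k s := by
  have key : pr z = pr (chord k 1) → ∃ s ∈ Icc (0 : ℝ) 1, z = chord k s := by
    intro h
    rcases eq_of_pr_eq_of_side (chord_one_mem k) hz h with h | h
    · exact ⟨1, by simp, h⟩
    · exact ⟨0, by simp, h.trans (chord_zero k).symm⟩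
  rcases ht.1.eq_or_lt with rfl | h0
  · exact key (h.trans (pr_chord_zero k))
  rcases ht.2.eq_or_lt with rfl | h1
  · exact key h
  · exact ⟨t, ht, eq_of_pr_eq_of_interior (chord_mem_interior k h0 h1) hz h⟩

/-- Over a given abscissa `s ≥ 0` the height depends injectively on the dyadic parameter, whose
coefficient `5 + 4 * s` is not zero. -/
lemma eq_of_chord_eq {k l : ℕ} {s t : ℝ} (hs : s ∈ Icc (0 : ℝ) 1)
    (h : chord k s = chord l t) : k = l ∧ s = t := by
  obtain rfl : s = t := congrArg Complex.re h
  refine ⟨?_, rfl⟩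
  have h1 := congrArg Complex.im h
  simp only [chord] at h1
  have h2 : dyad (2 * k + 1) = dyad (2 * l + 1) := by
    have h3 : (dyad (2 * k + 1) - dyad (2 * l + 1)) * (5 + 4 * s) = 0 := by linarith
    rcases mul_eq_zero.1 h3 with h4 | h4
    · linarith
    · linarith [hs.1]
  by_contra hne
  rcases lt_or_gt_of_ne hne with h3 | h3
  · have := dyad_succ_le (m := 2 * k + 1) (n := 2 * l + 1) (by omega)
    linarith [dyad_pos (2 * k + 1)]
  · have := dyad_succ_le (m := 2 * l + 1) (n := 2 * k + 1) (by omega)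
    linarith [dyad_pos (2 * l + 1)]

lemma injOn_pr_chord (k : ℕ) : InjOn (fun t => pr (chord k t)) (Ico 0 1) := by
  have key : ∀ s ∈ Ico (0 : ℝ) 1, ∀ t ∈ Ico (0 : ℝ) 1, 0 < s →
      pr (chord k s) = pr (chord k t) → s = t := by
    intro s hs t ht h0 h
    have := eq_of_pr_eq_of_interior (chord_mem_interior k h0 hs.2) (chord_mem k ⟨ht.1, ht.2.le⟩) h.symm
    exact (eq_of_chord_eq ⟨ht.1, ht.2.le⟩ this).2.symm
  intro s hs t ht h
  rcases hs.1.eq_or_lt with h0 | h0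
  · rcases ht.1.eq_or_lt with h1 | h1
    · rw [← h0, ← h1]
    · exact (key t ht s hs h1 h.symm).symm
  · exact key s hs t ht h0 h

/-- The height of a point over the line spanned by a chord. -/
def heightOver (k : ℕ) (z : ℂ) : ℝ :=
  z.im - ((2 + z.re) / 3 - dyad (2 * k + 1) * (5 + 4 * z.re) / 24)

lemma continuous_heightOver (k : ℕ) : Continuous (heightOver k) := by
  unfold heightOver
  fun_prop

lemma heightOver_chord (k : ℕ) (t : ℝ) : heightOver k (chord k t) = 0 := by
  simp [heightOver, chord]

lemma eq_chord_of_heightOver {k : ℕ} {z : ℂ} (h : heightOver k z = 0) : z = chord k z.re :=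
  Complex.ext rfl (by rw [heightOver] at h; simp only [chord]; linarith)

lemma heightOver_lt {k l : ℕ} (h : k < l) {z : ℂ} (hz : 0 ≤ z.re) :
    heightOver l z < heightOver k z := by
  have h1 := dyad_succ_le (m := 2 * k + 1) (n := 2 * l + 1) (by omega)
  have h2 := dyad_pos (2 * k + 1)
  simp only [heightOver]
  nlinarith

/-- The part of the surface represented in the lower rectangle. -/
def lowerPart : Set XInf := pr '' (polygon ∩ Icc (-1 / 2) (1 / 2) ×ℂ Icc 0 (1 / 2))

/-- The polygon contains the interiors of its two rectangles. -/
lemma lower_subset : Ioo (-1 / 2 : ℝ) (1 / 2) ×ℂ Ioo (0 : ℝ) (1 / 2) ⊆ polygon :=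
  (subset_union_left.trans subset_union_left).trans polygonInterior_subset

lemma upper_subset : Ioo (0 : ℝ) 1 ×ℂ Ioo (1 / 2 : ℝ) 1 ⊆ polygon :=
  subset_union_right.trans polygonInterior_subset

/-- An open convex set meets the part of the polygon in a closed rectangle in a connected set. -/
lemma isPreconnected_inter_rectangle {a b c d : ℝ} (hab : a < b) (hcd : c < d)
    (hsub : Ioo a b ×ℂ Ioo c d ⊆ polygon) {O : Set ℂ} (hO : IsOpen O) (hconv : Convex ℝ O) :
    IsPreconnected (pr '' (polygon ∩ Icc a b ×ℂ Icc c d ∩ O)) := by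
  have h1 : IsPreconnected (O ∩ Ioo a b ×ℂ Ioo c d) :=
    (hconv.inter (((convex_Ioo a b).linear_preimage Complex.reLm).inter
      ((convex_Ioo c d).linear_preimage Complex.imLm))).isPreconnected
  refine (h1.subset_closure ?_ ?_).image pr
    (continuousOn_pr.mono (inter_subset_left.trans inter_subset_left))
  · rintro z ⟨hz, h⟩
    exact ⟨⟨hsub h, ⟨h.1.1.le, h.1.2.le⟩, ⟨h.2.1.le, h.2.2.le⟩⟩, hz⟩
  · rintro z ⟨⟨-, h⟩, hz⟩
    rw [← closure_rectangle hab hcd] at h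
    exact hO.inter_closure ⟨hz, h⟩

lemma isPreconnected_lowerPart : IsPreconnected lowerPart := by
  have := isPreconnected_inter_rectangle (by norm_num) (by norm_num) lower_subset isOpen_univ
    convex_univ
  rwa [inter_univ] at this

/-- Points in the same components of the complement of the first `g` chords. -/
def strip (g : ℕ) (z : ℂ) : Set ℂ := {w | ∀ k < g, 0 < heightOver k z * heightOver k w}

lemma isOpen_strip (g : ℕ) (z : ℂ) : IsOpen (strip g z) := by
  have : strip g z = ⋂ k ∈ Finset.range g, {w | 0 < heightOver k z * heightOver k w} := by
    ext w; simp [strip]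
  rw [this]
  exact isOpen_biInter_finset fun k _ =>
    isOpen_lt continuous_const (continuous_const.mul (continuous_heightOver k))

lemma convex_strip (g : ℕ) (z : ℂ) : Convex ℝ (strip g z) := by
  intro v hv w hw a b ha hb hab k hk
  have h1 := hv k hk
  have h2 := hw k hk
  have h3 : heightOver k (a • v + b • w) = a * heightOver k v + b * heightOver k w := by
    simp only [heightOver, Complex.add_re, Complex.add_im, Complex.real_smul, Complex.mul_re,
      Complex.mul_im, Complex.ofReal_re, Complex.ofReal_im, zero_mul, sub_zero, add_zero]
    obtain rfl : b = 1 - a := by linarith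
    ring
  rw [h3]
  rcases ha.eq_or_lt with rfl | ha
  · obtain rfl : b = 1 := by linarith
    simpa using h2
  · nlinarith [mul_pos ha h1, mul_nonneg hb h2.le]

/-- Every strip between chords contains points of an edge glued to the lower rectangle. -/
lemma exists_mem_strip {g : ℕ} {z : ℂ} (hz : 0 ≤ z.re) (h : ∀ k < g, heightOver k z ≠ 0) :
    ∃ j, (⟨1, 1 - 3 / 8 * dyad (2 * j)⟩ : ℂ) ∈ strip g z := by
  classical
  -- The chords rise with their index, so the least such `j` is the number of the first `g` chords
  -- that lie below `z`.
  have hex : ∃ j, g ≤ j ∨ heightOver j z < 0 := ⟨g, .inl le_rfl⟩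
  refine ⟨Nat.find hex, fun k hk => ?_⟩
  set j := Nat.find hex
  -- The midpoint of `A (2 * j)` lies above chord `k` exactly when `k < j`, like `z`.
  have h1 : heightOver k ⟨1, 1 - 3 / 8 * dyad (2 * j)⟩ =
      3 / 8 * (dyad (2 * k + 1) - dyad (2 * j)) := by
    simp only [heightOver]; ring
  rw [h1]
  rcases lt_or_ge k j with hkj | hkj
  · have h2 := Nat.find_min hex hkj
    push Not at h2
    have h3 := dyad_succ_le (m := 2 * k + 1) (n := 2 * j) (by omega)
    have h4 := dyad_pos (2 * k + 1)
    exact mul_pos (lt_of_le_of_ne h2.2 (h k hk).symm) (by linarith)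
  · have h2 : heightOver j z < 0 := (Nat.find_spec hex).resolve_left (by omega)
    have h3 : heightOver k z < 0 := by
      rcases hkj.eq_or_lt with h' | h'
      · rwa [← h']
      · exact (heightOver_lt h' hz).trans h2
    have h4 := dyad_succ_le (m := 2 * j) (n := 2 * k + 1) (by omega)
    have h5 := dyad_pos (2 * j)
    exact mul_pos_of_neg_of_neg h3 (by linarith)

/-- The lower rectangle meets no chord and serves as a hub. A point of the upper rectangle lies in a
convex strip between chords, and this strip meets the hub in a point of some edge `A (2 * j)`, glued
to the left side of the lower rectangle. -/
lemma isConnected_compl_chords (g : ℕ) :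
    IsConnected (⋃ k : Fin g, (fun t => pr (chord k t)) '' Icc 0 1)ᶜ := by
  set M : Set XInf := (⋃ k : Fin g, (fun t => pr (chord k t)) '' Icc 0 1)ᶜ with hM
  have hmem : ∀ z ∈ polygon, (∀ k < g, ∀ t ∈ Icc (0 : ℝ) 1, z ≠ chord k t) → pr z ∈ M := by
    intro z hz h
    rw [hM, mem_compl_iff, mem_iUnion]
    rintro ⟨k, t, ht, htz⟩
    obtain ⟨s, hs, rfl⟩ := mem_chord_of_pr_eq ht hz htz.symm
    exact h k k.2 s hs rfl
  have hlow : lowerPart ⊆ M := by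
    rintro x ⟨z, ⟨hz, hz'⟩, rfl⟩
    refine hmem z hz fun k hk t ht h => ?_
    have := chord_bounds k ht
    rw [← h] at this
    exact absurd hz'.2.2 (not_le.2 this.1)
  have hbase : pr ⟨1 / 4, 1 / 4⟩ ∈ lowerPart :=
    ⟨_, ⟨polygonInterior_subset zero_lt_one_interior, by constructor <;> constructor <;> norm_num⟩,
      rfl⟩
  refine ⟨⟨_, hlow hbase⟩, isPreconnected_of_forall (pr ⟨1 / 4, 1 / 4⟩) fun x hx => ?_⟩
  obtain ⟨z, hz, rfl⟩ := exists_pr x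
  rcases polygon_bounds hz with h | h
  · exact ⟨lowerPart, hlow, hbase, ⟨z, ⟨hz, ⟨h.1, h.2.1⟩, h.2.2⟩, rfl⟩, isPreconnected_lowerPart⟩
  have hne : ∀ k < g, heightOver k z ≠ 0 := by
    intro k hk h0
    refine hx (mem_iUnion.2 ⟨⟨k, hk⟩, z.re, ⟨h.1, h.2.1⟩, ?_⟩)
    simp only
    rw [← eq_chord_of_heightOver h0]
  set T : Set XInf := pr '' (polygon ∩ Icc 0 1 ×ℂ Icc (1 / 2) 1 ∩ strip g z)
  have hT : IsPreconnected T := isPreconnected_inter_rectangle (by norm_num) (by norm_num)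
    upper_subset (isOpen_strip g z) (convex_strip g z)
  have hTM : T ⊆ M := by
    rintro x ⟨w, ⟨⟨hw, hw'⟩, hws⟩, rfl⟩
    refine hmem w hw fun k hk t ht h => ?_
    have := hws k hk
    rw [h, heightOver_chord, mul_zero] at this
    exact lt_irrefl _ this
  have hzT : pr z ∈ T := by
    refine ⟨z, ⟨⟨hz, ⟨h.1, h.2.1⟩, h.2.2⟩, fun k hk => ?_⟩, rfl⟩
    exact mul_self_pos.2 (hne k hk)
  obtain ⟨j, hj⟩ := exists_mem_strip h.1 hne
  have hev : Even (2 * j) := even_two_mul j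
  have hd := dyad_pos (2 * j)
  have hd' := dyad_le_one (2 * j)
  have hside : (⟨1, 1 - 3 / 8 * dyad (2 * j)⟩ : ℂ) ∈ (Edge.A (2 * j)).side :=
    Edge.mem_side_A.2 ⟨rfl, by simp only; linarith, by simp only; linarith⟩
  have hinter : (lowerPart ∩ T).Nonempty := by
    refine ⟨pr ⟨1, 1 - 3 / 8 * dyad (2 * j)⟩, ?_, ⟨_, ⟨⟨side_subset _ hside, ?_⟩, hj⟩, rfl⟩⟩
    · rw [← pr_add_shift hside]
      refine ⟨_, ⟨side'_subset _ (Edge.add_shift_mem_side' hside), ?_⟩, rfl⟩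
      rw [Edge.shift_A_even hev]
      constructor <;> constructor <;> simp <;> linarith
    · constructor <;> constructor <;> simp <;> linarith
  exact ⟨lowerPart ∪ T, union_subset hlow hTM, .inl hbase, .inr hzT,
    isPreconnected_lowerPart.union' hinter hT⟩

lemma genus_eq_top : genus XInf = ⊤ := by
  rw [genus, ENat.eq_top_iff_forall_ge]
  intro g
  refine le_iSup₂_of_le g ?_ le_rfl
  have h : ∀ k : Fin g, ∃ γ : Circle → XInf, Continuous γ ∧ Function.Injective γ ∧
      range γ = (fun t => pr (chord k t)) '' Icc 0 1 := fun k =>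
    exists_simple_closed_curve (continuousOn_pr.comp (continuous_chord k).continuousOn
      fun t ht => chord_mem k ht) (pr_chord_zero k) (injOn_pr_chord k)
  choose γ h1 h2 h3 using h
  refine ⟨γ, fun i => ⟨h1 i, h2 i⟩, fun i j hij => ?_, ?_⟩
  · simp only [h3]
    refine disjoint_left.2 ?_
    rintro x ⟨s, hs, rfl⟩ ⟨t, ht, hts⟩
    obtain ⟨s', hs', h⟩ := mem_chord_of_pr_eq hs (chord_mem j ht) hts
    exact hij (Fin.ext (eq_of_chord_eq ht h).1.symm)
  · simp only [h3]
    exact isConnected_compl_chords g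

/-! ## Ends -/

/-- A space has exactly one end if outside of every compact set there is a nonempty connected
set that contains the complement of a compact set. -/
lemma hasOneEnd_of_forall_compact {X : Type*} [TopologicalSpace X]
    (h : ∀ K : TopologicalSpace.Compacts X, ∃ N : Set X, N ⊆ (K : Set X)ᶜ ∧ IsPreconnected N ∧
      N.Nonempty ∧ ∃ L : TopologicalSpace.Compacts X, (L : Set X)ᶜ ⊆ N) : HasOneEnd X := by
  choose N hNK hN hne L hL using h
  have hmk : ∀ (K : TopologicalSpace.Compacts X) (x y : X) (hx : x ∈ N K) (hy : y ∈ N K),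
      (ConnectedComponents.mk ⟨x, hNK K hx⟩ : ConnectedComponents ↥((K : Set X)ᶜ)) =
        ConnectedComponents.mk ⟨y, hNK K hy⟩ := by
    intro K x y hx hy
    have h1 : IsPreconnected ((↑) ⁻¹' N K : Set ↥((K : Set X)ᶜ)) := by
      rw [← Topology.IsInducing.subtypeVal.isPreconnected_image,
        Subtype.image_preimage_coe, inter_eq_right.2 (hNK K)]
      exact hN K
    refine ConnectedComponents.coe_eq_coe'.2 ?_
    exact h1.subset_connectedComponent (x := ⟨y, hNK K hy⟩) hy (show (⟨x, hNK K hx⟩ : ↥((K : Set X)ᶜ)) ∈ _ from hx)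
  choose x hx using hne
  refine ⟨⟨fun K => ConnectedComponents.mk ⟨x K, hNK K (hx K)⟩, fun K K' hKK' => ?_⟩,
    fun e' => Subtype.ext (funext fun K => ?_)⟩
  -- The chosen point of `N (L K ⊔ L K')` avoids `L K` and `L K'`, so it lies in both `N K` and `N
  -- K'` and links their components.
  · have hy := hNK (L K ⊔ L K') (hx _)
    rw [TopologicalSpace.Compacts.coe_sup, compl_union] at hy
    exact (congrArg (restrictComponent hKK') (hmk K' _ _ (hx K') (hL K' hy.2))).trans
      (hmk K _ _ (hL K hy.1) (hx K))
  -- Any end is represented beyond `K ⊔ L K` by a point outside `L K`, hence in `N K`; so over `K`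
  -- it selects the component of `N K`.
  · rw [← e'.2 K (K ⊔ L K) le_sup_left]
    obtain ⟨⟨y, hy⟩, h⟩ := ConnectedComponents.surjective_coe (e'.1 (K ⊔ L K))
    rw [← h]
    have hy' : y ∈ (K : Set X)ᶜ ∩ (L K : Set X)ᶜ := by
      rwa [← compl_union, ← TopologicalSpace.Compacts.coe_sup]
    exact hmk K _ _ (hL K hy'.2) (hx K)

/-! ### Vertices of the upper rectangle -/

/-- The upper rectangle. -/
def upperRect : Set ℂ := Icc 0 1 ×ℂ Icc (1 / 2) 1

/-- The points of the closed upper rectangle that do not belong to the polygon. -/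
def IsVertex (r : ℂ) : Prop := r ∈ upperRect ∧ r ∉ polygon

lemma dyad_cases (m n : ℕ) : m = n ∨ dyad m ≤ dyad n / 2 ∨ dyad n ≤ dyad m / 2 := by
  rcases lt_trichotomy m n with h | h | h
  · exact .inr (.inr (dyad_succ_le h))
  · exact .inl h
  · exact .inr (.inl (dyad_succ_le h))

lemma dyad_cases_of_parity {m n : ℕ} (h : Even m ↔ Even n) :
    m = n ∨ dyad m ≤ dyad n / 4 ∨ dyad n ≤ dyad m / 4 := by
  rcases lt_trichotomy m n with h' | h' | h'
  · exact .inr (.inr (dyad_succ_succ_le h' h))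
  · exact .inl h'
  · exact .inr (.inl (dyad_succ_succ_le h' h.symm))

/-- The endpoints of the edges on the right side of the upper rectangle. -/
def rightVertex (m : ℕ) : ℂ := ⟨1, 1 - dyad m / 2⟩
/-- The endpoints of the edges below the limit point on the left side of the upper rectangle. -/
def lowLeftVertex (n : ℕ) : ℂ := ⟨0, 2 / 3 - dyad n / 3⟩
/-- The endpoints of the edges above the limit point on the left side of the upper rectangle. -/
def highLeftVertex (n : ℕ) : ℂ := ⟨0, 2 / 3 + dyad n / 3⟩
/-- The left endpoints of the edges `C' m`. -/
def topVertex (m : ℕ) : ℂ := ⟨1 - dyad m, 1⟩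
/-- The left endpoints of the edges `C'' m`. -/
def topMidVertex (m : ℕ) : ℂ := ⟨1 - 3 * dyad m / 4, 1⟩

/-- A criterion for a point to be a vertex. -/
lemma isVertex_of {r : ℂ} (h : r ∈ upperRect)
    (hi : ¬ (0 < r.re ∧ r.re < 1 ∧ r.im < 1 ∧ (1 / 2 < r.im ∨ r.re < 1 / 2)))
    (hA : ∀ n, r.re = 1 → ¬ (1 - dyad n / 2 < r.im ∧ r.im < 1 - dyad n / 4))
    (hC : ∀ n, r.im = 1 → 1 - dyad n < r.re → r.re < 1 - dyad n / 2 → r.re = 1 - 3 * dyad n / 4)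
    (hu : r.im = 1 / 2 → 1 / 2 < r.re → r.re = 1)
    (hA' : ∀ n, ¬ Even n → r.re = 0 →
      ¬ (2 / 3 - dyad n / 3 < r.im ∧ r.im < 2 / 3 - dyad n / 12))
    (hB' : ∀ n, Even n → r.re = 0 →
      ¬ (2 / 3 + dyad n / 12 < r.im ∧ r.im < 2 / 3 + dyad n / 3)) : IsVertex r := by
  refine ⟨h, fun hp => ?_⟩
  obtain ⟨⟨h1, h2⟩, ⟨h3, h4⟩⟩ := h
  rcases mem_polygon.1 hp with hp | ⟨e, hp | hp⟩
  · rcases mem_polygonInterior.1 hp with hp | hp | hp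
    · linarith
    · exact hi ⟨by linarith, by linarith, by linarith, .inr (by linarith)⟩
    · exact hi ⟨by linarith, by linarith, by linarith, .inl (by linarith)⟩
  · rcases Edge.side_cases hp with ⟨-, hp⟩ | ⟨n, -, hp⟩ | ⟨n, -, hp⟩ | ⟨n, -, hp⟩ | ⟨n, -, hp⟩
    · linarith
    · exact hA n hp.2.2.1 hp.2.2.2
    · linarith
    · linarith [hC n hp.2.2.1 hp.2.2.2.1 (by linarith)]
    · linarith [hC n hp.2.2.1 (by linarith) hp.2.2.2.2]
  · rcases Edge.side'_cases hp with ⟨-, hp⟩ | ⟨n, -, hn, hp⟩ | ⟨n, -, hn, hp⟩ | ⟨n, -, hn, hp⟩ |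
      ⟨n, -, hn, hp⟩ | ⟨n, -, hp⟩ | ⟨n, -, hp⟩
    · linarith [hu hp.1 hp.2.1]
    · linarith
    · exact hA' n hn hp.2.2.1 hp.2.2.2
    · exact hB' n hn hp.2.2.1 hp.2.2.2
    all_goals linarith

lemma isVertex_right (m : ℕ) : IsVertex (rightVertex m) := by
  have h0 := dyad_pos m
  have h1 := dyad_le_one m
  refine isVertex_of ?_ ?_ ?_ ?_ ?_ ?_ ?_
  · constructor <;> constructor <;> simp [rightVertex] <;> linarith
  all_goals simp only [rightVertex]
  · intro h; linarith
  · intro n _ h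
    rcases dyad_cases m n with rfl | h' | h' <;> linarith
  · intro n h; linarith
  · intro _ _; trivial
  · intro n _ h; norm_num at h
  · intro n _ h; norm_num at h

lemma isVertex_lowLeft {n : ℕ} (hn : ¬ Even n) : IsVertex (lowLeftVertex n) := by
  have h0 := dyad_pos n
  have h1 := dyad_odd_le hn
  refine isVertex_of ?_ ?_ ?_ ?_ ?_ ?_ ?_
  · constructor <;> constructor <;> simp [lowLeftVertex] <;> linarith
  all_goals simp only [lowLeftVertex]
  · intro h; linarith
  · intro m h; norm_num at h
  · intro m h; linarith
  · intro _ h; linarith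
  · intro m hm _ h
    rcases dyad_cases_of_parity (iff_of_false hn hm) with rfl | h' | h' <;> linarith
  · intro m _ _ h
    linarith [dyad_pos m]

lemma isVertex_highLeft {n : ℕ} (hn : Even n) : IsVertex (highLeftVertex n) := by
  have h0 := dyad_pos n
  have h1 := dyad_le_one n
  refine isVertex_of ?_ ?_ ?_ ?_ ?_ ?_ ?_
  · constructor <;> constructor <;> simp [highLeftVertex] <;> linarith
  all_goals simp only [highLeftVertex]
  · intro h; linarith
  · intro m h; norm_num at h
  · intro m _ h; linarith [dyad_le_one m]
  · intro _ h; linarith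
  · intro m _ _ h
    linarith [dyad_pos m]
  · intro m hm _ h
    rcases dyad_cases_of_parity (iff_of_true hn hm) with rfl | h' | h' <;> linarith

lemma isVertex_top (m : ℕ) : IsVertex (topVertex m) := by
  have h0 := dyad_pos m
  have h1 := dyad_le_one m
  refine isVertex_of ?_ ?_ ?_ ?_ ?_ ?_ ?_
  · constructor <;> constructor <;> simp [topVertex] <;> linarith
  all_goals simp only [topVertex]
  · intro h; linarith
  · intro n h; linarith
  · intro n _ h h'
    rcases dyad_cases m n with rfl | h' | h' <;> linarith
  · intro h; norm_num at h
  · intro n _ _ h; linarith [dyad_pos n]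
  · intro n _ _ h; linarith [dyad_le_one n]

lemma isVertex_topMid (m : ℕ) : IsVertex (topMidVertex m) := by
  have h0 := dyad_pos m
  have h1 := dyad_le_one m
  refine isVertex_of ?_ ?_ ?_ ?_ ?_ ?_ ?_
  · constructor <;> constructor <;> simp [topMidVertex] <;> linarith
  all_goals simp only [topMidVertex]
  · intro h; linarith
  · intro n h; linarith
  · intro n _ h h'
    rcases dyad_cases m n with rfl | h' | h' <;> linarith
  · intro h; norm_num at h
  · intro n _ _ h; linarith [dyad_pos n]
  · intro n _ _ h; linarith [dyad_le_one n]

lemma isVertex_center : IsVertex ⟨1 / 2, 1 / 2⟩ := by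
  refine isVertex_of ?_ ?_ ?_ ?_ ?_ ?_ ?_
  · constructor <;> constructor <;> norm_num
  all_goals norm_num

lemma isVertex_corner : IsVertex ⟨1, 1⟩ := by
  refine isVertex_of ?_ ?_ ?_ ?_ ?_ ?_ ?_
  · constructor <;> constructor <;> norm_num
  · norm_num
  · intro n _ h
    linarith [dyad_pos n]
  · intro n _ _ h
    linarith [dyad_pos n]
  all_goals norm_num

lemma exists_dyad {t : ℝ} (h0 : 0 < t) (h1 : t ≤ 1) : ∃ m, dyad m / 2 < t ∧ t ≤ dyad m := by
  obtain ⟨m, h2, h3⟩ := exists_nat_pow_near_of_lt_one h0 h1 (y := 1 / 2) (by norm_num) (by norm_num)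
  refine ⟨m, ?_, ?_⟩
  · rw [← dyad_succ]
    simpa [dyad] using h2
  · simpa [dyad] using h3

/-- An odd dyadic interval is merged with the even one preceding it. -/
lemma exists_dyad_even {t : ℝ} (h0 : 0 < t) (h1 : t ≤ 1) :
    ∃ n, Even n ∧ dyad n / 4 < t ∧ t ≤ dyad n := by
  obtain ⟨m, h2, h3⟩ := exists_dyad h0 h1
  have := dyad_pos m
  by_cases hm : Even m
  · exact ⟨m, hm, by linarith, h3⟩
  · obtain ⟨n, rfl⟩ : ∃ n, m = n + 1 := ⟨m - 1, by
      have : m ≠ 0 := by rintro rfl; simp at hm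
      omega⟩
    rw [dyad_succ] at h2 h3 this
    exact ⟨n, by rwa [Nat.even_add_one, not_not] at hm, by linarith, by linarith⟩

lemma exists_dyad_odd {t : ℝ} (h0 : 0 < t) (h1 : t ≤ 1 / 2) :
    ∃ n, ¬ Even n ∧ dyad n / 4 < t ∧ t ≤ dyad n := by
  obtain ⟨n, hn, h2, h3⟩ := exists_dyad_even (t := 2 * t) (by linarith) (by linarith)
  refine ⟨n + 1, by rwa [Nat.even_add_one, not_not], ?_, ?_⟩ <;> rw [dyad_succ] <;> linarith

/-- On each side the dyadic intervals are half-open and exhaust it up to the limit point; a missing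
point cannot be inside an edge, so it is the endpoint of its interval or, on the top, the middle
point between `C' m` and `C'' m`. -/
lemma IsVertex.cases {r : ℂ} (h : IsVertex r) :
    (∃ m, r = rightVertex m) ∨ (∃ n, ¬ Even n ∧ r = lowLeftVertex n) ∨
    (∃ n, Even n ∧ r = highLeftVertex n) ∨ (∃ m, r = topVertex m) ∨ (∃ m, r = topMidVertex m) ∨
    r = ⟨1 / 2, 1 / 2⟩ ∨ r = ⟨1, 1⟩ ∨ r = ⟨0, 2 / 3⟩ := by
  obtain ⟨⟨⟨h1, h2⟩, ⟨h3, h4⟩⟩, hp⟩ := h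
  rw [mem_polygon, not_or] at hp
  obtain ⟨hi, he⟩ := hp
  push Not at he
  rw [mem_polygonInterior] at hi
  rcases h2.eq_or_lt with hr | hr
  · rcases h4.eq_or_lt with hr' | hr'
    · exact .inr <| .inr <| .inr <| .inr <| .inr <| .inr <| .inl (Complex.ext hr hr')
    obtain ⟨m, hm1, hm2⟩ := exists_dyad (t := 2 * (1 - r.im)) (by linarith) (by linarith)
    refine .inl ⟨m, Complex.ext hr ?_⟩
    have := (he (.A m)).1
    rw [Edge.mem_side_A] at this
    simp only [rightVertex]
    by_contra hne
    have hlt : 2 * (1 - r.im) < dyad m := lt_of_le_of_ne hm2 fun h => hne (by linarith)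
    exact this ⟨hr, by linarith, by linarith⟩
  rcases h1.eq_or_lt with hl | hl
  · rcases lt_trichotomy r.im (2 / 3) with h | h | h
    · obtain ⟨n, hn, hn1, hn2⟩ := exists_dyad_odd (t := 3 * (2 / 3 - r.im)) (by linarith)
        (by linarith)
      refine .inr <| .inl ⟨n, hn, Complex.ext hl.symm ?_⟩
      have := (he (.A n)).2
      rw [Edge.mem_side'_A_odd hn] at this
      simp only [lowLeftVertex]
      by_contra hne
      have hlt : 3 * (2 / 3 - r.im) < dyad n := lt_of_le_of_ne hn2 fun h => hne (by linarith)
      exact this ⟨hl.symm, by linarith, by linarith⟩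
    · exact .inr <| .inr <| .inr <| .inr <| .inr <| .inr <| .inr (Complex.ext hl.symm h)
    · obtain ⟨n, hn, hn1, hn2⟩ := exists_dyad_even (t := 3 * (r.im - 2 / 3)) (by linarith)
        (by linarith)
      refine .inr <| .inr <| .inl ⟨n, hn, Complex.ext hl.symm ?_⟩
      have := (he (.B n)).2
      rw [Edge.mem_side'_B_even hn] at this
      simp only [highLeftVertex]
      by_contra hne
      have hlt : 3 * (r.im - 2 / 3) < dyad n := lt_of_le_of_ne hn2 fun h => hne (by linarith)
      exact this ⟨hl.symm, by linarith, by linarith⟩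
  rcases h4.eq_or_lt with ht | ht
  · obtain ⟨m, hm1, hm2⟩ := exists_dyad (t := 1 - r.re) (by linarith) (by linarith)
    have h' := (he (.C' m)).1
    have h'' := (he (.C'' m)).1
    rw [Edge.mem_side_C'] at h'
    rw [Edge.mem_side_C''] at h''
    rcases hm2.eq_or_lt with h5 | h5
    · exact .inr <| .inr <| .inr <| .inl ⟨m, Complex.ext (by simp only [topVertex]; linarith) ht⟩
    · refine .inr <| .inr <| .inr <| .inr <| .inl ⟨m, Complex.ext ?_ ht⟩
      simp only [topMidVertex]
      rcases lt_trichotomy r.re (1 - 3 * dyad m / 4) with h6 | h6 | h6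
      · exact (h' ⟨ht, by linarith, h6⟩).elim
      · exact h6
      · exact (h'' ⟨ht, h6, by linarith⟩).elim
  rcases h3.eq_or_lt with hb | hb
  · have := (he .unlabeled).2
    rw [Edge.mem_side'_unlabeled] at this
    refine .inr <| .inr <| .inr <| .inr <| .inr <| .inl (Complex.ext ?_ hb.symm)
    rcases lt_trichotomy r.re (1 / 2) with h6 | h6 | h6
    · exact (hi (.inr (.inl ⟨hl, h6, by linarith, ht⟩))).elim
    · exact h6
    · exact (this ⟨hb.symm, h6, hr⟩).elim
  · exact (hi (.inr (.inr ⟨hl, hr, hb, ht⟩))).elim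

/-! ### Cells around the vertices and their adjacency -/

/-- The identity or the involution `rho`. -/
def flip (b : Bool) (x : XInf) : XInf := if b then rho x else x

lemma flip_flip (a b : Bool) (x : XInf) : flip a (flip b x) = flip (a ^^ b) x := by
  cases a <;> cases b <;> simp [flip, show ∀ y, rho (rho y) = y from rho_rho]

lemma continuous_flip (b : Bool) : Continuous (flip b) := by
  cases b
  · exact continuous_id
  · exact rho.continuous

/-- The open square with center `r` and side length `2 * e`. -/
def box (r : ℂ) (e : ℝ) : Set ℂ := Ioo (r.re - e) (r.re + e) ×ℂ Ioo (r.im - e) (r.im + e)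

lemma isOpen_box (r : ℂ) (e : ℝ) : IsOpen (box r e) := isOpen_Ioo.reProdIm isOpen_Ioo

lemma convex_box (r : ℂ) (e : ℝ) : Convex ℝ (box r e) := 
  ((convex_Ioo _ _).linear_preimage Complex.reLm).inter ((convex_Ioo _ _).linear_preimage Complex.imLm)

lemma mem_box_self (r : ℂ) {e : ℝ} (he : 0 < e) : r ∈ box r e := by
  constructor <;> constructor <;> linarith

lemma dist_lt_of_mem_box {r z : ℂ} {e : ℝ} (h : z ∈ box r (e / 2)) : dist z r < e := by
  obtain ⟨⟨h1, h2⟩, ⟨h3, h4⟩⟩ := h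
  refine (dist_eq_norm z r ▸ Complex.norm_le_abs_re_add_abs_im (z - r)).trans_lt ?_
  have h5 : |(z - r).re| < e / 2 := abs_lt.2 (by simp only [Complex.sub_re]; constructor <;> linarith)
  have h6 : |(z - r).im| < e / 2 := abs_lt.2 (by simp only [Complex.sub_im]; constructor <;> linarith)
  linarith

/-- The part of the surface near a vertex of the upper rectangle, or its image under `rho`. -/
def cell (ε : ℂ → ℝ) (b : Bool) (r : ℂ) : Set XInf :=
  flip b '' (pr '' (polygon ∩ upperRect ∩ box r (ε r)))

lemma isPreconnected_cell (ε : ℂ → ℝ) (b : Bool) (r : ℂ) : IsPreconnected (cell ε b r) :=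
  (isPreconnected_inter_rectangle (by norm_num) (by norm_num) upper_subset (isOpen_box _ _)
    (convex_box _ _)).image _ (continuous_flip b).continuousOn

lemma exists_interior_mem {r : ℂ} (hr : r ∈ upperRect) {U : Set ℂ} (hU : IsOpen U) (h : r ∈ U) :
    ∃ z ∈ polygon ∩ upperRect, z ∈ U := by
  have h1 : r ∈ closure (Ioo (0 : ℝ) 1 ×ℂ Ioo (1 / 2 : ℝ) 1) := by
    rw [Complex.closure_reProdIm, closure_Ioo (by norm_num), closure_Ioo (by norm_num)]
    exact hr
  obtain ⟨z, hz, hz'⟩ := mem_closure_iff.1 h1 U hU h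
  exact ⟨z, ⟨upper_subset hz', ⟨Ioo_subset_Icc_self hz'.1, Ioo_subset_Icc_self hz'.2⟩⟩, hz⟩

lemma cell_nonempty {ε : ℂ → ℝ} (b : Bool) {r : ℂ} (hr : r ∈ upperRect) (hε : 0 < ε r) :
    (cell ε b r).Nonempty := by
  obtain ⟨z, hz, hz'⟩ := exists_interior_mem hr (isOpen_box r (ε r)) (mem_box_self r hε)
  exact ⟨_, _, ⟨z, ⟨hz, hz'⟩, rfl⟩, rfl⟩

/-- Arbitrarily close to `r` and `r'` there are points of the upper rectangle that represent the
same point of the surface, up to the involution `flip b`. -/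
def Adjoining (b : Bool) (r r' : ℂ) : Prop :=
  ∀ U U' : Set ℂ, IsOpen U → IsOpen U' → r ∈ U → r' ∈ U' →
    ∃ z ∈ polygon ∩ upperRect ∩ U, ∃ w ∈ polygon ∩ upperRect ∩ U', flip b (pr z) = pr w

lemma Adjoining.symm {b : Bool} {r r' : ℂ} (h : Adjoining b r r') : Adjoining b r' r := by
  intro U U' hU hU' hr hr'
  obtain ⟨z, hz, w, hw, hzw⟩ := h U' U hU' hU hr' hr
  refine ⟨w, hw, z, hz, ?_⟩
  rw [← hzw, flip_flip]
  simp [flip]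

/-- Matching points of two open segments tend simultaneously to the matching endpoints. -/
lemma adjoining_of_segment {b : Bool} {a v a' v' : ℂ}
    (h : ∀ t : ℝ, 0 < t → t < 1 → a + t * v ∈ polygon ∩ upperRect ∧
      a' + t * v' ∈ polygon ∩ upperRect ∧ flip b (pr (a + t * v)) = pr (a' + t * v')) :
    Adjoining b a a' ∧ Adjoining b (a + v) (a' + v') := by
  have key : ∀ t₀ ∈ Icc (0 : ℝ) 1, Adjoining b (a + t₀ * v) (a' + t₀ * v') := by
    intro t₀ h₀ U U' hU hU' hr hr'
    rw [← closure_Ioo (by norm_num)] at h₀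
    obtain ⟨t, ⟨ht, ht'⟩, h0, h1⟩ := mem_closure_iff.1 h₀
      ((fun t : ℝ => a + t * v) ⁻¹' U ∩ (fun t : ℝ => a' + t * v') ⁻¹' U')
      ((hU.preimage (by fun_prop)).inter (hU'.preimage (by fun_prop))) ⟨hr, hr'⟩
    obtain ⟨h2, h3, h4⟩ := h t h0 h1
    exact ⟨_, ⟨h2, ht⟩, _, ⟨h3, ht'⟩, h4⟩
  have h0 := key 0 (by simp)
  have h1 := key 1 (by simp)
  simp only [Complex.ofReal_zero, zero_mul, add_zero, Complex.ofReal_one, one_mul] at h0 h1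
  exact ⟨h0, h1⟩

/-- For odd `n` both edges of the pair `A n` lie on the upper rectangle. The index jumps by 2 on the
left because `dyad n / 3 - dyad n / 4 = dyad (n + 2) / 3`. -/
lemma adjoining_right_lowLeft {n : ℕ} (hn : ¬ Even n) :
    Adjoining false (rightVertex n) (lowLeftVertex n) ∧
      Adjoining false (rightVertex (n + 1)) (lowLeftVertex (n + 2)) := by
  have h0 := dyad_pos n
  have h1 := dyad_odd_le hn
  have := adjoining_of_segment (b := false) (a := rightVertex n) (v := ⟨0, dyad n / 4⟩)
    (a' := lowLeftVertex n) (v' := ⟨0, dyad n / 4⟩) fun t ht0 ht1 => by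
      have hm : rightVertex n + t * ⟨0, dyad n / 4⟩ ∈ (Edge.A n).side := by
        rw [Edge.mem_side_A]
        simp [rightVertex]
        constructor <;> nlinarith
      have hs : rightVertex n + t * ⟨0, dyad n / 4⟩ + (Edge.A n).shift =
          lowLeftVertex n + t * ⟨0, dyad n / 4⟩ := by
        rw [Edge.shift_A_odd hn]
        apply Complex.ext <;> simp [rightVertex, lowLeftVertex]; ring
      refine ⟨⟨side_subset _ hm, ?_⟩, ⟨hs ▸ side'_subset _ (Edge.add_shift_mem_side' hm), ?_⟩,
        hs ▸ (pr_add_shift hm).symm⟩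
      · have := Edge.mem_side_A.1 hm
        exact ⟨⟨by linarith, by linarith⟩, ⟨by linarith, by linarith⟩⟩
      · have := (Edge.mem_side'_A_odd hn).1 (hs ▸ Edge.add_shift_mem_side' hm)
        exact ⟨⟨by linarith, by linarith⟩, ⟨by linarith, by linarith⟩⟩
  refine ⟨this.1, ?_⟩
  convert this.2 using 1
  · apply Complex.ext <;> simp [rightVertex, dyad_succ]; ring
  · apply Complex.ext <;> simp [lowLeftVertex, dyad_succ]; ring

/-- For even `n` the partner of `A n` lies on the lower rectangle. Instead, `rho` carries `A n` to
`B n` with reversed direction, and the partner of `B n` is on the left of the upper rectangle. -/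
lemma adjoining_right_highLeft {n : ℕ} (hn : Even n) :
    Adjoining true (rightVertex n) (highLeftVertex n) ∧
      Adjoining true (rightVertex (n + 1)) (highLeftVertex (n + 2)) := by
  have h0 := dyad_pos n
  have h1 := dyad_le_one n
  have := adjoining_of_segment (b := true) (a := rightVertex n) (v := ⟨0, dyad n / 4⟩)
    (a' := highLeftVertex n) (v' := ⟨0, -dyad n / 4⟩) fun t ht0 ht1 => by
      set z := rightVertex n + t * ⟨0, dyad n / 4⟩ with hz
      have hre : z.re = 1 := by simp [hz, rightVertex]
      have him : z.im = 1 - dyad n / 2 + t * (dyad n / 4) := by simp [hz, rightVertex]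
      have hm : z ∈ (Edge.A n).side := by
        rw [Edge.mem_side_A, hre, him]
        exact ⟨rfl, by nlinarith, by nlinarith⟩
      have hm' := Edge.mem_side_A.1 hm
      have hm2 : z + ⟨-1 / 2, 1 - 2 * z.im⟩ ∈ (Edge.B n).side := by
        rw [Edge.mem_side_B]
        simp only [Complex.add_re, Complex.add_im]
        exact ⟨by linarith, by linarith, by linarith⟩
      have hs : z + ⟨-1 / 2, 1 - 2 * z.im⟩ + (Edge.B n).shift =
          highLeftVertex n + t * ⟨0, -dyad n / 4⟩ := by
        rw [Edge.shift_B_even hn]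
        apply Complex.ext
        · simp [hre, highLeftVertex]; norm_num
        · simp [him, highLeftVertex]; ring
      refine ⟨⟨side_subset _ hm, ⟨⟨by linarith, by linarith⟩, ⟨by linarith, by linarith⟩⟩⟩,
        ⟨hs ▸ side'_subset _ (Edge.add_shift_mem_side' hm2), ?_⟩, ?_⟩
      · have := (Edge.mem_side'_B_even hn).1 (hs ▸ Edge.add_shift_mem_side' hm2)
        exact ⟨⟨by linarith, by linarith⟩, ⟨by linarith, by linarith⟩⟩
      · rw [← hs, pr_add_shift hm2]
        exact (rho_upper (side_subset _ hm) (by linarith) (by linarith)).2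
  refine ⟨this.1, ?_⟩
  convert this.2 using 1
  · apply Complex.ext <;> simp [rightVertex, dyad_succ]; ring
  · apply Complex.ext <;> simp [highLeftVertex, dyad_succ]; ring

/-- The involution carries `C' n` to the partner of `C'' n`. -/
lemma adjoining_top (n : ℕ) :
    Adjoining true (topVertex n) (topMidVertex n) ∧
      Adjoining true (topMidVertex n) (topVertex (n + 1)) := by
  have h0 := dyad_pos n
  have h1 := dyad_le_one n
  have := adjoining_of_segment (b := true) (a := topVertex n) (v := ⟨dyad n / 4, 0⟩)
    (a' := topMidVertex n) (v' := ⟨dyad n / 4, 0⟩) fun t ht0 ht1 => by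
      set z := topVertex n + t * ⟨dyad n / 4, 0⟩ with hz
      set w := topMidVertex n + t * ⟨dyad n / 4, 0⟩ with hw
      have hre : z.re = 1 - dyad n + t * (dyad n / 4) := by simp [hz, topVertex]
      have him : z.im = 1 := by simp [hz, topVertex]
      have hm : z ∈ (Edge.C' n).side := by
        rw [Edge.mem_side_C', hre, him]
        exact ⟨rfl, by nlinarith, by nlinarith⟩
      have hre' : w.re = 1 - 3 * dyad n / 4 + t * (dyad n / 4) := by simp [hw, topMidVertex]
      have him' : w.im = 1 := by simp [hw, topMidVertex]
      have hm2 : w ∈ (Edge.C'' n).side := by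
        rw [Edge.mem_side_C'', hre', him']
        exact ⟨rfl, by nlinarith, by nlinarith⟩
      have hs : z + ⟨-1 / 2, 1 - 2 * z.im⟩ = w + (Edge.C'' n).shift := by
        rw [Edge.shift_C'']
        apply Complex.ext
        · simp [hre, hre']; ring
        · simp [him, him']; norm_num
      have hb := Edge.mem_side_C'.1 hm
      have hb' := Edge.mem_side_C''.1 hm2
      refine ⟨⟨side_subset _ hm, ⟨⟨by linarith, by linarith⟩, ⟨by linarith, by linarith⟩⟩⟩,
        ⟨side_subset _ hm2, ⟨⟨by linarith, by linarith⟩, ⟨by linarith, by linarith⟩⟩⟩, ?_⟩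
      rw [← pr_add_shift hm2, ← hs]
      exact (rho_upper (side_subset _ hm) (by linarith) (by linarith)).2
  refine ⟨this.1, ?_⟩
  convert this.2 using 1
  · apply Complex.ext <;> simp [topVertex, topMidVertex]; ring
  · apply Complex.ext <;> simp [topVertex, topMidVertex, dyad_succ]; ring

/-- The involution carries the second unlabeled edge to the segment from `i/2`, which is
`lowLeftVertex 1`, to the center. -/
lemma adjoining_center :
    Adjoining true ⟨1 / 2, 1 / 2⟩ (lowLeftVertex 1) ∧ Adjoining true (rightVertex 0) ⟨1 / 2, 1 / 2⟩ := by
  have := adjoining_of_segment (b := true) (a := ⟨1 / 2, 1 / 2⟩) (v := ⟨1 / 2, 0⟩)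
    (a' := lowLeftVertex 1) (v' := ⟨1 / 2, 0⟩) fun t ht0 ht1 => by
      set z : ℂ := ⟨1 / 2, 1 / 2⟩ + t * ⟨1 / 2, 0⟩ with hz
      have hre : z.re = 1 / 2 + t * (1 / 2) := by simp [hz]
      have him : z.im = 1 / 2 := by simp [hz]
      have hm : z ∈ Edge.unlabeled.side' := by
        rw [Edge.mem_side'_unlabeled]
        exact ⟨him, by linarith, by linarith⟩
      have hs : z + ⟨-1 / 2, 1 - 2 * z.im⟩ = lowLeftVertex 1 + t * ⟨1 / 2, 0⟩ := by
        apply Complex.ext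
        · simp [hre, lowLeftVertex]; ring
        · simp [him, lowLeftVertex, dyad]; norm_num
      have hr := rho_upper (side'_subset _ hm) (by linarith) (by linarith)
      rw [hs] at hr
      refine ⟨⟨side'_subset _ hm, ⟨⟨by linarith, by linarith⟩, ⟨by linarith, by linarith⟩⟩⟩,
        ⟨hr.1, ?_⟩, hr.2⟩
      rw [← hs]
      constructor <;> constructor <;> simp [hre, him] <;> linarith
  refine ⟨this.1, ?_⟩
  convert this.2 using 1
  · apply Complex.ext <;> simp [rightVertex, dyad_zero] <;> norm_num
  · apply Complex.ext <;> simp [lowLeftVertex, dyad]; norm_num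

/-! ### Connected neighbourhoods of the end -/

lemma tendsto_dyad : Filter.Tendsto dyad Filter.atTop (𝓝 0) := by
  have h : dyad = fun n => (1 / 2 : ℝ) ^ n := funext fun n => by simp [dyad]
  exact h ▸ tendsto_pow_atTop_nhds_zero_of_lt_one (by norm_num) (by norm_num)

lemma tendsto_mk {f g : ℝ → ℝ} (hf : Continuous f) (hg : Continuous g) :
    Filter.Tendsto (fun n => (⟨f (dyad n), g (dyad n)⟩ : ℂ)) Filter.atTop (𝓝 ⟨f 0, g 0⟩) := by
  have h : Continuous fun t => (⟨f t, g t⟩ : ℂ) := by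
    have : (fun t => (⟨f t, g t⟩ : ℂ)) = fun t => (f t : ℂ) + (g t : ℂ) * Complex.I :=
      funext fun t => (Complex.mk_eq_add_mul_I _ _)
    rw [this]
    fun_prop
  exact (h.tendsto 0).comp tendsto_dyad

lemma tendsto_rightVertex : Filter.Tendsto rightVertex Filter.atTop (𝓝 ⟨1, 1⟩) := by
  have := tendsto_mk (f := fun _ => 1) (g := fun t => 1 - t / 2) (by fun_prop) (by fun_prop)
  simp only [sub_zero, zero_div] at this
  exact this

lemma tendsto_topVertex : Filter.Tendsto topVertex Filter.atTop (𝓝 ⟨1, 1⟩) := by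
  have := tendsto_mk (f := fun t => 1 - t) (g := fun _ => 1) (by fun_prop) (by fun_prop)
  simp only [sub_zero] at this
  exact this

lemma tendsto_lowLeftVertex : Filter.Tendsto lowLeftVertex Filter.atTop (𝓝 ⟨0, 2 / 3⟩) := by
  have := tendsto_mk (f := fun _ => 0) (g := fun t => 2 / 3 - t / 3) (by fun_prop) (by fun_prop)
  simp only [sub_zero, zero_div] at this
  exact this

/-- A property of the vertices (in the two halves of the surface) that is preserved by adjacency
and by limits holds for all of them, if it holds for the corner of the upper rectangle. -/
lemma forall_vertex {G : Bool → ℂ → Prop}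
    (hadj : ∀ a b r r', IsVertex r' → Adjoining b r r' → G a r → G (a ^^ b) r')
    (hlim : ∀ a r, IsVertex r → ∀ᶠ r' in 𝓝 r, IsVertex r' → (G a r' ↔ G a r))
    (h : G false ⟨1, 1⟩) : ∀ a r, IsVertex r → G a r := by
  have ht : ∀ a r r', IsVertex r' → Adjoining true r r' → G a r → G (!a) r' :=
    fun a r r' h1 h2 h3 => by simpa using hadj a true r r' h1 h2 h3
  have ht' : ∀ a r r', IsVertex r' → Adjoining true r r' → G (!a) r → G a r' :=
    fun a r r' h1 h2 h3 => by simpa using hadj (!a) true r r' h1 h2 h3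
  have hf : ∀ a r r', IsVertex r' → Adjoining false r r' → G a r → G a r' :=
    fun a r r' h1 h2 h3 => by simpa using hadj a false r r' h1 h2 h3
  have hodd : ∀ {n : ℕ}, ¬ Even n → ¬ Even (n + 2) := by
    intro n hn; simpa [Nat.even_add] using hn
  have heven : ∀ {n : ℕ}, Even n → Even (n + 2) := by
    intro n hn; simpa [Nat.even_add] using hn
  have right_of_corner : ∀ a, G a ⟨1, 1⟩ → ∀ m, G a (rightVertex m) := by
    intro a h
    obtain ⟨M, hM⟩ := Filter.eventually_atTop.1 (tendsto_rightVertex.eventually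
      (hlim a _ isVertex_corner))
    -- Both right vertices adjoin the left vertex of index `n + 2`, where the edges of indices `n`
    -- and `n + 2` are consecutive; for even `n` two flips cancel.
    have hstep : ∀ n, G a (rightVertex (n + 2)) → G a (rightVertex (n + 1)) := by
      intro n hn
      by_cases he : Even n
      · exact ht' a _ _ (isVertex_right _) (adjoining_right_highLeft he).2.symm <|
          ht a _ _ (isVertex_highLeft (heven he)) (adjoining_right_highLeft (heven he)).1 hn
      · exact hf a _ _ (isVertex_right _) (adjoining_right_lowLeft he).2.symm <|
          hf a _ _ (isVertex_lowLeft (hodd he)) (adjoining_right_lowLeft (hodd he)).1 hn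
    have hpos : ∀ m, G a (rightVertex (m + 1)) := by
      intro m
      have h1 : ∀ k, G a (rightVertex (m + 1 + k)) → G a (rightVertex (m + 1)) := by
        intro k
        induction k with
        | zero => exact id
        | succ k ih =>
          intro hk
          refine ih ?_
          rw [show m + 1 + k = m + k + 1 by ring]
          exact hstep (m + k) (by rwa [show m + k + 2 = m + 1 + (k + 1) by ring])
      exact h1 M ((hM _ (by omega) (isVertex_right _)).2 h)
    rintro (_ | m)
    -- The last vertex `1 + i/2` is reached from `rightVertex 1` through `i/2` and the center, again
    -- with two flips.
    · have h1 : ¬ Even 1 := by decide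
      exact ht' a _ _ (isVertex_right _) adjoining_center.2.symm <|
        ht a _ _ isVertex_center adjoining_center.1.symm <|
        hf a _ _ (isVertex_lowLeft h1) (adjoining_right_lowLeft h1).1 (hpos 0)
    · exact hpos m
  have top_of_zero : ∀ a, G a (topVertex 0) → ∀ m, G a (topVertex m) := by
    intro a h m
    induction m with
    | zero => exact h
    | succ m ih =>
      exact ht' a _ _ (isVertex_top _) (adjoining_top m).2 <|
        ht a _ _ (isVertex_topMid _) (adjoining_top m).1 ih
  have high_of_corner : ∀ a, G a ⟨1, 1⟩ → ∀ n, Even n → G (!a) (highLeftVertex n) :=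
    fun a h n hn => ht a _ _ (isVertex_highLeft hn) (adjoining_right_highLeft hn).1
      (right_of_corner a h n)
  have top_of_corner : ∀ a, G a ⟨1, 1⟩ → ∀ m, G (!a) (topVertex m) := by
    intro a h
    refine top_of_zero _ ?_
    -- The corner `i` belongs to the left and to the top sequence. It is reached from the right with
    -- one flip, and the top sequence leads back to the corner `1 + i`; this joins the two halves of
    -- the surface.
    have : topVertex 0 = highLeftVertex 0 := by
      simp only [topVertex, highLeftVertex, dyad_zero]; norm_num
    exact this ▸ high_of_corner a h 0 (by decide)
  have corner_not : ∀ a, G a ⟨1, 1⟩ → G (!a) ⟨1, 1⟩ := by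
    intro a h
    obtain ⟨m, hm⟩ := (tendsto_topVertex.eventually (hlim (!a) _ isVertex_corner)).exists
    exact (hm (isVertex_top m)).1 (top_of_corner a h m)
  have hc : ∀ a, G a ⟨1, 1⟩ := by
    rintro (_ | _)
    exacts [h, corner_not false h]
  have hlow : ∀ a n, ¬ Even n → G a (lowLeftVertex n) := fun a n hn =>
    hf a _ _ (isVertex_lowLeft hn) (adjoining_right_lowLeft hn).1 (right_of_corner a (hc a) n)
  have htop : ∀ a m, G a (topVertex m) := fun a m => by
    simpa using top_of_corner (!a) (hc (!a)) m
  intro a r hr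
  rcases hr.cases with ⟨m, rfl⟩ | ⟨n, hn, rfl⟩ | ⟨n, hn, rfl⟩ | ⟨m, rfl⟩ | ⟨m, rfl⟩ | rfl | rfl | rfl
  · exact right_of_corner a (hc a) m
  · exact hlow a n hn
  · simpa using high_of_corner (!a) (hc (!a)) n hn
  · exact htop a m
  · simpa using ht (!a) _ _ hr (adjoining_top m).1 (htop (!a) m)
  · simpa using ht (!a) _ _ hr adjoining_center.2 (right_of_corner (!a) (hc (!a)) 0)
  · exact hc a
  -- The remaining limit point `2i/3` is approached by left vertices of odd index.
  · obtain ⟨N, hN⟩ := Filter.eventually_atTop.1 (tendsto_lowLeftVertex.eventually (hlim a _ hr))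
    have ho : ¬ Even (2 * N + 1) := not_even_two_mul_add_one N
    exact (hN (2 * N + 1) (by omega) (isVertex_lowLeft ho)).1 (hlow a _ ho)

/-- The union of the cells is connected. -/
lemma isPreconnected_iUnion_cell {ε : ℂ → ℝ} (hε : ∀ r, 0 < ε r) :
    IsPreconnected (⋃ b, ⋃ r, ⋃ _ : IsVertex r, cell ε b r) := by
  set N := ⋃ b, ⋃ r, ⋃ _ : IsVertex r, cell ε b r with hN
  have hsub : ∀ b r, IsVertex r → cell ε b r ⊆ N := fun b r hr =>
    subset_iUnion_of_subset b <| subset_iUnion_of_subset r <| subset_iUnion_of_subset hr subset_rfl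
  obtain ⟨x, hx⟩ := cell_nonempty false isVertex_corner.1 (hε ⟨1, 1⟩)
  have hxN := hsub _ _ isVertex_corner hx
  set D := connectedComponentIn N x with hD
  have hmeet : ∀ b r, IsVertex r → ∀ y ∈ cell ε b r, y ∈ D → cell ε b r ⊆ D := by
    intro b r hr y hy hyD
    rw [hD, connectedComponentIn_eq hyD]
    exact (isPreconnected_cell ε b r).subset_connectedComponentIn hy (hsub b r hr)
  have key := forall_vertex (G := fun b r => cell ε b r ⊆ D) ?_ ?_
    ((isPreconnected_cell ε _ _).subset_connectedComponentIn hx (hsub _ _ isVertex_corner))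
  · have : N = D := by
      refine subset_antisymm (iUnion_subset fun b => iUnion_subset fun r => iUnion_subset fun hr =>
        key b r hr) (connectedComponentIn_subset _ _)
    rw [this]
    exact isPreconnected_connectedComponentIn
  · intro a b r r' hr' hrr' hr
    obtain ⟨z, ⟨hz, hz'⟩, w, ⟨hw, hw'⟩, h⟩ := hrr' _ _ (isOpen_box r (ε r)) (isOpen_box r' (ε r'))
      (mem_box_self r (hε r)) (mem_box_self r' (hε r'))
    refine hmeet _ _ hr' (flip (a ^^ b) (pr w)) ⟨_, ⟨w, ⟨hw, hw'⟩, rfl⟩, rfl⟩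
      (hr ⟨_, ⟨z, ⟨hz, hz'⟩, rfl⟩, ?_⟩)
    rw [← h, flip_flip]
    simp
  · intro a r hr
    -- If `r'` lies in the square of `r`, the two squares share points of the open upper rectangle,
    -- however small the square of `r'` is.
    filter_upwards [(isOpen_box r (ε r)).mem_nhds (mem_box_self r (hε r))] with r' hr1 hr'
    obtain ⟨z, hz, hz1, hz2⟩ := exists_interior_mem hr'.1 ((isOpen_box r (ε r)).inter
      (isOpen_box r' (ε r'))) ⟨hr1, mem_box_self r' (hε r')⟩
    have h1 : flip a (pr z) ∈ cell ε a r := ⟨_, ⟨z, ⟨hz, hz1⟩, rfl⟩, rfl⟩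
    have h2 : flip a (pr z) ∈ cell ε a r' := ⟨_, ⟨z, ⟨hz, hz2⟩, rfl⟩, rfl⟩
    exact ⟨fun h => hmeet _ _ hr _ h1 (h h2), fun h => hmeet _ _ hr' _ h2 (h h1)⟩

/-- The complement of the union of the cells is contained in a compact set. -/
lemma exists_compact_compl_iUnion_cell {ε : ℂ → ℝ} (hε : ∀ r, 0 < ε r) :
    ∃ L : TopologicalSpace.Compacts XInf,
      (L : Set XInf)ᶜ ⊆ ⋃ b, ⋃ r, ⋃ _ : IsVertex r, cell ε b r := by
  -- Every point of the closed rectangle outside the polygon is the center of a removed square, so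
  -- `C` is a compact subset of the polygon.
  set C := upperRect \ ⋃ r, ⋃ _ : IsVertex r, box r (ε r) with hC
  have hCc : IsCompact C := (isCompact_Icc.reProdIm isCompact_Icc).diff
    (isOpen_iUnion fun r => isOpen_iUnion fun _ => isOpen_box _ _)
  have hCp : C ⊆ polygon := by
    rintro z ⟨hz, hz'⟩
    by_contra h
    exact hz' (mem_iUnion₂.2 ⟨z, ⟨hz, h⟩, mem_box_self z (hε z)⟩)
  have hK : IsCompact (⋃ b, flip b '' (pr '' C)) :=
    isCompact_iUnion fun b => (hCc.image_of_continuousOn (continuousOn_pr.mono hCp)).image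
      (continuous_flip b)
  have hup : ∀ b, ∀ z ∈ polygon, z ∈ upperRect → flip b (pr z) ∉ (⋃ b, flip b '' (pr '' C)) →
      flip b (pr z) ∈ ⋃ b, ⋃ r, ⋃ _ : IsVertex r, cell ε b r := by
    intro b z hz hz' h
    have hzC : z ∉ C := fun h' => h (mem_iUnion.2 ⟨b, _, ⟨z, h', rfl⟩, rfl⟩)
    obtain ⟨r, hr, hzr⟩ := mem_iUnion₂.1 (not_not.1 fun h' => hzC ⟨hz', h'⟩)
    exact mem_iUnion.2 ⟨b, mem_iUnion₂.2 ⟨r, hr, _, ⟨z, ⟨⟨hz, hz'⟩, hzr⟩, rfl⟩, rfl⟩⟩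
  refine ⟨⟨_, hK⟩, fun x hx => ?_⟩
  obtain ⟨z, hz, rfl⟩ := exists_pr x
  rcases polygon_bounds hz with h | h
  · obtain ⟨h1, h2⟩ := rho_lower hz h.2.2.2 h.2.1
    have h3 : pr z = flip true (pr (z + ⟨1 / 2, 1 - 2 * z.im⟩)) := by
      rw [← h2]
      exact (rho_rho _).symm
    rw [h3] at hx ⊢
    refine hup _ _ h1 ?_ hx
    constructor <;> constructor <;> simp <;> linarith
  · exact hup false z hz ⟨⟨h.1, h.2.1⟩, ⟨h.2.2.1, h.2.2.2⟩⟩ hx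

/-- The points over a compact subset of the surface keep their distance from the points that do
not belong to the polygon. -/
lemma exists_dist_lt_of_isCompact {K : Set XInf} (hK : IsCompact K) {r : ℂ} (hr : r ∉ polygon) :
    ∃ e > 0, ∀ z ∈ polygon, dist z r < e → pr z ∉ K := by
  refine hK.induction_on (p := fun K => ∃ e > 0, ∀ z ∈ polygon, dist z r < e → pr z ∉ K)
    ⟨1, one_pos, fun _ _ _ => notMem_empty _⟩
    (fun s t hst ⟨e, he, h⟩ => ⟨e, he, fun z hz hzr hs => h z hz hzr (hst hs)⟩)
    (fun s t ⟨e, he, h⟩ ⟨e', he', h'⟩ => ⟨min e e', lt_min he he', fun z hz hzr hs =>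
      hs.elim (h z hz (hzr.trans_le (min_le_left _ _))) (h' z hz (hzr.trans_le (min_le_right _ _)))⟩)
    fun x _ => ?_
  obtain ⟨z, hz, rfl⟩ := exists_pr x
  -- The finite fibre keeps a distance `e` from `r`, and a saturated neighbourhood can be kept at
  -- distance `e / 2`.
  have hF := (finite_fiber z hz).isClosed.isOpen_compl
  obtain ⟨e, he, hball⟩ := Metric.isOpen_iff.1 hF r fun h => hr h.1
  obtain ⟨U, hU, hU1, hU2, hU3⟩ := exists_saturated hz (V := {w | e / 2 < dist w r})
    (isOpen_lt continuous_const (by fun_prop)) fun w hw hwz => by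
      by_contra h
      exact hball (show dist w r < e by simp only [mem_ofPred_eq, not_lt] at h; linarith) ⟨hw, hwz⟩
  refine ⟨_, mem_nhdsWithin_of_mem_nhds ((isOpen_descend hU hU1).mem_nhds hU3), e / 2, half_pos he,
    fun w hw hwr h => ?_⟩
  have : e / 2 < dist w r := hU2 ((pr_mem_descend hw).1 h)
  linarith

/-- The compact set is first made invariant under `rho`, so that radii chosen in the upper rectangle
also serve for the reflected cells. -/
lemma hasOneEnd : HasOneEnd XInf := by
  refine hasOneEnd_of_forall_compact fun K => ?_
  have hK : IsCompact (⋃ b, flip b '' (K : Set XInf)) :=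
    isCompact_iUnion fun b => K.isCompact.image (continuous_flip b)
  have h : ∀ r, ∃ e > 0, IsVertex r → ∀ z ∈ polygon, dist z r < e →
      pr z ∉ ⋃ b, flip b '' (K : Set XInf) := by
    intro r
    by_cases hr : IsVertex r
    · obtain ⟨e, he, h⟩ := exists_dist_lt_of_isCompact hK hr.2
      exact ⟨e, he, fun _ => h⟩
    · exact ⟨1, one_pos, fun h => (hr h).elim⟩
  choose e he h using h
  -- A square of half-side `e r / 2` lies within distance `e r` of its center.
  have hε : ∀ r, 0 < e r / 2 := fun r => half_pos (he r)
  refine ⟨⋃ b, ⋃ r, ⋃ _ : IsVertex r, cell (fun r => e r / 2) b r, ?_,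
    isPreconnected_iUnion_cell hε, ?_, exists_compact_compl_iUnion_cell hε⟩
  · refine iUnion_subset fun b => iUnion_subset fun r => iUnion_subset fun hr => ?_
    rintro _ ⟨_, ⟨z, ⟨⟨hz, -⟩, hzr⟩, rfl⟩, rfl⟩ hzK
    refine h r hr z hz (dist_lt_of_mem_box hzr) (mem_iUnion.2 ⟨b, _, hzK, ?_⟩)
    rw [flip_flip]
    simp [flip]
  · exact (cell_nonempty false isVertex_corner.1 (hε ⟨1, 1⟩)).mono
      (subset_iUnion_of_subset false <| subset_iUnion₂_of_subset _ isVertex_corner subset_rfl)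

end InfiniteAY

end

theorem theoremT :
    ∃ h : HasLocalCoordinates,
      letI : ChartedSpace ℂ XInf := chartedSpaceXInf h
      IsRiemannSurface XInf ∧ genus XInf = ⊤ ∧ HasOneEnd XInf ∧
      (omegaInf h).IsHolomorphic ∧ (omegaInf h).area < ⊤ ∧ (∀ x, omegaInf h x ≠ 0) ∧
      ∃ ρ ∈ (omegaInf h).Aff, ∃ ψ ∈ (omegaInf h).Aff,
        ((omegaInf h).ReversesOrientation ρ ∧ (omegaInf h).IsIsometric ρ ∧
          (∀ x, ρ (ρ x) = x) ∧ (∀ x, ρ x ≠ x)) ∧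
        ((omegaInf h).PreservesOrientation ψ ∧ (omegaInf h).IsPseudoAnosov ψ 2) ∧
        (∀ x, ρ (ψ x) = ψ (ρ x)) := by
  exact ⟨hasLocalCoordinates, isRiemannSurface, genus_eq_top, hasOneEnd, omega_isHolomorphic,
    omega_area_lt_top, omega_ne_zero, rho_psi_spec⟩
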